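/- Conventions. Let $M$ be a topological space. All étale groupoids over $M$ are Hausdorff: the arrow space is Hausdorff, the structure maps are continuous, and source and target are local homeomorphisms (étale Lie groupoids are a special case). The product $g_1g_2$ of arrows is defined when $t(g_1)=s(g_2)$, and then $s(g_1g_2)=s(g_1)$, $t(g_1g_2)=t(g_2)$. Fix a field $\mathbb K$ with a ring homomorphism $\mathbb C\to\mathbb K$ (e.g. $\mathbb C$ or $\mathbb C((\hbar))$). If $\mathcal G$ is an étale groupoid over $\mathcal G_0$, a $\mathcal G$-sheaf of unital $\mathbb K$-algebras is a sheaf $\mathcal S$ of unital $\mathbb K$-algebras on $\mathcal G_0$ on which each arrow $g:x\to y$ acts by a unital algebra map $\mathcal S_y\to\mathcal S_x$, functorially and continuously in $g$. For a locally constant $U(1)$-valued groupoid $2$-cocycle $c$ on $\mathcal G$, the $c$-twisted crossed product $\mathcal S\rtimes_c\mathcal G$ is the space $\Gamma_{\mathrm{cpt}}(\mathcal G,s^*\mathcal S)$ of compactly supported sections with the product $$(a_1*_c a_2)(g)=\sum_{g_1g_2=g}c(g_1,g_2)\,a_1(g_1)\,g_1\big(a_2(g_2)\big),$$ and $\mathcal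 S\rtimes\mathcal G$ is the case $c=1$. Let $\mathfrak Q$ be a proper étale groupoid over $M$ whose arrow space is a disjoint union of contractible open sets, let $G$ be a finite group, and let $$M\times G\xrightarrow{\ i\ }\mathfrak H\xrightarrow{\ j\ }\mathfrak Q$$ be an extension of étale groupoids over $M$: $i$ and $j$ are continuous groupoid morphisms that are the identity on $M$, $i$ is injective, $j$ is surjective on arrows, and the image of $i$ is the kernel of $j$. Let $\mathcal A$ be a $\mathfrak Q$-sheaf of unital $\mathbb K$-algebras on $M$, regarded through $j$ also as an $\mathfrak H$-sheaf, and assume that for each compact $K\subseteq M$ there is a compactly supported global section of $\mathcal A$ that is equal to $1$ at every point of $K$ (as holds for the sheaf of smooth functions and for its deformation quantizations). Let $\widehat G$ be the set of isomorphism classes of irreducible complex representations of $G$, and fix in each class $[\rho]$ a unitary representation $\rho$ on $V_\rho$. **Theorem.** 1. There is a continuous section $\sigma:\mathfrak Q\to\mathfrak H$ of $j$ that is the identity on units. 2. Let $\sigma$ be any such section, let $q\in\mathfrak Q$ act on $\widehat G$ by $q([\rho])=[\rho\circ\mathrm{Ad}_{\sigma(q)}]$, and let $\tau(q_1,q_2)=\sigma(q_1)\sigma(q_2)\sigma(q_1q_2)^{-1}\in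 G$. Then there are unitary operators $T^{[\rho]}_q:V_\rho\to V_{q([\rho])}$ with $T^{[\rho]}_q\,\rho(\mathrm{Ad}_{\sigma(q)}(g))=q([\rho])(g)\,T^{[\rho]}_q$ for all $g\in G$, which are locally constant in $q$ and are the identity when $q$ is a unit. 3. For each such $\sigma$ and $T$, the equation $$T^{q_1([\rho])}_{q_2}\circ T^{[\rho]}_{q_1}=c^{[\rho]}(q_1,q_2)\,T^{[\rho]}_{q_1q_2}\,\rho(\tau(q_1,q_2))^{-1}$$ defines a locally constant $U(1)$-valued $2$-cocycle $c$ on the transformation groupoid $\widehat G\rtimes\mathfrak Q$ over $\widehat G\times M$. If $\widetilde{\mathcal A}$ denotes the pull-back of $\mathcal A$ to a $\widehat G\rtimes\mathfrak Q$-sheaf on $\widehat G\times M$, then the algebras $$\mathcal A\rtimes\mathfrak H\qquad\text{and}\qquad\widetilde{\mathcal A}\rtimes_c(\widehat G\rtimes\mathfrak Q)$$ are Morita equivalent. Here algebras $A$, $B$, possibly without unit, are Morita equivalent if there are an $A$-$B$-bimodule $\mathcal M$ and a $B$-$A$-bimodule $\mathcal N$ that are essential (the actions induce isomorphisms $A\otimes_A\mathcal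 M\cong\mathcal M\cong\mathcal M\otimes_BB$ and $B\otimes_B\mathcal N\cong\mathcal N\cong\mathcal N\otimes_AA$), and bimodule isomorphisms $\Xi:\mathcal M\otimes_B\mathcal N\cong A$ and $\Theta:\mathcal N\otimes_A\mathcal M\cong B$ such that $\Xi(m,n)m'=m\,\Theta(n,m')$ and $\Theta(n,m)n'=n\,\Xi(m,n')$. -/

import Mathlib

universe u v w

open scoped Topology TensorProduct

namespace GerbeDuality

/-! ### Étale groupoids -/

/-- An arrow of a groupoid with set of objects `M`, together with its source and target. -/
structure Arrow {M : Type u} (Γ : CategoryTheory.Groupoid.{u} M) : Type u where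
  src : M
  tgt : M
  hom : Γ.Hom src tgt

/-- A composable pair of arrows `x ⟶ y ⟶ z`. -/
structure Composable {M : Type u} (Γ : CategoryTheory.Groupoid.{u} M) : Type u where
  x : M
  y : M
  z : M
  fst : Γ.Hom x y
  snd : Γ.Hom y z

/-- The space of composable pairs is a subspace of the product of two copies of the arrow space. -/
instance {M : Type u} (Γ : CategoryTheory.Groupoid.{u} M) [TopologicalSpace (Arrow Γ)] :
    TopologicalSpace (Composable Γ) :=
  TopologicalSpace.induced
    (fun p => ((⟨p.x, p.y, p.fst⟩ : Arrow Γ), (⟨p.y, p.z, p.snd⟩ : Arrow Γ))) inferInstance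

theorem Composable.continuous_fst {M : Type u} (Γ : CategoryTheory.Groupoid.{u} M)
    [TopologicalSpace (Arrow Γ)] :
    Continuous fun p : Composable Γ => (⟨p.x, p.y, p.fst⟩ : Arrow Γ) := by
  have h : Continuous fun p : Composable Γ => ((⟨p.x, p.y, p.fst⟩ : Arrow Γ), (⟨p.y, p.z, p.snd⟩ : Arrow Γ)) :=
    continuous_induced_dom
  exact h.fst

theorem Composable.continuous_snd {M : Type u} (Γ : CategoryTheory.Groupoid.{u} M)
    [TopologicalSpace (Arrow Γ)] :
    Continuous fun p : Composable Γ => (⟨p.y, p.z, p.snd⟩ : Arrow Γ) := by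
  have h : Continuous fun p : Composable Γ => ((⟨p.x, p.y, p.fst⟩ : Arrow Γ), (⟨p.y, p.z, p.snd⟩ : Arrow Γ)) :=
    continuous_induced_dom
  exact h.snd

/-- A (Hausdorff) étale groupoid with object space `M`.  The product of `g₁ : x ⟶ y` and
`g₂ : y ⟶ z` is the arrow `g₁ ≫ g₂ : x ⟶ z`.  Since inversion is a homeomorphism, the target
map is a local homeomorphism too. -/
structure EtaleGroupoid (M : Type u) [TopologicalSpace M] extends
    CategoryTheory.Groupoid.{u} M where
  [top : TopologicalSpace (Arrow toGroupoid)]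
  t2 : T2Space (Arrow toGroupoid)
  isLocalHomeomorph_src : IsLocalHomeomorph (Arrow.src : Arrow toGroupoid → M)
  continuous_id : Continuous fun x : M => (⟨x, x, toGroupoid.id x⟩ : Arrow toGroupoid)
  continuous_inv : Continuous fun a : Arrow toGroupoid =>
    (⟨a.tgt, a.src, toGroupoid.inv a.hom⟩ : Arrow toGroupoid)
  continuous_comp : Continuous fun p : Composable toGroupoid =>
    (⟨p.x, p.z, toGroupoid.comp p.fst p.snd⟩ : Arrow toGroupoid)

namespace EtaleGroupoid

variable {M : Type u} [TopologicalSpace M] (𝒢 : EtaleGroupoid M)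

/-- The space of arrows. -/
abbrev Arr : Type u := Arrow 𝒢.toGroupoid

instance : TopologicalSpace (Arrow 𝒢.toGroupoid) := 𝒢.top

instance : T2Space (Arrow 𝒢.toGroupoid) := 𝒢.t2

variable {𝒢}

/-- The space of arrows with prescribed source. -/
abbrev Out (𝒢 : EtaleGroupoid M) (x : M) : Type u := Σ y : M, 𝒢.Hom x y

/-- Left translation by an arrow. -/
def leftMul {x y : M} (r : 𝒢.Hom x y) : 𝒢.Out y ≃ 𝒢.Out x where
  toFun p := ⟨p.1, 𝒢.comp r p.2⟩
  invFun p := ⟨p.1, 𝒢.comp (𝒢.inv r) p.2⟩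
  left_inv p := by
    ext
    · rfl
    · simp only [heq_eq_eq]
      rw [← 𝒢.assoc, 𝒢.inv_comp, 𝒢.id_comp]
  right_inv p := by
    ext
    · rfl
    · simp only [heq_eq_eq]
      rw [← 𝒢.assoc, 𝒢.comp_inv, 𝒢.id_comp]

theorem inv_comp_eq {x y z : M} (p : 𝒢.Hom x y) (q : 𝒢.Hom x z) (r : 𝒢.Hom y z) :
    𝒢.comp (𝒢.inv p) q = r ↔ q = 𝒢.comp p r := by
  constructor
  · rintro rfl
    rw [← 𝒢.assoc, 𝒢.comp_inv, 𝒢.id_comp]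
  · rintro rfl
    rw [← 𝒢.assoc, 𝒢.inv_comp, 𝒢.id_comp]

theorem inv_comp_rev {x y z : M} (p : 𝒢.Hom x y) (q : 𝒢.Hom y z) :
    𝒢.inv (𝒢.comp p q) = 𝒢.comp (𝒢.inv q) (𝒢.inv p) := by
  have h := (inv_comp_eq (𝒢 := 𝒢) (𝒢.comp p q) (𝒢.id x) (𝒢.comp (𝒢.inv q) (𝒢.inv p))).2 (by
    rw [𝒢.assoc, ← 𝒢.assoc q, 𝒢.comp_inv, 𝒢.id_comp, 𝒢.comp_inv])
  rwa [𝒢.comp_id] at h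

theorem t2_base (𝒢 : EtaleGroupoid M) : T2Space M :=
  T2Space.of_injective_continuous (f := fun x : M => (⟨x, x, 𝒢.id x⟩ : 𝒢.Arr))
    (fun _ _ h => congrArg Arrow.src h) 𝒢.continuous_id

theorem continuous_src (𝒢 : EtaleGroupoid M) : Continuous (Arrow.src : 𝒢.Arr → M) :=
  𝒢.isLocalHomeomorph_src.continuous

theorem continuous_tgt (𝒢 : EtaleGroupoid M) : Continuous (Arrow.tgt : 𝒢.Arr → M) :=
  𝒢.continuous_src.comp 𝒢.continuous_inv

theorem finite_out (𝒢 : EtaleGroupoid M) {K : Set 𝒢.Arr} (hK : IsCompact K) (x : M) :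
    {p : 𝒢.Out x | (⟨x, p.1, p.2⟩ : 𝒢.Arr) ∈ K}.Finite := by
  have h1 : (K ∩ Arrow.src ⁻¹' {x}).Finite := by
    choose e he using 𝒢.isLocalHomeomorph_src
    obtain ⟨t, ht⟩ := hK.elim_finite_subcover (fun a => (e a).source)
      (fun a => (e a).open_source) (fun a _ => Set.mem_iUnion.2 ⟨a, (he a).1⟩)
    have : K ∩ Arrow.src ⁻¹' {x} ⊆ ⋃ a ∈ t, ((e a).source ∩ Arrow.src ⁻¹' {x}) := by
      rintro b ⟨hb, hx⟩
      obtain ⟨a, ha, hba⟩ := Set.mem_iUnion₂.1 (ht hb)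
      exact Set.mem_iUnion₂.2 ⟨a, ha, hba, hx⟩
    refine Set.Finite.subset (Set.Finite.biUnion t.finite_toSet fun a _ => ?_) this
    refine Set.Subsingleton.finite ?_
    rintro b ⟨hb, hb'⟩ d ⟨hd, hd'⟩
    refine (e a).injOn hb hd ?_
    rw [← (he a).2]
    exact hb'.trans hd'.symm
  refine Set.Finite.of_finite_image (f := fun p => (⟨x, p.1, p.2⟩ : 𝒢.Arr)) (h1.subset ?_) ?_
  · rintro _ ⟨p, hp, rfl⟩
    exact ⟨hp, rfl⟩
  · rintro ⟨y, p⟩ _ ⟨z, q⟩ _ h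
    simpa using h

/-- A groupoid is proper if `(s, t)` is a proper map from arrows to pairs of objects. -/
def IsProper (𝒢 : EtaleGroupoid M) : Prop :=
  IsProperMap fun a : 𝒢.Arr => (a.src, a.tgt)

end EtaleGroupoid

/-! ### Sheaves of algebras, as étalé spaces -/

/-- A point of the total space of a family of stalks. -/
structure Germ {M : Type u} (stalk : M → Type u) : Type u where
  base : M
  val : stalk base

/-- A pair of germs at the same point. -/
structure GermPair {M : Type u} (stalk : M → Type u) : Type u where
  base : M
  fst : stalk base
  snd : stalk base

instance {M : Type u} (stalk : M → Type u) [TopologicalSpace (Germ stalk)] :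
    TopologicalSpace (GermPair stalk) :=
  TopologicalSpace.induced
    (fun p => ((⟨p.base, p.fst⟩ : Germ stalk), (⟨p.base, p.snd⟩ : Germ stalk))) inferInstance

theorem GermPair.continuous_fst {M : Type u} (stalk : M → Type u)
    [TopologicalSpace (Germ stalk)] :
    Continuous fun p : GermPair stalk => (⟨p.base, p.fst⟩ : Germ stalk) := by
  have h : Continuous fun p : GermPair stalk => ((⟨p.base, p.fst⟩ : Germ stalk), (⟨p.base, p.snd⟩ : Germ stalk)) :=
    continuous_induced_dom
  exact h.fst

theorem GermPair.continuous_snd {M : Type u} (stalk : M → Type u)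
    [TopologicalSpace (Germ stalk)] :
    Continuous fun p : GermPair stalk => (⟨p.base, p.snd⟩ : Germ stalk) := by
  have h : Continuous fun p : GermPair stalk => ((⟨p.base, p.fst⟩ : Germ stalk), (⟨p.base, p.snd⟩ : Germ stalk)) :=
    continuous_induced_dom
  exact h.snd

/-- A sheaf of unital `𝕜`-algebras on `M`, given by its étalé space: a space over `M` whose
projection is a local homeomorphism and whose fibres (the stalks) are unital `𝕜`-algebras with
continuous operations.  The sections of the sheaf are the continuous sections of the
projection. -/
structure AlgebraSheaf (𝕜 : Type v) [Field 𝕜] (M : Type u) [TopologicalSpace M] where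
  stalk : M → Type u
  [ring : ∀ x, Ring (stalk x)]
  [algebra : ∀ x, Algebra 𝕜 (stalk x)]
  [top : TopologicalSpace (Germ stalk)]
  isLocalHomeomorph_base : IsLocalHomeomorph (Germ.base : Germ stalk → M)
  continuous_add : Continuous fun p : GermPair stalk => (⟨p.base, p.fst + p.snd⟩ : Germ stalk)
  continuous_mul : Continuous fun p : GermPair stalk => (⟨p.base, p.fst * p.snd⟩ : Germ stalk)
  continuous_smul : ∀ r : 𝕜, Continuous fun a : Germ stalk => (⟨a.base, r • a.val⟩ : Germ stalk)
  continuous_one : Continuous fun x : M => (⟨x, 1⟩ : Germ stalk)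

attribute [instance] AlgebraSheaf.ring AlgebraSheaf.algebra AlgebraSheaf.top

namespace AlgebraSheaf

variable {𝕜 : Type v} [Field 𝕜] {M : Type u} [TopologicalSpace M] (S : AlgebraSheaf 𝕜 M)

section Sections

variable {X : Type u} [TopologicalSpace X] {φ : X → M}

theorem sec_add {a b : ∀ x, S.stalk (φ x)}
    (ha : Continuous fun x => (⟨φ x, a x⟩ : Germ S.stalk))
    (hb : Continuous fun x => (⟨φ x, b x⟩ : Germ S.stalk)) :
    Continuous fun x => (⟨φ x, a x + b x⟩ : Germ S.stalk) :=
  S.continuous_add.comp (g := fun p : GermPair S.stalk => (⟨p.base, p.fst + p.snd⟩ : Germ S.stalk))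
    (f := fun x => ⟨φ x, a x, b x⟩) (continuous_induced_rng.2 (ha.prodMk hb))

theorem sec_mul {a b : ∀ x, S.stalk (φ x)}
    (ha : Continuous fun x => (⟨φ x, a x⟩ : Germ S.stalk))
    (hb : Continuous fun x => (⟨φ x, b x⟩ : Germ S.stalk)) :
    Continuous fun x => (⟨φ x, a x * b x⟩ : Germ S.stalk) :=
  S.continuous_mul.comp (g := fun p : GermPair S.stalk => (⟨p.base, p.fst * p.snd⟩ : Germ S.stalk))
    (f := fun x => ⟨φ x, a x, b x⟩) (continuous_induced_rng.2 (ha.prodMk hb))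

theorem sec_smul (r : 𝕜) {a : ∀ x, S.stalk (φ x)}
    (ha : Continuous fun x => (⟨φ x, a x⟩ : Germ S.stalk)) :
    Continuous fun x => (⟨φ x, r • a x⟩ : Germ S.stalk) :=
  (S.continuous_smul r).comp ha

theorem sec_one (hφ : Continuous φ) : Continuous fun x => (⟨φ x, 1⟩ : Germ S.stalk) :=
  S.continuous_one.comp hφ

theorem sec_zero (hφ : Continuous φ) : Continuous fun x => (⟨φ x, 0⟩ : Germ S.stalk) := by
  simpa using S.sec_smul 0 (S.sec_one hφ)

theorem sec_sum (hφ : Continuous φ) {ι : Type*} (t : Finset ι) {a : ι → ∀ x, S.stalk (φ x)}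
    (ha : ∀ i ∈ t, Continuous fun x => (⟨φ x, a i x⟩ : Germ S.stalk)) :
    Continuous fun x => (⟨φ x, ∑ i ∈ t, a i x⟩ : Germ S.stalk) := by
  classical
  induction t using Finset.induction_on with
  | empty => simpa using S.sec_zero hφ
  | insert i t hi ih =>
    simp only [Finset.sum_insert hi]
    exact S.sec_add (ha i (Finset.mem_insert_self _ _))
      (ih fun k hk => ha k (Finset.mem_insert_of_mem hk))

/-- Scaling by a locally constant function. -/
theorem sec_locConst_smul {r : X → 𝕜} (hr : IsLocallyConstant r) {a : ∀ x, S.stalk (φ x)}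
    (ha : Continuous fun x => (⟨φ x, a x⟩ : Germ S.stalk)) :
    Continuous fun x => (⟨φ x, r x • a x⟩ : Germ S.stalk) := by
  rw [continuous_iff_continuousAt]
  intro x₀
  refine (S.sec_smul (r x₀) ha).continuousAt.congr ?_
  filter_upwards [hr.eventually_eq x₀] with x hx
  rw [hx]

theorem isClosed_support (hφ : Continuous φ) {a : ∀ x, S.stalk (φ x)}
    (ha : Continuous fun x => (⟨φ x, a x⟩ : Germ S.stalk)) : IsClosed {x | a x ≠ 0} := by
  rw [← isOpen_compl_iff]
  convert S.isLocalHomeomorph_base.isLocallyInjective.isOpen_eqLocus ha (S.sec_zero hφ) rfl using 1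
  ext x
  simp

end Sections

end AlgebraSheaf

/-- A germ based at the target of an arrow. -/
structure ArrowGerm {M : Type u} (Γ : CategoryTheory.Groupoid.{u} M) (stalk : M → Type u) :
    Type u where
  x : M
  y : M
  hom : Γ.Hom x y
  val : stalk y

instance {M : Type u} (Γ : CategoryTheory.Groupoid.{u} M) (stalk : M → Type u)
    [TopologicalSpace (Arrow Γ)] [TopologicalSpace (Germ stalk)] :
    TopologicalSpace (ArrowGerm Γ stalk) :=
  TopologicalSpace.induced
    (fun p => ((⟨p.x, p.y, p.hom⟩ : Arrow Γ), (⟨p.y, p.val⟩ : Germ stalk))) inferInstance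

theorem ArrowGerm.continuous_arrow {M : Type u} (Γ : CategoryTheory.Groupoid.{u} M)
    (stalk : M → Type u) [TopologicalSpace (Arrow Γ)] [TopologicalSpace (Germ stalk)] :
    Continuous fun p : ArrowGerm Γ stalk => (⟨p.x, p.y, p.hom⟩ : Arrow Γ) := by
  have h : Continuous fun p : ArrowGerm Γ stalk => ((⟨p.x, p.y, p.hom⟩ : Arrow Γ), (⟨p.y, p.val⟩ : Germ stalk)) :=
    continuous_induced_dom
  exact h.fst

theorem ArrowGerm.continuous_germ {M : Type u} (Γ : CategoryTheory.Groupoid.{u} M)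
    (stalk : M → Type u) [TopologicalSpace (Arrow Γ)] [TopologicalSpace (Germ stalk)] :
    Continuous fun p : ArrowGerm Γ stalk => (⟨p.y, p.val⟩ : Germ stalk) := by
  have h : Continuous fun p : ArrowGerm Γ stalk => ((⟨p.x, p.y, p.hom⟩ : Arrow Γ), (⟨p.y, p.val⟩ : Germ stalk)) :=
    continuous_induced_dom
  exact h.snd

/-- A `𝒢`-sheaf of unital algebras: an arrow `g : x ⟶ y` acts by a unital algebra map from the
stalk at `y` to the stalk at `x`, functorially and continuously. -/
structure EquivariantSheaf (𝕜 : Type v) [Field 𝕜] {M : Type u} [TopologicalSpace M]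
    (𝒢 : EtaleGroupoid M) extends AlgebraSheaf 𝕜 M where
  act : ∀ {x y : M}, 𝒢.Hom x y → (stalk y →ₐ[𝕜] stalk x)
  act_id : ∀ (x : M) (a : stalk x), act (𝒢.id x) a = a
  act_comp : ∀ {x y z : M} (g : 𝒢.Hom x y) (h : 𝒢.Hom y z) (a : stalk z),
    act (𝒢.comp g h) a = act g (act h a)
  continuous_act : Continuous fun p : ArrowGerm 𝒢.toGroupoid stalk =>
    (⟨p.x, act p.hom p.val⟩ : Germ stalk)

/-- A locally constant `U(1)`-valued groupoid `2`-cocycle. -/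
structure LocConstCocycle {M : Type u} [TopologicalSpace M] (𝒢 : EtaleGroupoid M) where
  toFun : ∀ {x y z : M}, 𝒢.Hom x y → 𝒢.Hom y z → Circle
  isLocallyConstant :
    IsLocallyConstant fun p : Composable 𝒢.toGroupoid => toFun p.fst p.snd
  cocycle : ∀ {w x y z : M} (g₁ : 𝒢.Hom w x) (g₂ : 𝒢.Hom x y) (g₃ : 𝒢.Hom y z),
    toFun g₁ g₂ * toFun (𝒢.comp g₁ g₂) g₃ = toFun g₁ (𝒢.comp g₂ g₃) * toFun g₂ g₃

/-- The trivial cocycle. -/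
noncomputable def LocConstCocycle.trivial {M : Type u} [TopologicalSpace M] (𝒢 : EtaleGroupoid M) :
    LocConstCocycle 𝒢 where
  toFun _ _ := 1
  isLocallyConstant := IsLocallyConstant.const 1
  cocycle _ _ _ := rfl

/-! ### Twisted crossed products -/

section CrossedProduct

variable {𝕜 : Type v} [Field 𝕜] {M : Type u} [TopologicalSpace M]
  {𝒢 : EtaleGroupoid M} (S : EquivariantSheaf 𝕜 𝒢)

/-- The space `Γ_cpt(𝒢, s^* S)` of compactly supported sections of the pull-back of `S` along
the source map.  (The support `{a | f a ≠ 0}` of a section of a sheaf is closed.) -/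
def compactSections : Submodule 𝕜 (∀ a : 𝒢.Arr, S.stalk a.src) where
  carrier := {f | (Continuous fun a : 𝒢.Arr => (⟨a.src, f a⟩ : Germ S.stalk)) ∧
    IsCompact {a | f a ≠ 0}}
  zero_mem' := ⟨S.sec_zero 𝒢.continuous_src, by simp⟩
  add_mem' := by
    rintro f g ⟨hf, hf'⟩ ⟨hg, hg'⟩
    have h := S.sec_add hf hg
    refine ⟨h, (hf'.union hg').of_isClosed_subset (S.isClosed_support 𝒢.continuous_src h) ?_⟩
    intro a ha
    by_contra hn
    have h1 : f a = 0 := by_contra fun h => hn (Or.inl h)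
    have h2 : g a = 0 := by_contra fun h => hn (Or.inr h)
    exact ha (by simp [h1, h2])
  smul_mem' := by
    rintro r f ⟨hf, hf'⟩
    have h := S.sec_smul r hf
    refine ⟨h, hf'.of_isClosed_subset (S.isClosed_support 𝒢.continuous_src h) ?_⟩
    intro a ha h0
    exact ha (by simp [h0])

variable {S}

theorem finite_support {f : ∀ a : 𝒢.Arr, S.stalk a.src} (hf : f ∈ compactSections S) (x : M) :
    {p : 𝒢.Out x | f ⟨x, p.1, p.2⟩ ≠ 0}.Finite :=
  𝒢.finite_out hf.2 x

theorem section_congr (f : ∀ a : 𝒢.Arr, S.stalk a.src) {x y : M} {p q : 𝒢.Hom x y} (h : p = q) :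
    (f ⟨x, y, p⟩ : S.stalk x) = f ⟨x, y, q⟩ := by
  subst h; rfl

/-- Read an arrow as an arrow out of a point known to be its source. -/
def toOut (b : 𝒢.Arr) (x : M) (h : b.src = x) : 𝒢.Out x := ⟨b.tgt, h ▸ b.hom⟩

theorem mk_toOut (b : 𝒢.Arr) (x : M) (h : b.src = x) :
    (⟨x, (toOut b x h).1, (toOut b x h).2⟩ : 𝒢.Arr) = b := by
  subst h; rfl

variable [Algebra ℂ 𝕜] (S) (c : LocConstCocycle 𝒢)

/-- The factor `c(p, p⁻¹q) · f(p) · p(g(p⁻¹q))`. -/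
def convTerm (f g : ∀ a : 𝒢.Arr, S.stalk a.src) {x y z : M} (p : 𝒢.Hom x y) (q : 𝒢.Hom x z) :
    S.stalk x :=
  algebraMap ℂ 𝕜 (c.toFun p (𝒢.comp (𝒢.inv p) q)) •
    (f ⟨x, y, p⟩ * S.act p (g ⟨y, z, 𝒢.comp (𝒢.inv p) q⟩))

/-- The `c`-twisted convolution
`(f * g)(q) = ∑_{q = q₁ q₂} c(q₁, q₂) f(q₁) q₁(g(q₂))`;
the sum is over all arrows `q₁` with the same source as `q`, and `q₂ = q₁⁻¹ q`. -/
noncomputable def conv (f g : ∀ a : 𝒢.Arr, S.stalk a.src) : ∀ a : 𝒢.Arr, S.stalk a.src :=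
  fun a => ∑ᶠ p : 𝒢.Out a.src, convTerm S c f g p.2 a.hom

variable {S c}

theorem convTerm_ne_zero {f g : ∀ a : 𝒢.Arr, S.stalk a.src} {x y z : M} {p : 𝒢.Hom x y}
    {q : 𝒢.Hom x z} (h : convTerm S c f g p q ≠ 0) :
    f ⟨x, y, p⟩ ≠ 0 ∧ g ⟨y, z, 𝒢.comp (𝒢.inv p) q⟩ ≠ 0 := by
  constructor <;> intro h0 <;> exact h (by simp [convTerm, h0])

theorem finite_convTerm {f : ∀ a : 𝒢.Arr, S.stalk a.src} (hf : f ∈ compactSections S)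
    (g : ∀ a : 𝒢.Arr, S.stalk a.src) (a : 𝒢.Arr) :
    (Function.support fun p : 𝒢.Out a.src => convTerm S c f g p.2 a.hom).Finite :=
  (finite_support hf a.src).subset fun _ hp => (convTerm_ne_zero hp).1

/-- The convolution term is continuous in its arguments. -/
theorem continuous_convTerm {f g : ∀ a : 𝒢.Arr, S.stalk a.src}
    (hf : Continuous fun a : 𝒢.Arr => (⟨a.src, f a⟩ : Germ S.stalk))
    (hg : Continuous fun a : 𝒢.Arr => (⟨a.src, g a⟩ : Germ S.stalk))
    {X : Type u} [TopologicalSpace X] {x y z : X → M} {p : ∀ w, 𝒢.Hom (x w) (y w)}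
    {q : ∀ w, 𝒢.Hom (x w) (z w)}
    (hp : Continuous fun w => (⟨x w, y w, p w⟩ : 𝒢.Arr))
    (hq : Continuous fun w => (⟨x w, z w, q w⟩ : 𝒢.Arr)) :
    Continuous fun w => (⟨x w, convTerm S c f g (p w) (q w)⟩ : Germ S.stalk) := by
  have h1 : Continuous fun w => (⟨y w, z w, 𝒢.comp (𝒢.inv (p w)) (q w)⟩ : 𝒢.Arr) :=
    𝒢.continuous_comp.comp (f := fun w => (⟨y w, x w, z w, 𝒢.inv (p w), q w⟩ :
      Composable 𝒢.toGroupoid)) (continuous_induced_rng.2 ((𝒢.continuous_inv.comp hp).prodMk hq))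
  have h2 : Continuous fun w => (⟨x w, y w, z w, p w, 𝒢.comp (𝒢.inv (p w)) (q w)⟩ :
      Composable 𝒢.toGroupoid) := continuous_induced_rng.2 (hp.prodMk h1)
  have h3 : IsLocallyConstant fun w =>
      algebraMap ℂ 𝕜 (c.toFun (p w) (𝒢.comp (𝒢.inv (p w)) (q w))) :=
    (c.isLocallyConstant.comp_continuous h2).comp (fun r : Circle => algebraMap ℂ 𝕜 r)
  refine S.sec_locConst_smul h3 (S.sec_mul (hf.comp hp) ?_)
  exact S.continuous_act.comp (f := fun w => (⟨x w, y w, p w,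
    g ⟨y w, z w, 𝒢.comp (𝒢.inv (p w)) (q w)⟩⟩ : ArrowGerm 𝒢.toGroupoid S.stalk))
    (continuous_induced_rng.2 (hp.prodMk (hg.comp h1)))

theorem conv_continuous {f g : ∀ a : 𝒢.Arr, S.stalk a.src} (hf : f ∈ compactSections S)
    (hg : g ∈ compactSections S) :
    Continuous fun a : 𝒢.Arr => (⟨a.src, conv S c f g a⟩ : Germ S.stalk) := by
  classical
  have := 𝒢.t2_base
  rw [continuous_iff_continuousAt]
  intro a₀
  choose e he using 𝒢.isLocalHomeomorph_src
  set F : Finset (𝒢.Out a₀.src) := (finite_support hf a₀.src).toFinset with hF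
  let m : 𝒢.Out a₀.src → 𝒢.Arr := fun p => ⟨a₀.src, p.1, p.2⟩
  have hm : Function.Injective m := by
    rintro ⟨y, p⟩ ⟨z, q⟩ h
    simpa [m] using h
  -- the local sections through the points of `F`
  let β : 𝒢.Out a₀.src → M → 𝒢.Arr := fun p => (e (m p)).symm
  have hβ0 : ∀ p, β p a₀.src = m p := fun p => by
    have := (e (m p)).left_inv (he (m p)).1
    rwa [← (he (m p)).2] at this
  have hmem : ∀ p, a₀.src ∈ (e (m p)).target := fun p => by
    have := (e (m p)).map_source (he (m p)).1
    rwa [← (he (m p)).2] at this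
  have hsrc : ∀ p, ∀ x ∈ (e (m p)).target, (β p x).src = x := fun p x hx => by
    have := (e (m p)).right_inv hx
    rwa [← (he (m p)).2] at this
  have hcont : ∀ p, ContinuousOn (β p) (e (m p)).target := fun p => (e (m p)).continuousOn_symm
  -- the neighbourhood
  let V₁ : Set M := ⋂ p ∈ F, (e (m p)).target
  have hV₁ : V₁ ∈ 𝓝 a₀.src :=
    (Filter.biInter_finset_mem F).2 fun p _ => (e (m p)).open_target.mem_nhds (hmem p)
  let V₂ : Set M := ⋂ p ∈ F, ⋂ r ∈ F, {x | p ≠ r → β p x ≠ β r x}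
  have hV₂ : V₂ ∈ 𝓝 a₀.src := by
    refine (Filter.biInter_finset_mem F).2 fun p _ => (Filter.biInter_finset_mem F).2 fun r _ => ?_
    by_cases hpr : p = r
    · simp [hpr]
    · have h1 := (hcont p).continuousAt ((e (m p)).open_target.mem_nhds (hmem p))
      have h2 := (hcont r).continuousAt ((e (m r)).open_target.mem_nhds (hmem r))
      have hne : β p a₀.src ≠ β r a₀.src := by
        rw [hβ0, hβ0]
        exact fun h => hpr (hm h)
      filter_upwards [(h1.ne_iff_eventually_ne h2).1 hne] with x hx _ using hx
  let K : Set 𝒢.Arr := {a | f a ≠ 0}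
  let V₃ : Set M := (Arrow.src '' (K \ ⋃ p ∈ F, (e (m p)).source))ᶜ
  have hV₃ : V₃ ∈ 𝓝 a₀.src := by
    have hcpt : IsCompact (K \ ⋃ p ∈ F, (e (m p)).source) :=
      hf.2.diff (isOpen_biUnion fun p _ => (e (m p)).open_source)
    refine (hcpt.image 𝒢.continuous_src).isClosed.isOpen_compl.mem_nhds ?_
    rintro ⟨b, ⟨hbK, hb⟩, hbs⟩
    refine hb (Set.mem_iUnion₂.2 ⟨toOut b _ hbs, ?_, ?_⟩)
    · have h1 : (⟨a₀.src, (toOut b _ hbs).1, (toOut b _ hbs).2⟩ : 𝒢.Arr) ∈ K := by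
        rw [mk_toOut]
        exact hbK
      exact (Set.Finite.mem_toFinset _).2 h1
    · have : m (toOut b a₀.src hbs) = b := mk_toOut b _ hbs
      have h2 := (he (m (toOut b a₀.src hbs))).1
      rwa [this] at h2 ⊢
  obtain ⟨V, hVsub, hVo, hVm⟩ :=
    mem_nhds_iff.1 (Filter.inter_mem hV₁ (Filter.inter_mem hV₂ hV₃))
  let W : Set 𝒢.Arr := Arrow.src ⁻¹' V
  have hWo : IsOpen W := hVo.preimage 𝒢.continuous_src
  refine ContinuousOn.continuousAt (s := W) ?_ (hWo.mem_nhds hVm)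
  rw [continuousOn_iff_continuous_domRestrict]
  have hs : ∀ (w : W) (p : F), (β p w.1.src).src = w.1.src := fun w p =>
    hsrc _ _ (Set.mem_iInter₂.1 (hVsub w.2).1 p.1 p.2)
  let r : F → ∀ w : W, 𝒢.Out w.1.src := fun p w => toOut (β p w.1.src) w.1.src (hs w p)
  have hrmk : ∀ (p : F) (w : W), (⟨w.1.src, (r p w).1, (r p w).2⟩ : 𝒢.Arr) = β p w.1.src :=
    fun p w => mk_toOut _ _ _
  have key : ∀ w : W, conv S c f g w.1 =
      ∑ p ∈ Finset.univ, convTerm S c f g (r p w).2 w.1.hom := by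
    intro w
    have hinj : Function.Injective fun p : F => r p w := by
      intro p p' h
      by_contra hne
      have hne' : (p : 𝒢.Out a₀.src) ≠ p' := fun h => hne (Subtype.ext h)
      have h2 := Set.mem_iInter₂.1 (Set.mem_iInter₂.1 (hVsub w.2).2.1 p.1 p.2) p'.1 p'.2 hne'
      apply h2
      rw [← hrmk, ← hrmk]
      simp only at h
      rw [h]
    have hsub : (Function.support fun p : 𝒢.Out w.1.src => convTerm S c f g p.2 w.1.hom) ⊆
        ((Finset.univ.map ⟨fun p : F => r p w, hinj⟩ : Finset (𝒢.Out w.1.src)) :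
          Set (𝒢.Out w.1.src)) := by
      intro p hp
      have hpK : (⟨w.1.src, p.1, p.2⟩ : 𝒢.Arr) ∈ K := (convTerm_ne_zero hp).1
      by_contra hn
      refine (hVsub w.2).2.2 ⟨_, ⟨hpK, ?_⟩, rfl⟩
      intro hU
      obtain ⟨p₀, hp₀, hps⟩ := Set.mem_iUnion₂.1 hU
      apply hn
      simp only [Finset.coe_map, Function.Embedding.coeFn_mk, Finset.coe_univ, Set.image_univ,
        Set.mem_range]
      refine ⟨⟨p₀, hp₀⟩, ?_⟩
      have h3 : β p₀ w.1.src = ⟨w.1.src, p.1, p.2⟩ := by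
        have := (e (m p₀)).left_inv hps
        rwa [← (he (m p₀)).2] at this
      have h4 := (hrmk ⟨p₀, hp₀⟩ w).trans h3
      generalize r ⟨p₀, hp₀⟩ w = rr at h4
      obtain ⟨y, rr⟩ := rr
      obtain ⟨y', p⟩ := p
      simpa using h4
    unfold conv
    rw [finsum_eq_sum_of_support_subset _ hsub, Finset.sum_map]
    rfl
  have : W.domRestrict (fun a : 𝒢.Arr => (⟨a.src, conv S c f g a⟩ : Germ S.stalk)) =
      fun w : W => ⟨w.1.src, ∑ p ∈ Finset.univ, convTerm S c f g (r p w).2 w.1.hom⟩ := by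
    funext w
    simp only [Set.domRestrict_apply]
    rw [key w]
  rw [this]
  refine S.sec_sum (φ := fun w : W => w.1.src)
    (𝒢.continuous_src.comp continuous_subtype_val) Finset.univ
    (a := fun p w => convTerm S c f g (r p w).2 w.1.hom) fun p _ => ?_
  refine continuous_convTerm hf.1 hg.1 ?_ continuous_subtype_val
  simp only [hrmk]
  refine (hcont p).comp_continuous (𝒢.continuous_src.comp continuous_subtype_val) fun w => ?_
  exact Set.mem_iInter₂.1 (hVsub w.2).1 p.1 p.2

theorem conv_mem {f g : ∀ a : 𝒢.Arr, S.stalk a.src} (hf : f ∈ compactSections S)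
    (hg : g ∈ compactSections S) : conv S c f g ∈ compactSections S := by
  classical
  have := 𝒢.t2_base
  have hc := conv_continuous (c := c) hf hg
  refine ⟨hc, ?_⟩
  let ι : Composable 𝒢.toGroupoid → 𝒢.Arr × 𝒢.Arr :=
    fun p => (⟨p.x, p.y, p.fst⟩, ⟨p.y, p.z, p.snd⟩)
  have hι : Topology.IsClosedEmbedding ι := by
    refine ⟨⟨⟨rfl⟩, ?_⟩, ?_⟩
    · rintro ⟨x, y, z, p, q⟩ ⟨x', y', z', p', q'⟩ h
      simp only [ι, Prod.mk.injEq, Arrow.mk.injEq] at h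
      obtain ⟨⟨rfl, rfl, hp⟩, ⟨-, rfl, hq⟩⟩ := h
      obtain rfl := eq_of_heq hp
      obtain rfl := eq_of_heq hq
      rfl
    · have : Set.range ι = {p | p.1.tgt = p.2.src} := by
        ext ⟨⟨x, y, p⟩, ⟨y', z, q⟩⟩
        constructor
        · rintro ⟨t, ht⟩
          rw [← ht]
          rfl
        · rintro h
          change y = y' at h
          subst h
          exact ⟨⟨x, y, z, p, q⟩, rfl⟩
      rw [this]
      exact isClosed_eq (𝒢.continuous_tgt.comp continuous_fst) (𝒢.continuous_src.comp continuous_snd)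
  have hK := (hι.isCompact_preimage (hf.2.prod hg.2)).image 𝒢.continuous_comp
  refine hK.of_isClosed_subset (S.isClosed_support 𝒢.continuous_src hc) ?_
  intro a ha
  obtain ⟨p, hp⟩ : ∃ p : 𝒢.Out a.src, convTerm S c f g p.2 a.hom ≠ 0 := by
    by_contra hn
    push Not at hn
    exact ha (by simp [conv, hn])
  obtain ⟨h1, h2⟩ := convTerm_ne_zero hp
  refine ⟨⟨a.src, p.1, a.tgt, p.2, 𝒢.comp (𝒢.inv p.2) a.hom⟩, ⟨h1, h2⟩, ?_⟩
  simp only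
  rw [← 𝒢.assoc, 𝒢.comp_inv, 𝒢.id_comp]

theorem conv_eq_sum {f g : ∀ a : 𝒢.Arr, S.stalk a.src} (a : 𝒢.Arr) (t : Finset (𝒢.Out a.src))
    (ht : ∀ p : 𝒢.Out a.src, f ⟨a.src, p.1, p.2⟩ ≠ 0 → p ∈ t) :
    conv S c f g a = ∑ p ∈ t, convTerm S c f g p.2 a.hom :=
  finsum_eq_sum_of_support_subset _ fun p hp => ht p (convTerm_ne_zero hp).1

theorem conv_assoc {f g h : ∀ a : 𝒢.Arr, S.stalk a.src} (hf : f ∈ compactSections S)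
    (hg : g ∈ compactSections S) :
    conv S c (conv S c f g) h = conv S c f (conv S c g h) := by
  classical
  funext a
  obtain ⟨x, z, q⟩ := a
  set Sf := (finite_support hf x).toFinset with hSf
  have hSf' : ∀ p : 𝒢.Out x, f ⟨x, p.1, p.2⟩ ≠ 0 → p ∈ Sf := fun p hp => by simpa [hSf] using hp
  let Sg : ∀ y, Finset (𝒢.Out y) := fun y => (finite_support hg y).toFinset
  have hSg : ∀ y, ∀ p : 𝒢.Out y, g ⟨y, p.1, p.2⟩ ≠ 0 → p ∈ Sg y := fun y p hp => by
    simpa [Sg] using hp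
  let T : Finset (𝒢.Out x) := Sf.biUnion fun r => (Sg r.1).map (EtaleGroupoid.leftMul r.2).toEmbedding
  have hT : ∀ p : 𝒢.Out x, conv S c f g ⟨x, p.1, p.2⟩ ≠ 0 → p ∈ T := by
    intro p hp
    obtain ⟨r, hr⟩ : ∃ r : 𝒢.Out x, convTerm S c f g r.2 p.2 ≠ 0 := by
      by_contra hn
      push Not at hn
      exact hp (by simp [conv, hn])
    obtain ⟨h1, h2⟩ := convTerm_ne_zero hr
    refine Finset.mem_biUnion.2 ⟨r, hSf' r h1, Finset.mem_map.2
      ⟨⟨p.1, 𝒢.comp (𝒢.inv r.2) p.2⟩, hSg _ _ h2, ?_⟩⟩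
    exact (EtaleGroupoid.leftMul r.2).apply_symm_apply p
  rw [conv_eq_sum _ T hT, conv_eq_sum _ Sf hSf']
  have step : ∀ p ∈ T, convTerm S c (conv S c f g) h p.2 q =
      ∑ r ∈ Sf, algebraMap ℂ 𝕜 (c.toFun p.2 (𝒢.comp (𝒢.inv p.2) q)) •
        (convTerm S c f g r.2 p.2 * S.act p.2 (h ⟨p.1, z, 𝒢.comp (𝒢.inv p.2) q⟩)) := by
    intro p _
    rw [convTerm, conv_eq_sum _ Sf hSf', Finset.sum_mul, Finset.smul_sum]
  rw [Finset.sum_congr rfl step, Finset.sum_comm]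
  refine Finset.sum_congr rfl fun r hr => ?_
  rw [convTerm, conv_eq_sum _ (Sg r.1) (hSg r.1), map_sum, Finset.mul_sum, Finset.smul_sum]
  symm
  rw [← Finset.sum_subset (s₁ := (Sg r.1).map (EtaleGroupoid.leftMul r.2).toEmbedding) (s₂ := T),
    Finset.sum_map]
  · refine Finset.sum_congr rfl fun v _ => ?_
    have e1 : 𝒢.comp (𝒢.inv r.2) (𝒢.comp r.2 v.2) = v.2 :=
      (EtaleGroupoid.inv_comp_eq _ _ _).2 rfl
    have e2 : 𝒢.comp (𝒢.inv (𝒢.comp r.2 v.2)) q = 𝒢.comp (𝒢.inv v.2) (𝒢.comp (𝒢.inv r.2) q) := by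
      rw [EtaleGroupoid.inv_comp_rev, 𝒢.assoc]
    have e3 : 𝒢.comp v.2 (𝒢.comp (𝒢.inv v.2) (𝒢.comp (𝒢.inv r.2) q)) = 𝒢.comp (𝒢.inv r.2) q := by
      rw [← 𝒢.assoc, 𝒢.comp_inv, 𝒢.id_comp]
    have hc := c.cocycle r.2 v.2 (𝒢.comp (𝒢.inv v.2) (𝒢.comp (𝒢.inv r.2) q))
    rw [e3] at hc
    have hc' := congrArg (fun t : Circle => algebraMap ℂ 𝕜 t) hc
    simp only [Circle.coe_mul, map_mul] at hc'
    change _ = algebraMap ℂ 𝕜 (c.toFun (𝒢.comp r.2 v.2) (𝒢.comp (𝒢.inv (𝒢.comp r.2 v.2)) q)) •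
      (algebraMap ℂ 𝕜 (c.toFun r.2 (𝒢.comp (𝒢.inv r.2) (𝒢.comp r.2 v.2))) •
        (f ⟨x, r.1, r.2⟩ * S.act r.2 (g ⟨r.1, v.1, 𝒢.comp (𝒢.inv r.2) (𝒢.comp r.2 v.2)⟩)) *
        S.act (𝒢.comp r.2 v.2) (h ⟨v.1, z, 𝒢.comp (𝒢.inv (𝒢.comp r.2 v.2)) q⟩))
    rw [section_congr g e1, section_congr h e2, e1, e2, convTerm]
    simp only [map_smul, map_mul, mul_smul_comm, smul_smul, smul_mul_assoc, S.act_comp, mul_assoc]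
    rw [← hc', mul_comm (algebraMap ℂ 𝕜 _)]
  · exact fun p hp => Finset.mem_biUnion.2 ⟨r, hr, hp⟩
  · intro p _ hp
    have : convTerm S c f g r.2 p.2 = 0 := by
      by_contra hne
      refine hp (Finset.mem_map.2 ⟨⟨p.1, 𝒢.comp (𝒢.inv r.2) p.2⟩,
        hSg _ _ (convTerm_ne_zero hne).2, ?_⟩)
      exact (EtaleGroupoid.leftMul r.2).apply_symm_apply p
    rw [this, zero_mul, smul_zero]

variable (S) (c)

/-- The `c`-twisted crossed product algebra `S ⋊_c 𝒢`: the space `Γ_cpt(𝒢, s^* S)` with the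
`c`-twisted convolution product. -/
def CrossedProduct (_c : LocConstCocycle 𝒢) : Type u := compactSections S

noncomputable instance : AddCommGroup (CrossedProduct S c) :=
  inferInstanceAs (AddCommGroup (compactSections S))

noncomputable instance : Module 𝕜 (CrossedProduct S c) :=
  inferInstanceAs (Module 𝕜 (compactSections S))

noncomputable instance : Mul (CrossedProduct S c) :=
  ⟨fun f g => ⟨conv S c f.1 g.1, conv_mem f.2 g.2⟩⟩

theorem CrossedProduct.mul_val (f g : CrossedProduct S c) :
    (f * g).1 = conv S c f.1 g.1 := rfl

theorem CrossedProduct.mul_apply (f g : CrossedProduct S c) (a : 𝒢.Arr) :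
    (f * g).1 a = ∑ p ∈ (finite_support f.2 a.src).toFinset, convTerm S c f.1 g.1 p.2 a.hom :=
  conv_eq_sum _ _ (by simp)

noncomputable instance : NonUnitalRing (CrossedProduct S c) where
  left_distrib f g h := by
    refine Subtype.ext (funext fun a => ?_)
    change (f * (g + h)).1 a = (f * g).1 a + (f * h).1 a
    simp only [CrossedProduct.mul_apply, ← Finset.sum_add_distrib]
    refine Finset.sum_congr rfl fun p _ => ?_
    have : ∀ b, (g + h).1 b = g.1 b + h.1 b := fun _ => rfl
    simp only [convTerm, this, map_add, mul_add, smul_add]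
  right_distrib f g h := by
    classical
    refine Subtype.ext (funext fun a => ?_)
    have key : ∀ k : CrossedProduct S c,
        (∀ b, k.1 b ≠ 0 → f.1 b ≠ 0 ∨ g.1 b ≠ 0) → (k * h).1 a =
        ∑ p ∈ (finite_support f.2 a.src).toFinset ∪ (finite_support g.2 a.src).toFinset,
          convTerm S c k.1 h.1 p.2 a.hom := fun k hk => conv_eq_sum _ _ fun p hp => by
      simpa using hk _ hp
    change ((f + g) * h).1 a = (f * h).1 a + (g * h).1 a
    have hadd : ∀ b, (f + g).1 b = f.1 b + g.1 b := fun _ => rfl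
    rw [key (f + g) fun b hb => ?_, key f fun _ => Or.inl, key g fun _ => Or.inr,
      ← Finset.sum_add_distrib]
    · refine Finset.sum_congr rfl fun p _ => ?_
      simp only [convTerm, hadd, add_mul, smul_add]
    · by_contra hn
      push Not at hn
      exact hb (by rw [hadd, hn.1, hn.2, add_zero])
  zero_mul f := by
    refine Subtype.ext (funext fun a => ?_)
    have : ∀ b, (0 : CrossedProduct S c).1 b = 0 := fun _ => rfl
    rw [CrossedProduct.mul_apply, this]
    exact Finset.sum_eq_zero fun p _ => by simp [convTerm, this]
  mul_zero f := by
    refine Subtype.ext (funext fun a => ?_)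
    have : ∀ b, (0 : CrossedProduct S c).1 b = 0 := fun _ => rfl
    rw [CrossedProduct.mul_apply, this]
    exact Finset.sum_eq_zero fun p _ => by simp [convTerm, this]
  mul_assoc f g h := Subtype.ext (conv_assoc f.2 g.2)

instance : IsScalarTower 𝕜 (CrossedProduct S c) (CrossedProduct S c) where
  smul_assoc r f g := by
    refine Subtype.ext (funext fun a => ?_)
    have hs : ∀ (k : CrossedProduct S c) b, (r • k).1 b = r • k.1 b := fun _ _ => rfl
    change ((r • f) * g).1 a = (r • (f * g)).1 a
    have h1 : ((r • f) * g).1 a =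
        ∑ p ∈ (finite_support f.2 a.src).toFinset, convTerm S c (r • f).1 g.1 p.2 a.hom :=
      conv_eq_sum _ _ fun p hp => by
        refine (Set.Finite.mem_toFinset _).2 fun h0 => ?_
        exact hp (by rw [hs, h0, smul_zero])
    rw [hs, h1, CrossedProduct.mul_apply, Finset.smul_sum]
    refine Finset.sum_congr rfl fun p _ => ?_
    simp only [convTerm, hs, smul_mul_assoc]
    rw [smul_comm]

instance : SMulCommClass 𝕜 (CrossedProduct S c) (CrossedProduct S c) where
  smul_comm r f g := by
    refine Subtype.ext (funext fun a => ?_)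
    have hs : ∀ (k : CrossedProduct S c) b, (r • k).1 b = r • k.1 b := fun _ _ => rfl
    change (r • (f * g)).1 a = (f * (r • g)).1 a
    rw [hs, CrossedProduct.mul_apply, CrossedProduct.mul_apply, Finset.smul_sum]
    refine Finset.sum_congr rfl fun p _ => ?_
    simp only [convTerm, hs, map_smul, mul_smul_comm]
    rw [smul_comm]

end CrossedProduct

/-! ### The transformation groupoid of an action on a discrete set -/

/-- An action of an étale groupoid `𝒢` on the trivial bundle `ι × M → M` with discrete fibre `ι`:
an arrow `g : x ⟶ y` carries the fibre at `x` to the fibre at `y`, and `g₁ ≫ g₂` acts by first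
applying `g₁`. -/
structure DiscreteAction {M : Type u} [TopologicalSpace M] (𝒢 : EtaleGroupoid M) (ι : Type) where
  act : ∀ {x y : M}, 𝒢.Hom x y → ι → ι
  act_id : ∀ (x : M) (i : ι), act (𝒢.id x) i = i
  act_comp : ∀ {x y z : M} (g : 𝒢.Hom x y) (h : 𝒢.Hom y z) (i : ι),
    act (𝒢.comp g h) i = act h (act g i)
  isLocallyConstant : ∀ i : ι, IsLocallyConstant fun a : 𝒢.Arr => act a.hom i

theorem isLocalHomeomorph_map_snd {ι X Y : Type*} [TopologicalSpace ι] [TopologicalSpace X]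
    [TopologicalSpace Y] {f : X → Y} (hf : IsLocalHomeomorph f) :
    IsLocalHomeomorph fun p : ι × X => (p.1, f p.2) := by
  refine IsLocalHomeomorph.mk _ fun p => ?_
  obtain ⟨e, he, hfe⟩ := hf p.2
  refine ⟨(OpenPartialHomeomorph.refl ι).prod e, ⟨trivial, he⟩, fun q _ => ?_⟩
  rw [hfe]
  rfl

theorem continuous_discrete_prod {ι X Y : Type*} [TopologicalSpace ι] [DiscreteTopology ι]
    [TopologicalSpace X] [TopologicalSpace Y] {f : ι × X → Y}
    (hf : ∀ i, Continuous fun x => f (i, x)) : Continuous f :=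
  continuous_prod_of_discrete_left.2 hf

namespace DiscreteAction

variable {M : Type u} [TopologicalSpace M] {𝒢 : EtaleGroupoid M} {ι : Type}

/-- The transformation groupoid `ι ⋊ 𝒢` with objects `ι × M`: an arrow `(i, x) ⟶ (k, y)` is an
arrow `g : x ⟶ y` of `𝒢` with `g(i) = k`. -/
@[reducible] def groupoid (α : DiscreteAction 𝒢 ι) : CategoryTheory.Groupoid.{u} (ι × M) where
  Hom p q := {g : 𝒢.Hom p.2 q.2 // α.act g p.1 = q.1}
  id p := ⟨𝒢.id p.2, α.act_id _ _⟩
  comp g h := ⟨𝒢.comp g.1 h.1, by rw [α.act_comp, g.2, h.2]⟩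
  id_comp g := Subtype.ext (𝒢.id_comp g.1)
  comp_id g := Subtype.ext (𝒢.comp_id g.1)
  assoc g h k := Subtype.ext (𝒢.assoc g.1 h.1 k.1)
  inv g := ⟨𝒢.inv g.1, by
    have h := congrArg (α.act (𝒢.inv g.1)) g.2
    rwa [← α.act_comp, 𝒢.comp_inv, α.act_id, eq_comm] at h⟩
  inv_comp g := Subtype.ext (𝒢.inv_comp g.1)
  comp_inv g := Subtype.ext (𝒢.comp_inv g.1)

/-- The arrows of `ι ⋊ 𝒢` are the pairs `(i, g)` with `i ∈ ι` and `g` an arrow of `𝒢`. -/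
def arrowEquiv (α : DiscreteAction 𝒢 ι) : Arrow α.groupoid ≃ ι × 𝒢.Arr where
  toFun a := (a.src.1, ⟨a.src.2, a.tgt.2, a.hom.1⟩)
  invFun p := ⟨(p.1, p.2.src), (α.act p.2.hom p.1, p.2.tgt), ⟨p.2.hom, rfl⟩⟩
  left_inv := by
    have key : ∀ (i k : ι) (x y : M) (g : 𝒢.Hom x y) (hg : α.act g i = k),
        (⟨(i, x), (α.act g i, y), ⟨g, rfl⟩⟩ : Arrow α.groupoid) = ⟨(i, x), (k, y), ⟨g, hg⟩⟩ := by
      rintro i k x y g rfl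
      rfl
    rintro ⟨⟨i, x⟩, ⟨k, y⟩, ⟨g, hg⟩⟩
    exact key i k x y g hg
  right_inv _ := rfl

variable [TopologicalSpace ι] [DiscreteTopology ι]

/-- The arrow space of `ι ⋊ 𝒢` has the topology of `ι × 𝒢`. -/
instance (α : DiscreteAction 𝒢 ι) : TopologicalSpace (Arrow α.groupoid) :=
  TopologicalSpace.induced α.arrowEquiv inferInstance

/-- `arrowEquiv` as a homeomorphism. -/
def arrowHomeo (α : DiscreteAction 𝒢 ι) : Arrow α.groupoid ≃ₜ ι × 𝒢.Arr :=
  α.arrowEquiv.toHomeomorphOfIsInducing ⟨rfl⟩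

/-- The transformation groupoid `ι ⋊ 𝒢` as an étale groupoid. -/
def transformation (α : DiscreteAction 𝒢 ι) : EtaleGroupoid (ι × M) where
  toGroupoid := α.groupoid
  t2 := α.arrowHomeo.symm.t2Space
  isLocalHomeomorph_src :=
    (isLocalHomeomorph_map_snd (ι := ι) 𝒢.isLocalHomeomorph_src).comp
      α.arrowHomeo.isLocalHomeomorph
  continuous_id := continuous_induced_rng.2
    (continuous_fst.prodMk (𝒢.continuous_id.comp continuous_snd))
  continuous_inv := by
    refine continuous_induced_rng.2 (Continuous.prodMk ?_ ?_)
    · have h : Continuous fun p : ι × 𝒢.Arr => α.act p.2.hom p.1 :=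
        continuous_discrete_prod fun i => (α.isLocallyConstant i).continuous
      refine (h.comp α.arrowHomeo.continuous).congr fun a => ?_
      exact a.hom.2
    · exact 𝒢.continuous_inv.comp (continuous_snd.comp α.arrowHomeo.continuous)
  continuous_comp := by
    have h1 : Continuous fun p : Composable α.groupoid => (⟨p.x, p.y, p.fst⟩ : Arrow α.groupoid) :=
      Composable.continuous_fst _
    have h2 : Continuous fun p : Composable α.groupoid => (⟨p.y, p.z, p.snd⟩ : Arrow α.groupoid) :=
      Composable.continuous_snd _
    refine continuous_induced_rng.2 (Continuous.prodMk ?_ ?_)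
    · exact (α.arrowHomeo.continuous.comp h1).fst
    · exact 𝒢.continuous_comp.comp (f := fun p : Composable α.groupoid =>
        (⟨p.x.2, p.y.2, p.z.2, p.fst.1, p.snd.1⟩ : Composable 𝒢.toGroupoid))
        (continuous_induced_rng.2 ((continuous_snd.comp (α.arrowHomeo.continuous.comp h1)).prodMk
          (continuous_snd.comp (α.arrowHomeo.continuous.comp h2))))

/-- The arrow `(i, g) : (i, x) ⟶ (g(i), y)` of `ι ⋊ 𝒢`. -/
def arrow (α : DiscreteAction 𝒢 ι) (i : ι) {x y : M} (g : 𝒢.Hom x y) :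
    α.transformation.Hom (i, x) (α.act g i, y) :=
  ⟨g, rfl⟩

section Sheaf

variable {𝕜 : Type v} [Field 𝕜] (A : EquivariantSheaf 𝕜 𝒢)

/-- The total space of the pull-back of a sheaf along `ι × M → M`. -/
def germEquiv (ι : Type) (stalk : M → Type u) :
    Germ (fun p : ι × M => stalk p.2) ≃ ι × Germ stalk where
  toFun a := (a.base.1, ⟨a.base.2, a.val⟩)
  invFun p := ⟨(p.1, p.2.base), p.2.val⟩
  left_inv _ := rfl
  right_inv _ := rfl

instance (stalk : M → Type u) [TopologicalSpace (Germ stalk)] :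
    TopologicalSpace (Germ fun p : ι × M => stalk p.2) :=
  TopologicalSpace.induced (germEquiv ι stalk) inferInstance

/-- `germEquiv` as a homeomorphism. -/
def germHomeo (ι : Type) [TopologicalSpace ι] (stalk : M → Type u)
    [TopologicalSpace (Germ stalk)] :
    Germ (fun p : ι × M => stalk p.2) ≃ₜ ι × Germ stalk :=
  (germEquiv ι stalk).toHomeomorphOfIsInducing ⟨rfl⟩

/-- The `ι ⋊ 𝒢`-sheaf on `ι × M` obtained by pulling back a `𝒢`-sheaf on `M`: its stalk at
`(i, x)` is the stalk at `x`, and `(i, g)` acts as `g` does. -/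
def pullbackSheaf (α : DiscreteAction 𝒢 ι) : EquivariantSheaf 𝕜 α.transformation where
  stalk p := A.stalk p.2
  isLocalHomeomorph_base :=
    (isLocalHomeomorph_map_snd (ι := ι) A.isLocalHomeomorph_base).comp
      (germHomeo ι A.stalk).isLocalHomeomorph
  continuous_add := by
    have h1 := (germHomeo ι A.stalk).continuous.comp (GermPair.continuous_fst _)
    have h2 := (germHomeo ι A.stalk).continuous.comp (GermPair.continuous_snd _)
    exact continuous_induced_rng.2 ((continuous_fst.comp h1).prodMk
      (A.sec_add (continuous_snd.comp h1) (continuous_snd.comp h2)))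
  continuous_mul := by
    have h1 := (germHomeo ι A.stalk).continuous.comp (GermPair.continuous_fst _)
    have h2 := (germHomeo ι A.stalk).continuous.comp (GermPair.continuous_snd _)
    exact continuous_induced_rng.2 ((continuous_fst.comp h1).prodMk
      (A.sec_mul (continuous_snd.comp h1) (continuous_snd.comp h2)))
  continuous_smul r := by
    have h1 := (germHomeo ι A.stalk).continuous
    exact continuous_induced_rng.2 ((continuous_fst.comp h1).prodMk
      (A.sec_smul r (continuous_snd.comp h1)))
  continuous_one := continuous_induced_rng.2
    (continuous_fst.prodMk (A.continuous_one.comp continuous_snd))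
  act g := A.act g.1
  act_id p a := A.act_id p.2 a
  act_comp g h a := A.act_comp g.1 h.1 a
  continuous_act := by
    have h1 := α.arrowHomeo.continuous.comp
      (ArrowGerm.continuous_arrow α.groupoid fun p : ι × M => A.stalk p.2)
    have h2 := (germHomeo ι A.stalk).continuous.comp
      (ArrowGerm.continuous_germ α.groupoid fun p : ι × M => A.stalk p.2)
    refine continuous_induced_rng.2 ((continuous_fst.comp h1).prodMk ?_)
    exact A.continuous_act.comp
      (f := fun p : ArrowGerm α.groupoid (fun p : ι × M => A.stalk p.2) =>
        (⟨p.x.2, p.y.2, p.hom.1, p.val⟩ : ArrowGerm 𝒢.toGroupoid A.stalk))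
      (continuous_induced_rng.2 ((continuous_snd.comp h1).prodMk (continuous_snd.comp h2)))

end Sheaf

end DiscreteAction

/-! ### Representations -/

/-- The unitary dual `Ĝ` of a finite group `G`: a set `ι` indexing the isomorphism classes of
irreducible complex representations of `G`, with a chosen unitary representation `ρ i` on `V i`
in each class. -/
structure UnitaryDual (G : Type w) [Group G] where
  ι : Type
  V : ι → Type
  [normed : ∀ i, NormedAddCommGroup (V i)]
  [inner : ∀ i, InnerProductSpace ℂ (V i)]
  [finiteDimensional : ∀ i, FiniteDimensional ℂ (V i)]
  ρ : ∀ i, Representation ℂ G (V i)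
  unitary : ∀ (i : ι) (g : G) (v : V i), ‖ρ i g v‖ = ‖v‖
  irreducible : ∀ i, (ρ i).IsIrreducible
  eq_of_equiv : ∀ i k, Nonempty ((ρ i).Equiv (ρ k)) → i = k
  exists_equiv : ∀ (W : Type) [AddCommGroup W] [Module ℂ W] [FiniteDimensional ℂ W]
    (π : Representation ℂ G W), π.IsIrreducible → ∃ i, Nonempty (π.Equiv (ρ i))

namespace UnitaryDual

attribute [instance] UnitaryDual.normed UnitaryDual.inner UnitaryDual.finiteDimensional

variable {G : Type w} [Group G] (R : UnitaryDual G)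

instance : TopologicalSpace R.ι := ⊥

instance : DiscreteTopology R.ι := ⟨rfl⟩

theorem isIrreducible_comp {W : Type*} [AddCommGroup W] [Module ℂ W] {π : Representation ℂ G W}
    (hπ : π.IsIrreducible) (α : G ≃* G) :
    Representation.IsIrreducible (k := ℂ) (V := W) (π.comp (α : G →* G)) := by
  let e : Subrepresentation (A := ℂ) (W := W) (π.comp (α : G →* G)) ≃o Subrepresentation π :=
    { toFun := fun N => ⟨N.toSubmodule, fun g v hv => by
        have := N.apply_mem_toSubmodule (α.symm g) hv
        simpa using this⟩
      invFun := fun N => ⟨N.toSubmodule, fun g v hv => N.apply_mem_toSubmodule (α g) hv⟩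
      left_inv := fun _ => rfl
      right_inv := fun _ => rfl
      map_rel_iff' := Iff.rfl }
  exact (OrderIso.isSimpleOrder_iff e).2 hπ

theorem exists_twist (α : G ≃* G) (i : R.ι) : ∃ k : R.ι,
    Nonempty (Representation.Equiv (A := ℂ) (V := R.V i) ((R.ρ i).comp (α : G →* G)) (R.ρ k)) :=
  R.exists_equiv _ _ (isIrreducible_comp (R.irreducible i) α)

/-- The class of the representation `g ↦ ρ i (α g)`. -/
noncomputable def twist (α : G ≃* G) (i : R.ι) : R.ι := (R.exists_twist α i).choose

theorem twist_spec (α : G ≃* G) (i : R.ι) :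
    ∃ T : R.V i ≃ₗ[ℂ] R.V (R.twist α i), ∀ g v, T (R.ρ i (α g) v) = R.ρ (R.twist α i) g (T v) := by
  obtain ⟨T⟩ := (R.exists_twist α i).choose_spec
  exact ⟨T.toLinearEquiv, fun g v => T.toIntertwiningMap.isIntertwining _ _ g v⟩

theorem twist_eq {α : G ≃* G} {i k : R.ι} (T : R.V i ≃ₗ[ℂ] R.V k)
    (hT : ∀ g v, T (R.ρ i (α g) v) = R.ρ k g (T v)) : R.twist α i = k := by
  obtain ⟨S, hS⟩ := R.twist_spec α i
  refine R.eq_of_equiv _ _ ⟨Representation.Equiv.mk (S.symm.trans T) fun g => ?_⟩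
  refine LinearMap.ext fun v => ?_
  obtain ⟨v, rfl⟩ := S.surjective v
  have h := hS g v
  simp [← h, hT]

theorem twist_refl (i : R.ι) : R.twist (MulEquiv.refl G) i = i :=
  R.twist_eq (LinearEquiv.refl ℂ _) fun _ _ => rfl

theorem twist_comp {α β γ : G ≃* G} (t : G) (h : ∀ g, α (β g) = t * γ g * t⁻¹) (i : R.ι) :
    R.twist γ i = R.twist β (R.twist α i) := by
  obtain ⟨S, hS⟩ := R.twist_spec α i
  obtain ⟨T, hT⟩ := R.twist_spec β (R.twist α i)
  let U : R.V i ≃ₗ[ℂ] R.V i := LinearEquiv.ofLinearMap (R.ρ i t) (R.ρ i t⁻¹)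
    (by rw [← Module.End.mul_eq_comp, ← map_mul, mul_inv_cancel, map_one]; rfl)
    (by rw [← Module.End.mul_eq_comp, ← map_mul, inv_mul_cancel, map_one]; rfl)
  refine R.twist_eq ((U.trans S).trans T) fun g v => ?_
  have h1 : U (R.ρ i (γ g) v) = R.ρ i (α (β g)) (U v) := by
    change R.ρ i t (R.ρ i (γ g) v) = R.ρ i (α (β g)) (R.ρ i t v)
    rw [h, ← Module.End.mul_apply, ← Module.End.mul_apply, ← map_mul, ← map_mul,
      inv_mul_cancel_right]
  change T (S (U (R.ρ i (γ g) v))) = R.ρ _ g (T (S (U v)))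
  rw [h1, hS, hT]

end UnitaryDual

/-! ### Groupoid extensions -/

/-- A groupoid extension `M × G → 𝔥 → 𝔔` of an étale groupoid `𝔔` over `M` by the trivial bundle
of groups with (discrete) fibre `G`; all maps are the identity on objects. -/
structure GerbeExtension (G : Type w) [Group G] {M : Type u} [TopologicalSpace M]
    (𝔔 : EtaleGroupoid M) where
  /-- The groupoid `𝔥`. -/
  tot : EtaleGroupoid M
  /-- The morphism `𝔥 → 𝔔`. -/
  proj : ∀ {x y : M}, tot.Hom x y → 𝔔.Hom x y
  proj_comp : ∀ {x y z : M} (h : tot.Hom x y) (k : tot.Hom y z),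
    proj (tot.comp h k) = 𝔔.comp (proj h) (proj k)
  continuous_proj : Continuous fun a : tot.Arr => (⟨a.src, a.tgt, proj a.hom⟩ : 𝔔.Arr)
  proj_surjective : ∀ {x y : M} (q : 𝔔.Hom x y), ∃ h, proj h = q
  /-- The morphism `M × G → 𝔥`. -/
  incl : ∀ x : M, G → tot.Hom x x
  incl_mul : ∀ (x : M) (g h : G), incl x (g * h) = tot.comp (incl x g) (incl x h)
  continuous_incl : ∀ g : G, Continuous fun x : M => (⟨x, x, incl x g⟩ : tot.Arr)
  incl_injective : ∀ x : M, Function.Injective (incl x)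
  proj_eq_id_iff : ∀ {x : M} (h : tot.Hom x x), proj h = 𝔔.id x ↔ ∃ g, incl x g = h

namespace GerbeExtension

variable {G : Type w} [Group G] {M : Type u} [TopologicalSpace M] {𝔔 : EtaleGroupoid M}
  (E : GerbeExtension G 𝔔)

theorem proj_id (x : M) : E.proj (E.tot.id x) = 𝔔.id x := by
  have h : 𝔔.comp (E.proj (E.tot.id x)) (E.proj (E.tot.id x)) = E.proj (E.tot.id x) := by
    rw [← E.proj_comp, E.tot.comp_id]
  have h2 := (EtaleGroupoid.inv_comp_eq (𝒢 := 𝔔) _ _ _).2 h.symm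
  rw [𝔔.inv_comp] at h2
  exact h2.symm

theorem proj_inv {x y : M} (h : E.tot.Hom x y) : E.proj (E.tot.inv h) = 𝔔.inv (E.proj h) := by
  have h2 : E.proj (E.tot.id x) = 𝔔.comp (E.proj h) (E.proj (E.tot.inv h)) := by
    rw [← E.proj_comp, E.tot.comp_inv]
  have h3 := (EtaleGroupoid.inv_comp_eq (𝒢 := 𝔔) _ _ _).2 h2
  rw [E.proj_id, 𝔔.comp_id] at h3
  exact h3.symm

theorem incl_one (x : M) : E.incl x 1 = E.tot.id x := by
  obtain ⟨g, hg⟩ := (E.proj_eq_id_iff (E.tot.id x)).1 (E.proj_id x)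
  have h := E.incl_mul x 1 g
  rw [one_mul, hg, E.tot.comp_id] at h
  exact h.symm

theorem exists_ad {x y : M} (h : E.tot.Hom x y) (g : G) :
    ∃ g', E.incl x g' = E.tot.comp (E.tot.comp h (E.incl y g)) (E.tot.inv h) := by
  refine (E.proj_eq_id_iff _).1 ?_
  rw [E.proj_comp, E.proj_comp, (E.proj_eq_id_iff (E.incl y g)).2 ⟨g, rfl⟩, 𝔔.comp_id, E.proj_inv,
    𝔔.comp_inv]

/-- The element `Ad_h(g) = h g h⁻¹` of `G`, for an arrow `h` of `𝔥`. -/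
noncomputable def adFun {x y : M} (h : E.tot.Hom x y) (g : G) : G := (E.exists_ad h g).choose

theorem incl_adFun {x y : M} (h : E.tot.Hom x y) (g : G) :
    E.incl x (E.adFun h g) = E.tot.comp (E.tot.comp h (E.incl y g)) (E.tot.inv h) :=
  (E.exists_ad h g).choose_spec

theorem incl_adFun_comp {x y : M} (h : E.tot.Hom x y) (g : G) :
    E.tot.comp (E.incl x (E.adFun h g)) h = E.tot.comp h (E.incl y g) := by
  rw [incl_adFun, E.tot.assoc, E.tot.inv_comp, E.tot.comp_id]

theorem adFun_eq {x y : M} {h : E.tot.Hom x y} {g g' : G}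
    (e : E.tot.comp (E.incl x g') h = E.tot.comp h (E.incl y g)) : E.adFun h g = g' := by
  apply E.incl_injective x
  rw [incl_adFun, ← e, E.tot.assoc, E.tot.comp_inv, E.tot.comp_id]

theorem adFun_comp {x y z : M} (h : E.tot.Hom x y) (k : E.tot.Hom y z) (g : G) :
    E.adFun (E.tot.comp h k) g = E.adFun h (E.adFun k g) := by
  apply E.adFun_eq
  rw [← E.tot.assoc, incl_adFun_comp, E.tot.assoc, incl_adFun_comp, E.tot.assoc]

theorem adFun_id (x : M) (g : G) : E.adFun (E.tot.id x) g = g :=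
  E.adFun_eq (by rw [E.tot.id_comp, E.tot.comp_id])

theorem adFun_incl (x : M) (t g : G) : E.adFun (E.incl x t) g = t * g * t⁻¹ := by
  apply E.adFun_eq
  rw [← E.incl_mul, ← E.incl_mul, inv_mul_cancel_right]

/-- `Ad_h` as an automorphism of `G`. -/
noncomputable def ad {x y : M} (h : E.tot.Hom x y) : G ≃* G where
  toFun := E.adFun h
  invFun := E.adFun (E.tot.inv h)
  left_inv g := by rw [← adFun_comp, E.tot.inv_comp, adFun_id]
  right_inv g := by rw [← adFun_comp, E.tot.comp_inv, adFun_id]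
  map_mul' g g' := by
    apply E.adFun_eq
    rw [E.incl_mul, E.tot.assoc, incl_adFun_comp, ← E.tot.assoc, incl_adFun_comp, E.tot.assoc,
      ← E.incl_mul]

/-- A `𝔔`-sheaf regarded as an `𝔥`-sheaf along `𝔥 → 𝔔`. -/
def pullbackSheaf {𝕜 : Type v} [Field 𝕜] (A : EquivariantSheaf 𝕜 𝔔) :
    EquivariantSheaf 𝕜 E.tot where
  toAlgebraSheaf := A.toAlgebraSheaf
  act h := A.act (E.proj h)
  act_id x a := by rw [E.proj_id, A.act_id]
  act_comp g h a := by rw [E.proj_comp, A.act_comp]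
  continuous_act := by
    exact A.continuous_act.comp (f := fun p : ArrowGerm E.tot.toGroupoid A.stalk =>
        (⟨p.x, p.y, E.proj p.hom, p.val⟩ : ArrowGerm 𝔔.toGroupoid A.stalk))
      (continuous_induced_rng.2
        ((E.continuous_proj.comp (ArrowGerm.continuous_arrow _ _)).prodMk
          (ArrowGerm.continuous_germ _ _)))

/-- A continuous section `σ` of `𝔥 → 𝔔` that is the identity on units. -/
structure Section where
  lift : ∀ {x y : M}, 𝔔.Hom x y → E.tot.Hom x y
  proj_lift : ∀ {x y : M} (q : 𝔔.Hom x y), E.proj (lift q) = q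
  lift_id : ∀ x : M, lift (𝔔.id x) = E.tot.id x
  continuous_lift : Continuous fun a : 𝔔.Arr => (⟨a.src, a.tgt, lift a.hom⟩ : E.tot.Arr)

namespace Section

variable {E} (σ : E.Section)

theorem exists_tau {x y z : M} (q₁ : 𝔔.Hom x y) (q₂ : 𝔔.Hom y z) :
    ∃ g, E.incl x g = E.tot.comp (E.tot.comp (σ.lift q₁) (σ.lift q₂))
      (E.tot.inv (σ.lift (𝔔.comp q₁ q₂))) := by
  refine (E.proj_eq_id_iff _).1 ?_
  rw [E.proj_comp, E.proj_comp, E.proj_inv, σ.proj_lift, σ.proj_lift, σ.proj_lift, 𝔔.comp_inv]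

/-- The element `τ(q₁, q₂) = σ(q₁) σ(q₂) σ(q₁ q₂)⁻¹` of `G`. -/
noncomputable def tau {x y z : M} (q₁ : 𝔔.Hom x y) (q₂ : 𝔔.Hom y z) : G :=
  (σ.exists_tau q₁ q₂).choose

theorem incl_tau {x y z : M} (q₁ : 𝔔.Hom x y) (q₂ : 𝔔.Hom y z) :
    E.incl x (σ.tau q₁ q₂) = E.tot.comp (E.tot.comp (σ.lift q₁) (σ.lift q₂))
      (E.tot.inv (σ.lift (𝔔.comp q₁ q₂))) :=
  (σ.exists_tau q₁ q₂).choose_spec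

theorem ad_ad {x y z : M} (q₁ : 𝔔.Hom x y) (q₂ : 𝔔.Hom y z) (g : G) :
    E.ad (σ.lift q₁) (E.ad (σ.lift q₂) g) =
      σ.tau q₁ q₂ * E.ad (σ.lift (𝔔.comp q₁ q₂)) g * (σ.tau q₁ q₂)⁻¹ := by
  change E.adFun _ (E.adFun _ g) = _ * E.adFun _ g * _
  rw [← E.adFun_comp, ← E.adFun_incl x, ← E.adFun_comp, incl_tau, E.tot.assoc, E.tot.inv_comp,
    E.tot.comp_id]

theorem isOpen_ad (g g' : G) : IsOpen {a : 𝔔.Arr | E.ad (σ.lift a.hom) g = g'} := by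
  have h1 : Continuous fun a : 𝔔.Arr => (⟨a.src, a.src, E.incl a.src g'⟩ : E.tot.Arr) :=
    (E.continuous_incl g').comp 𝔔.continuous_src
  have h2 : Continuous fun a : 𝔔.Arr => (⟨a.src, a.tgt,
      E.tot.comp (σ.lift a.hom) (E.incl a.tgt g)⟩ : E.tot.Arr) :=
    E.tot.continuous_comp.comp (f := fun a : 𝔔.Arr => (⟨a.src, a.tgt, a.tgt, σ.lift a.hom,
      E.incl a.tgt g⟩ : Composable E.tot.toGroupoid)) (continuous_induced_rng.2
      (σ.continuous_lift.prodMk ((E.continuous_incl g).comp 𝔔.continuous_tgt)))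
  have h3 : Continuous fun a : 𝔔.Arr => (⟨a.src, a.src,
      E.tot.comp (E.tot.comp (σ.lift a.hom) (E.incl a.tgt g)) (E.tot.inv (σ.lift a.hom))⟩ :
        E.tot.Arr) :=
    E.tot.continuous_comp.comp (f := fun a : 𝔔.Arr => (⟨a.src, a.tgt, a.src,
      E.tot.comp (σ.lift a.hom) (E.incl a.tgt g), E.tot.inv (σ.lift a.hom)⟩ :
        Composable E.tot.toGroupoid)) (continuous_induced_rng.2
      (h2.prodMk (E.tot.continuous_inv.comp σ.continuous_lift)))
  convert E.tot.isLocalHomeomorph_src.isLocallyInjective.isOpen_eqLocus h3 h1 rfl using 1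
  ext a
  change E.adFun _ g = g' ↔ _ = _
  rw [← (E.incl_injective a.src).eq_iff, E.incl_adFun]
  simp

theorem isLocallyConstant_ad [Finite G] :
    IsLocallyConstant fun a : 𝔔.Arr => E.ad (σ.lift a.hom) := by
  rw [IsLocallyConstant.iff_exists_open]
  intro a₀
  refine ⟨⋂ g : G, {a : 𝔔.Arr | E.ad (σ.lift a.hom) g = E.ad (σ.lift a₀.hom) g},
    isOpen_iInter_of_finite fun g => σ.isOpen_ad g _, Set.mem_iInter.2 fun _ => rfl, ?_⟩
  intro a ha
  exact MulEquiv.ext fun g => Set.mem_iInter.1 ha g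

/-- The action of `𝔔` on `Ĝ`: the arrow `q` sends the class of `ρ` to the class of the
representation `g ↦ ρ(Ad_{σ(q)}(g))`. -/
noncomputable def dualAction [Finite G] (R : UnitaryDual G) : DiscreteAction 𝔔 R.ι where
  act q i := R.twist (E.ad (σ.lift q)) i
  act_id x i := by
    have : E.ad (σ.lift (𝔔.id x)) = MulEquiv.refl G :=
      MulEquiv.ext fun g => by
        rw [σ.lift_id]
        exact E.adFun_id x g
    rw [this, R.twist_refl]
  act_comp q₁ q₂ i := R.twist_comp (σ.tau q₁ q₂) (σ.ad_ad q₁ q₂) i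
  isLocallyConstant i := σ.isLocallyConstant_ad.comp fun α => R.twist α i

/-- A choice of unitary intertwiners `T_q^{[ρ]} : V_ρ → V_{q([ρ])}`,
`T_q^{[ρ]} ρ(Ad_{σ(q)}(g)) = q([ρ])(g) T_q^{[ρ]}`, which is locally constant in `q` and is the
identity for units `q`. -/
structure Intertwiners [Finite G] (R : UnitaryDual G) where
  T : ∀ {x y : M} (q : 𝔔.Hom x y) (i : R.ι), R.V i ≃ₗᵢ[ℂ] R.V ((σ.dualAction R).act q i)
  intertwines : ∀ {x y : M} (q : 𝔔.Hom x y) (i : R.ι) (g : G) (v : R.V i),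
    T q i (R.ρ i (E.ad (σ.lift q) g) v) = R.ρ _ g (T q i v)
  T_id : ∀ (x : M) (i : R.ι),
    (⟨_, T (𝔔.id x) i⟩ : Σ k, R.V i ≃ₗᵢ[ℂ] R.V k) = ⟨i, LinearIsometryEquiv.refl ℂ (R.V i)⟩
  isLocallyConstant : ∀ i : R.ι,
    IsLocallyConstant fun a : 𝔔.Arr => (⟨_, T a.hom i⟩ : Σ k, R.V i ≃ₗᵢ[ℂ] R.V k)

/-- The relation
`T_{q₂}^{q₁([ρ])} ∘ T_{q₁}^{[ρ]} = c^{[ρ]}(q₁, q₂) T_{q₁q₂}^{[ρ]} ρ(τ(q₁, q₂))⁻¹`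
which determines `c`, where `c^{[ρ]}(q₁, q₂)` is the value of `c` at the composable arrows
`([ρ], q₁)` and `(q₁([ρ]), q₂)` of `Ĝ ⋊ 𝔔`.  It is evaluated on `ρ(τ(q₁, q₂)) v`; the two sides lie
in the spaces of `q₂(q₁([ρ]))` and `(q₁q₂)([ρ])`, which are equal elements of `Ĝ`. -/
def Intertwiners.IsDefect [Finite G] {σ : E.Section} {R : UnitaryDual G} (T : σ.Intertwiners R)
    (c : LocConstCocycle (σ.dualAction R).transformation) : Prop :=
  ∀ {x y z : M} (q₁ : 𝔔.Hom x y) (q₂ : 𝔔.Hom y z) (i : R.ι) (v : R.V i),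
    (⟨_, T.T q₂ _ (T.T q₁ i (R.ρ i (σ.tau q₁ q₂) v))⟩ : Σ k, R.V k) =
      ⟨_, (c.toFun ((σ.dualAction R).arrow i q₁) ((σ.dualAction R).arrow _ q₂) : ℂ) •
        T.T (𝔔.comp q₁ q₂) i v⟩

end Section

end GerbeExtension

/-- The space `X` is a disjoint union of contractible open sets. -/
def IsUnionOfContractibles (X : Type u) [TopologicalSpace X] : Prop :=
  ∃ (κ : Type u) (U : κ → Set X), (∀ k, IsOpen (U k)) ∧ Pairwise (Function.onFun Disjoint U) ∧
    (⋃ k, U k) = Set.univ ∧ ∀ k, ContractibleSpace (U k)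

/-- Over every compact set the unit section of the sheaf coincides with some compactly supported
global section. -/
def AlgebraSheaf.HasCompactUnits {𝕜 : Type v} [Field 𝕜] {M : Type u} [TopologicalSpace M]
    (A : AlgebraSheaf 𝕜 M) : Prop :=
  ∀ K : Set M, IsCompact K → ∃ e : ∀ x, A.stalk x,
    (Continuous fun x => (⟨x, e x⟩ : Germ A.stalk)) ∧ IsCompact {x | e x ≠ 0} ∧ ∀ x ∈ K, e x = 1

/-! ### Morita equivalence of algebras without unit -/

section Morita

variable (𝕜 : Type v) [Field 𝕜]

/-- An `A`-`B`-bimodule structure on a vector space `M`, for algebras `A`, `B` possibly without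
unit. -/
structure Bimod (A B M : Type*) [NonUnitalRing A] [Module 𝕜 A] [NonUnitalRing B] [Module 𝕜 B]
    [AddCommGroup M] [Module 𝕜 M] where
  lsmul : A →ₗ[𝕜] M →ₗ[𝕜] M
  rsmul : M →ₗ[𝕜] B →ₗ[𝕜] M
  mul_lsmul : ∀ a a' m, lsmul (a * a') m = lsmul a (lsmul a' m)
  rsmul_mul : ∀ m b b', rsmul m (b * b') = rsmul (rsmul m b) b'
  lsmul_rsmul : ∀ a m b, rsmul (lsmul a m) b = lsmul a (rsmul m b)

variable {𝕜} {A B C : Type*} [NonUnitalRing A] [Module 𝕜 A] [NonUnitalRing B] [Module 𝕜 B]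
  [NonUnitalRing C] [Module 𝕜 C]

/-- An algebra as a bimodule over itself. -/
def Bimod.regular (𝕜 : Type v) [Field 𝕜] (A : Type*) [NonUnitalRing A] [Module 𝕜 A]
    [IsScalarTower 𝕜 A A] [SMulCommClass 𝕜 A A] : Bimod 𝕜 A A A where
  lsmul := LinearMap.mul 𝕜 A
  rsmul := LinearMap.mul 𝕜 A
  mul_lsmul a a' m := mul_assoc a a' m
  rsmul_mul m b b' := (mul_assoc m b b').symm
  lsmul_rsmul a m b := mul_assoc a m b

variable {M N L : Type*} [AddCommGroup M] [Module 𝕜 M] [AddCommGroup N] [Module 𝕜 N]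
  [AddCommGroup L] [Module 𝕜 L]

/-- The subspace of `M ⊗ N` spanned by the elements `m b ⊗ n - m ⊗ b n`; the quotient by it is
the tensor product `M ⊗_B N`. -/
def Bimod.balancing (P : Bimod 𝕜 A B M) (Q : Bimod 𝕜 B C N) : Submodule 𝕜 (M ⊗[𝕜] N) :=
  Submodule.span 𝕜 {t | ∃ m b n, t = P.rsmul m b ⊗ₜ[𝕜] n - m ⊗ₜ[𝕜] Q.lsmul b n}

theorem Bimod.balancing_le_ker {P : Bimod 𝕜 A B M} {Q : Bimod 𝕜 B C N} {φ : M →ₗ[𝕜] N →ₗ[𝕜] L}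
    (h : ∀ m b n, φ (P.rsmul m b) n = φ m (Q.lsmul b n)) :
    P.balancing Q ≤ LinearMap.ker (TensorProduct.lift φ) := by
  refine Submodule.span_le.2 ?_
  rintro _ ⟨m, b, n, rfl⟩
  simp [h]

/-- The pairing `φ : M × N → L` induces an isomorphism of `A`-`C`-bimodules `M ⊗_B N ≅ L`. -/
structure Bimod.InducesIso (P : Bimod 𝕜 A B M) (Q : Bimod 𝕜 B C N) (R : Bimod 𝕜 A C L)
    (φ : M →ₗ[𝕜] N →ₗ[𝕜] L) : Prop where
  balanced : ∀ m b n, φ (P.rsmul m b) n = φ m (Q.lsmul b n)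
  map_lsmul : ∀ a m n, φ (P.lsmul a m) n = R.lsmul a (φ m n)
  map_rsmul : ∀ m n c, φ m (Q.rsmul n c) = R.rsmul (φ m n) c
  bijective : Function.Bijective
    ((P.balancing Q).liftQ (TensorProduct.lift φ) (Bimod.balancing_le_ker balanced))

/-- Morita equivalence of two (quasi-unital) algebras `A` and `B`: there are an `A`-`B`-bimodule `M`
and a `B`-`A`-bimodule `N` which are essential (`A ⊗_A M ≅ M ≅ M ⊗_B B` and
`B ⊗_B N ≅ N ≅ N ⊗_A A` via the actions), and bimodule isomorphisms
`Ξ : M ⊗_B N ≅ A` and `Θ : N ⊗_A M ≅ B` with `Ξ(m, n) m' = m Θ(n, m')` and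
`Θ(n, m) n' = n Ξ(m, n')`. -/
def MoritaEquivalent (𝕜 : Type v) [Field 𝕜] (A B : Type u) [NonUnitalRing A] [Module 𝕜 A]
    [IsScalarTower 𝕜 A A] [SMulCommClass 𝕜 A A] [NonUnitalRing B] [Module 𝕜 B]
    [IsScalarTower 𝕜 B B] [SMulCommClass 𝕜 B B] : Prop :=
  ∃ (M N : Type u) (_ : AddCommGroup M) (_ : Module 𝕜 M) (_ : AddCommGroup N) (_ : Module 𝕜 N)
    (P : Bimod 𝕜 A B M) (Q : Bimod 𝕜 B A N)
    (Ξ : M →ₗ[𝕜] N →ₗ[𝕜] A) (Θ : N →ₗ[𝕜] M →ₗ[𝕜] B),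
    (Bimod.regular 𝕜 A).InducesIso P P P.lsmul ∧
    P.InducesIso (Bimod.regular 𝕜 B) P P.rsmul ∧
    (Bimod.regular 𝕜 B).InducesIso Q Q Q.lsmul ∧
    Q.InducesIso (Bimod.regular 𝕜 A) Q Q.rsmul ∧
    P.InducesIso Q (Bimod.regular 𝕜 A) Ξ ∧
    Q.InducesIso P (Bimod.regular 𝕜 B) Θ ∧
    (∀ m n m', P.lsmul (Ξ m n) m' = P.rsmul m (Θ n m')) ∧
    (∀ n m n', Q.lsmul (Θ n m) n' = Q.rsmul n (Ξ m n'))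

end Morita

end GerbeDuality

open GerbeDuality

/-!
The extension `M × G → 𝔥 → 𝔔` is a finite covering of arrow spaces, hence trivial over each
contractible component of the arrows of `𝔔`; a component that meets the units consists of units,
where the canonical lift is used. This gives continuous sections
(`GerbeExtension.nonempty_section`). By Schur's lemma an intertwiner between irreducible
representations is unique up to a scalar and can be rescaled to a unitary one, and two unitary
ones differ by a phase (`UnitaryDual.exists_unitary_twist`, `UnitaryDual.exists_phase`). Hence the
operators `T_q` exist, and `T_{q₂} T_{q₁}` and `T_{q₁ q₂} ρ(τ(q₁, q₂))⁻¹` differ by a phase `c`.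
The identity `τ(q₁, q₂) τ(q₁ q₂, q₃) = Ad_{σ(q₁)}(τ(q₂, q₃)) τ(q₁, q₂ q₃)` makes `c` a cocycle:
its two sides are the phases obtained from the two ways to bracket `T_{q₃} T_{q₂} T_{q₁}`.

For the Morita equivalence, every arrow of `𝔥` is `g σ(q)` for unique `g` in `G` and `q` in `𝔔`.
Let it act on `∏ V_ρ` by the operator with blocks `ρ(g) (T_q^ρ)⁻¹ : V_{q(ρ)} → V_ρ`. These
operators form a projective representation of `𝔥` with multiplier `c⁻¹`
(`Intertwiners.defect_smul_op_op`), and, for fixed `q`, those with `g` in `G` are a basis of the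
operators whose blocks have this shape, because `ℂ[G]` is the product of the matrix algebras `End
V_ρ`. Replacing each arrow by the matrix coefficients of its operator in a basis of `∏ V_ρ`, a
Fourier transform along the fibres of `𝔥 → 𝔔`, therefore identifies the crossed product `A` by `𝔥`
with an algebra of matrices over the twisted crossed product `B` by `Ĝ ⋊ 𝔔`, the `(j, k)` entry
lying in `p_ρ B p_ρ'` if the basis vectors `j` and `k` belong to `V_ρ` and `V_ρ'`; here `p_ρ` is
the indicator function of the sheet `{ρ} × M` of units, a multiplier of `B`
(`Intertwiners.matrix_mul`, `Intertwiners.matrix_injective`, `Intertwiners.exists_matrix_eq`).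

Such a matrix algebra is Morita equivalent to `B`, via columns and rows
(`MoritaEquivalent.of_matrix`), because each `ρ` occurs among the basis vectors and the `p_ρ` sum
to the identity. Neither algebra needs to have a unit, but both have local units: compactly
supported sections over the units that are `1` on a large compact set
(`CrossedProduct.hasLocalUnits`). With local units, a Morita context whose pairings span is a
Morita equivalence in the sense of tensor products (`MoritaEquivalent.of_context`).
-/

namespace GerbeDuality

/-! ### Irreducible representations of a finite group -/

namespace UnitaryDual

variable {G : Type w} [Group G] (R : UnitaryDual G)

instance nontrivial_V (i : R.ι) : Nontrivial (R.V i) := by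
  have := R.irreducible i
  by_contra h
  rw [not_nontrivial_iff_subsingleton] at h
  have h2 := (R.irreducible i).exists_pair_ne
  obtain ⟨a, b, hab⟩ := h2
  refine hab (Subrepresentation.toSubmodule_injective ?_)
  exact Subsingleton.elim _ _

/-- Schur's lemma. -/
theorem exists_eq_smul {i : R.ι} (f : R.V i →ₗ[ℂ] R.V i)
    (hf : ∀ g v, f (R.ρ i g v) = R.ρ i g (f v)) : ∃ r : ℂ, ∀ v, f v = r • v := by
  have := R.irreducible i
  let f' : (R.ρ i).IntertwiningMap (R.ρ i) :=
    LinearMap.intertwiningMap_of_isIntertwiningMap _ _ f hf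
  obtain ⟨r, hr⟩ :=
    (Representation.IsIrreducible.algebraMap_intertwiningMap_bijective_of_isAlgClosed
      (ρ := R.ρ i)).2 f'
  refine ⟨r, fun v => ?_⟩
  have := congrArg (fun t : (R.ρ i).IntertwiningMap (R.ρ i) => t v) hr
  exact this.symm

theorem eq_zero_of_ne {i k : R.ι} (hik : i ≠ k) (f : R.V i →ₗ[ℂ] R.V k)
    (hf : ∀ g v, f (R.ρ i g v) = R.ρ k g (f v)) : f = 0 := by
  have := R.irreducible i
  have := R.irreducible k
  let f' : (R.ρ i).IntertwiningMap (R.ρ k) :=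
    LinearMap.intertwiningMap_of_isIntertwiningMap _ _ f hf
  rcases Representation.IsIrreducible.bijective_or_eq_zero f' with h | h
  · exact absurd (R.eq_of_equiv _ _ ⟨f'.ofBijective h⟩) hik
  · exact congrArg (fun t : (R.ρ i).IntertwiningMap (R.ρ k) => t.toLinearMap) h

/-- Averaging the rank one operator `x ↦ φ x • v` over `G` realizes it as the action of an element
of the group algebra which vanishes in all other irreducible representations. -/
theorem exists_rankOne [Fintype G] (i : R.ι) (v : R.V i) (φ : R.V i →ₗ[ℂ] ℂ) :
    ∃ z : G → ℂ, (∀ x, ∑ g, z g • R.ρ i g x = φ x • v) ∧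
      ∀ k, k ≠ i → ∀ x, ∑ g, z g • R.ρ k g x = 0 := by
  -- the average of `w ↦ φ w • x` over `G`
  let P : ∀ k, R.V k → R.V i →ₗ[ℂ] R.V k := fun k x =>
    ∑ g : G, (R.ρ k g) ∘ₗ (φ.smulRight x) ∘ₗ (R.ρ i g⁻¹)
  have hPa : ∀ k x w, P k x w = ∑ g : G, φ (R.ρ i g⁻¹ w) • R.ρ k g x := fun k x w => by
    simp [P]
  have hP : ∀ k x h w, P k x (R.ρ i h w) = R.ρ k h (P k x w) := by
    intro k x h w
    rw [hPa, hPa, map_sum]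
    refine Fintype.sum_equiv (Equiv.mulLeft h⁻¹) _ _ fun g => ?_
    simp [← Module.End.mul_apply, ← map_mul]
  let n : ℂ := Module.finrank ℂ (R.V i)
  have hn : n ≠ 0 := Nat.cast_ne_zero.2 (Module.finrank_pos).ne'
  have hG : (Fintype.card G : ℂ) ≠ 0 := Nat.cast_ne_zero.2 Fintype.card_ne_zero
  refine ⟨fun g => (n / Fintype.card G) * φ (R.ρ i g⁻¹ v), fun x => ?_, fun k hk x => ?_⟩
  · obtain ⟨r, hr⟩ := R.exists_eq_smul (P i x) (hP i x)
    have h1 : LinearMap.trace ℂ _ (P i x) = r * n := by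
      have : P i x = r • LinearMap.id := LinearMap.ext hr
      rw [this, map_smul, LinearMap.trace_id, smul_eq_mul]
    have h2 : LinearMap.trace ℂ _ (P i x) = Fintype.card G * φ x := by
      have h3 : ∀ g : G, LinearMap.trace ℂ _ ((R.ρ i g) ∘ₗ (φ.smulRight x) ∘ₗ (R.ρ i g⁻¹)) =
          φ x := fun g => by
        rw [LinearMap.trace_comp_comm', LinearMap.comp_assoc, ← Module.End.mul_eq_comp (R.ρ i g⁻¹),
          ← map_mul, inv_mul_cancel, map_one]
        exact LinearMap.trace_smulRight _ _
      simp [P, h3]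
    have h4 : r = Fintype.card G * φ x / n := by
      rw [eq_div_iff hn, ← h1, h2]
    simp only [mul_smul, ← Finset.smul_sum]
    rw [← hPa, hr, h4, smul_smul]
    congr 1
    field_simp
  · simp only [mul_smul, ← Finset.smul_sum]
    rw [← hPa, R.eq_zero_of_ne hk.symm _ (hP k x), LinearMap.zero_apply, smul_zero]

/-- Each irreducible representation, in any universe, is equivalent to one of the chosen ones: it
can be moved to a space `Fin n → ℂ`. -/
theorem exists_equiv' {W : Type*} [AddCommGroup W] [Module ℂ W] [FiniteDimensional ℂ W]
    (π : Representation ℂ G W) (hπ : π.IsIrreducible) : ∃ i, Nonempty (π.Equiv (R.ρ i)) := by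
  let e : W ≃ₗ[ℂ] (Fin (Module.finrank ℂ W) → ℂ) := (Module.finBasis ℂ W).equivFun
  let π' : Representation ℂ G (Fin (Module.finrank ℂ W) → ℂ) :=
    (e.conjAlgEquiv ℂ : _ →* _).comp π
  let E : π.Equiv π' := Representation.Equiv.mk e fun g => by
    ext v
    simp [π']
  have hπ' : π'.IsIrreducible := by
    rw [Representation.irreducible_iff_isSimpleModule_asModule] at hπ ⊢
    exact IsSimpleModule.congr (LinearEquiv.ofBijective
      (Representation.IntertwiningMap.equivLinearMapAsModule π' π E.symm.toIntertwiningMap)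
      E.symm.toLinearEquiv.bijective)
  obtain ⟨i, ⟨F⟩⟩ := R.exists_equiv _ π' hπ'
  exact ⟨i, ⟨E.trans F⟩⟩

/-- The irreducible representations separate the elements of the group algebra: this is Maschke's
theorem, applied to the regular representation. -/
theorem eq_zero_of_forall_sum_eq_zero [Fintype G] (z : G → ℂ)
    (hz : ∀ i (x : R.V i), ∑ g, z g • R.ρ i g x = 0) : z = 0 := by
  classical
  let a : MonoidAlgebra ℂ G := ∑ g, MonoidAlgebra.single g (z g)
  have key : ∀ {W : Type w} [AddCommGroup W] [Module ℂ W] [FiniteDimensional ℂ W]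
      (π : Representation ℂ G W), π.IsIrreducible → π.asAlgebraHom a = 0 := by
    intro W _ _ _ π hπ
    obtain ⟨i, ⟨F⟩⟩ := R.exists_equiv' π hπ
    refine LinearMap.ext fun x => F.toLinearEquiv.injective ?_
    have h : ∀ g, F.toLinearEquiv (π g x) = R.ρ i g (F.toLinearEquiv x) := fun g =>
      F.toIntertwiningMap.isIntertwining _ _ g x
    simp [a, h, hz]
  -- `a` acts by zero on the simple submodules of `ℂ[G]`, which span
  have hann : ∀ m : MonoidAlgebra ℂ G, a * m = 0 := by
    intro m
    have hm : m ∈ sSup {S : Submodule (MonoidAlgebra ℂ G) (MonoidAlgebra ℂ G) |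
        IsSimpleModule (MonoidAlgebra ℂ G) S} := by
      rw [IsSemisimpleModule.sSup_simples_eq_top]; trivial
    rw [sSup_eq_iSup'] at hm
    refine Submodule.iSup_induction _ (motive := fun m => a * m = 0) hm ?_ (mul_zero a)
      fun x y hx hy => by rw [mul_add, hx, hy, add_zero]
    rintro ⟨S, hS⟩ x hx
    have hS' : IsSimpleModule (MonoidAlgebra ℂ G) S := hS
    have hfin : FiniteDimensional ℂ S :=
      inferInstanceAs (FiniteDimensional ℂ (S.restrictScalars ℂ))
    let π : Representation ℂ G S := Representation.ofModule' S
    have hπ : π.asAlgebraHom = Algebra.lsmul ℂ ℂ S :=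
      (MonoidAlgebra.lift ℂ (Module.End ℂ S) G).apply_symm_apply _
    let e : π.asModule ≃ₗ[MonoidAlgebra ℂ G] S :=
      { π.asModuleEquiv.toAddEquiv with
        map_smul' := fun r y => by
          change π.asModuleEquiv (r • y) = r • π.asModuleEquiv y
          rw [π.asModuleEquiv_map_smul, hπ]
          rfl }
    have h := key π
      ((Representation.irreducible_iff_isSimpleModule_asModule π).2 (IsSimpleModule.congr e))
    rw [hπ] at h
    exact congrArg Subtype.val (LinearMap.congr_fun h ⟨x, hx⟩)
  have h1 := hann 1
  rw [mul_one] at h1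
  funext g
  have h2 := congrArg (fun t : MonoidAlgebra ℂ G => t.coeff g) h1
  simpa [a, Finsupp.single_apply] using h2

/-- Matrix coefficients of inequivalent irreducible representations are linearly independent
functions on `G`. -/
theorem finite_index [Finite G] : Finite R.ι := by
  have := Fintype.ofFinite G
  choose v hv using fun i => exists_ne (0 : R.V i)
  have hdual : ∀ i, ∃ φ : R.V i →ₗ[ℂ] ℂ, φ (v i) ≠ 0 := fun i => by
    by_contra! h
    exact hv i ((Module.forall_dual_apply_eq_zero_iff ℂ (v i)).1 h)
  choose φ hφ using hdual
  have hli : LinearIndependent ℂ fun i => (fun g : G => φ i (R.ρ i g (v i))) := by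
    rw [linearIndependent_iff']
    intro s c hc i hi
    obtain ⟨z, hz, hz'⟩ := R.exists_rankOne i (v i) (φ i)
    have h1 : ∑ g, z g * ∑ k ∈ s, c k * φ k (R.ρ k g (v k)) = 0 :=
      Finset.sum_eq_zero fun g _ => by
        have := congrFun hc g
        simp only [Finset.sum_apply, Pi.smul_apply, smul_eq_mul, Pi.zero_apply] at this
        rw [this, mul_zero]
    have h2 : ∑ g, z g * ∑ k ∈ s, c k * φ k (R.ρ k g (v k)) =
        ∑ k ∈ s, c k * φ k (∑ g, z g • R.ρ k g (v k)) := by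
      simp only [map_sum, map_smul, Finset.mul_sum, smul_eq_mul]
      rw [Finset.sum_comm]
      exact Finset.sum_congr rfl fun k _ => Finset.sum_congr rfl fun g _ => by ring
    rw [h2, Finset.sum_eq_single_of_mem i hi fun k _ hk => by rw [hz' k hk, map_zero, mul_zero],
      hz, map_smul, smul_eq_mul] at h1
    exact (mul_eq_zero.1 h1).resolve_right (mul_ne_zero (hφ i) (hφ i))
  exact hli.finite

end UnitaryDual

/-! ### Unitary intertwiners -/

namespace UnitaryDual

variable {G : Type w} [Group G] (R : UnitaryDual G)

theorem inner_rho (i : R.ι) (g : G) (v w : R.V i) :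
    Inner.inner ℂ (R.ρ i g v) (R.ρ i g w) = Inner.inner ℂ v w :=
  LinearIsometry.inner_map_map (⟨R.ρ i g, R.unitary i g⟩ : R.V i →ₗᵢ[ℂ] R.V i) v w

theorem rho_apply_inv (i : R.ι) (g : G) (v : R.V i) : R.ρ i g (R.ρ i g⁻¹ v) = v := by
  rw [← Module.End.mul_apply, ← map_mul, mul_inv_cancel, map_one, Module.End.one_apply]

/-- By Schur's lemma `T* T` is a scalar, so that an intertwiner `T` can be rescaled to a unitary
one. -/
theorem exists_unitary {α : G ≃* G} {i k : R.ι} (T : R.V i ≃ₗ[ℂ] R.V k)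
    (hT : ∀ g v, T (R.ρ i (α g) v) = R.ρ k g (T v)) :
    ∃ U : R.V i ≃ₗᵢ[ℂ] R.V k, ∀ g v, U (R.ρ i (α g) v) = R.ρ k g (U v) := by
  let S : R.V i →ₗ[ℂ] R.V i := (LinearMap.adjoint T.toLinearMap) ∘ₗ T.toLinearMap
  have hS : ∀ u v, Inner.inner ℂ (S u) v = Inner.inner ℂ (T u) (T v) := fun u v =>
    LinearMap.adjoint_inner_left T.toLinearMap v (T u)
  obtain ⟨r, hr⟩ := R.exists_eq_smul S fun h v => by
    refine ext_inner_right ℂ fun u => ?_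
    obtain ⟨g, rfl⟩ := α.surjective h
    rw [hS, hT, ← R.rho_apply_inv i (α g) u, hT, R.inner_rho, R.inner_rho, hS]
  have hnorm : ∀ v, ‖T v‖ ^ 2 = ‖r‖ * ‖v‖ ^ 2 := fun v => by
    have h := hS v v
    rw [hr, inner_smul_left, inner_self_eq_norm_sq_to_K, inner_self_eq_norm_sq_to_K] at h
    have h2 := congrArg norm h
    simpa using h2.symm
  have hr0 : r ≠ 0 := by
    rintro rfl
    obtain ⟨v, hv⟩ := exists_ne (0 : R.V i)
    have h := hnorm v
    simp only [norm_zero, zero_mul, ne_eq, OfNat.ofNat_ne_zero, not_false_eq_true,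
      pow_eq_zero_iff, norm_eq_zero, EmbeddingLike.map_eq_zero_iff] at h
    exact hv h
  have hr1 : 0 < Real.sqrt ‖r‖ := Real.sqrt_pos.2 (norm_pos_iff.2 hr0)
  let s : ℂ := ((Real.sqrt ‖r‖)⁻¹ : ℝ)
  have hs : s ≠ 0 := Complex.ofReal_ne_zero.2 (inv_ne_zero hr1.ne')
  refine ⟨⟨T.trans (LinearEquiv.smulOfNeZero ℂ _ s hs), fun v => ?_⟩, fun g v => ?_⟩
  · change ‖s • T v‖ = ‖v‖
    have h1 : ‖T v‖ = Real.sqrt ‖r‖ * ‖v‖ := by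
      rw [← Real.sqrt_sq (norm_nonneg (T v)), hnorm, Real.sqrt_mul (norm_nonneg _),
        Real.sqrt_sq (norm_nonneg _)]
    rw [norm_smul, h1, Complex.norm_real, Real.norm_of_nonneg (inv_nonneg.2 hr1.le),
      inv_mul_cancel_left₀ hr1.ne']
  · change s • T (R.ρ i (α g) v) = R.ρ k g (s • T v)
    rw [hT, map_smul]

/-- Unitary intertwiners `V_ρ ≅ V_{ρ ∘ α}`, chosen to be the identity if `α` is; the last condition
is an equality in a sigma type because `ρ ∘ id` and `ρ` are only propositionally equal indices. -/
theorem exists_unitary_twist (α : G ≃* G) (i : R.ι) :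
    ∃ U : R.V i ≃ₗᵢ[ℂ] R.V (R.twist α i),
      (∀ g v, U (R.ρ i (α g) v) = R.ρ (R.twist α i) g (U v)) ∧
      (α = MulEquiv.refl G → (⟨_, U⟩ : Σ k, R.V i ≃ₗᵢ[ℂ] R.V k) =
        ⟨i, LinearIsometryEquiv.refl ℂ (R.V i)⟩) := by
  by_cases hα : α = MulEquiv.refl G
  · subst hα
    have key : ∀ k, k = i → ∃ U : R.V i ≃ₗᵢ[ℂ] R.V k,
        (∀ g v, U (R.ρ i g v) = R.ρ k g (U v)) ∧
        (⟨_, U⟩ : Σ k, R.V i ≃ₗᵢ[ℂ] R.V k) = ⟨i, LinearIsometryEquiv.refl ℂ (R.V i)⟩ := by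
      rintro k rfl
      exact ⟨LinearIsometryEquiv.refl ℂ _, fun _ _ => rfl, rfl⟩
    obtain ⟨U, hU, hU'⟩ := key _ (R.twist_refl i)
    exact ⟨U, hU, fun _ => hU'⟩
  · obtain ⟨T, hT⟩ := R.twist_spec α i
    obtain ⟨U, hU⟩ := R.exists_unitary T hT
    exact ⟨U, hU, fun h => absurd h hα⟩

/-- Two unitary intertwiners between the same irreducible representations differ by a phase. -/
theorem exists_phase {α : G ≃* G} {i k k' : R.ι} (h : k = k') (S : R.V i →ₗ[ℂ] R.V k)
    (hSn : ∀ v, ‖S v‖ = ‖v‖) (hS : ∀ g v, S (R.ρ i (α g) v) = R.ρ k g (S v))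
    (T : R.V i ≃ₗᵢ[ℂ] R.V k') (hT : ∀ g v, T (R.ρ i (α g) v) = R.ρ k' g (T v)) :
    ∃ c : Circle, ∀ v, (⟨k, S v⟩ : Σ k, R.V k) = ⟨k', (c : ℂ) • T v⟩ := by
  subst h
  obtain ⟨r, hr⟩ := R.exists_eq_smul (T.symm.toLinearEquiv.toLinearMap ∘ₗ S) fun h v => by
    obtain ⟨g, rfl⟩ := α.surjective h
    apply T.injective
    change T (T.symm (S _)) = T (R.ρ i (α g) (T.symm (S v)))
    rw [hT, T.apply_symm_apply, T.apply_symm_apply, hS]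
  have hr' : ∀ v, S v = r • T v := fun v => by
    rw [← map_smul, ← hr]
    exact (T.apply_symm_apply _).symm
  obtain ⟨v, hv⟩ := exists_ne (0 : R.V i)
  have h1 : ‖r‖ = 1 := by
    have h2 := hSn v
    rw [hr', norm_smul, T.norm_map] at h2
    exact mul_right_cancel₀ (norm_ne_zero_iff.2 hv) (h2.trans (one_mul _).symm)
  exact ⟨⟨r, mem_sphere_zero_iff_norm.2 h1⟩, fun v => by rw [hr' v]⟩

end UnitaryDual

namespace GerbeExtension.Section

variable {G : Type w} [Group G] {M : Type u} [TopologicalSpace M] {𝔔 : EtaleGroupoid M}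
  {E : GerbeExtension G 𝔔} (σ : E.Section)

/-- The defining equation `τ(q₁, q₂) σ(q₁ q₂) = σ(q₁) σ(q₂)` determines `τ(q₁, q₂)`. -/
theorem tau_eq {x y z : M} {q₁ : 𝔔.Hom x y} {q₂ : 𝔔.Hom y z} {g : G}
    (h : E.tot.comp (E.incl x g) (σ.lift (𝔔.comp q₁ q₂)) =
      E.tot.comp (σ.lift q₁) (σ.lift q₂)) : σ.tau q₁ q₂ = g := by
  apply E.incl_injective x
  rw [incl_tau, ← h, E.tot.assoc, E.tot.comp_inv, E.tot.comp_id]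

theorem incl_tau_comp {x y z : M} (q₁ : 𝔔.Hom x y) (q₂ : 𝔔.Hom y z) :
    E.tot.comp (E.incl x (σ.tau q₁ q₂)) (σ.lift (𝔔.comp q₁ q₂)) =
      E.tot.comp (σ.lift q₁) (σ.lift q₂) := by
  rw [incl_tau, E.tot.assoc, E.tot.inv_comp, E.tot.comp_id]

theorem tau_id_left {x y : M} (q : 𝔔.Hom x y) : σ.tau (𝔔.id x) q = 1 :=
  σ.tau_eq (by rw [E.incl_one, E.tot.id_comp, σ.lift_id, E.tot.id_comp, 𝔔.id_comp])

theorem tau_id_right {x y : M} (q : 𝔔.Hom x y) : σ.tau q (𝔔.id y) = 1 :=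
  σ.tau_eq (by rw [E.incl_one, E.tot.id_comp, σ.lift_id, E.tot.comp_id, 𝔔.comp_id])

/-- The non-abelian cocycle identity
`τ(q₁, q₂) τ(q₁ q₂, q₃) = Ad_{σ(q₁)}(τ(q₂, q₃)) τ(q₁, q₂ q₃)`, which expresses associativity. -/
theorem tau_mul_tau {w x y z : M} (q₁ : 𝔔.Hom w x) (q₂ : 𝔔.Hom x y) (q₃ : 𝔔.Hom y z) :
    σ.tau q₁ q₂ * σ.tau (𝔔.comp q₁ q₂) q₃ =
      E.ad (σ.lift q₁) (σ.tau q₂ q₃) * σ.tau q₁ (𝔔.comp q₂ q₃) := by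
  have key : ∀ g : G, E.tot.comp (E.incl w g) (σ.lift (𝔔.comp (𝔔.comp q₁ q₂) q₃)) =
      E.tot.comp (E.tot.comp (σ.lift q₁) (σ.lift q₂)) (σ.lift q₃) →
      E.incl w g = E.tot.comp (E.tot.comp (E.tot.comp (σ.lift q₁) (σ.lift q₂)) (σ.lift q₃))
        (E.tot.inv (σ.lift (𝔔.comp (𝔔.comp q₁ q₂) q₃))) := fun g hg => by
    rw [← hg, E.tot.assoc, E.tot.comp_inv, E.tot.comp_id]
  apply E.incl_injective w
  rw [key, key]
  · rw [𝔔.assoc, E.incl_mul, E.tot.assoc, σ.incl_tau_comp, ← E.tot.assoc]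
    change E.tot.comp (E.tot.comp (E.incl w (E.adFun _ _)) _) _ = _
    rw [E.incl_adFun_comp, E.tot.assoc, σ.incl_tau_comp, E.tot.assoc]
  · rw [E.incl_mul, E.tot.assoc, σ.incl_tau_comp, ← E.tot.assoc, σ.incl_tau_comp]

/-- For a fixed `g`, the arrows `g σ(q₁ q₂)` and `σ(q₁) σ(q₂)` have the same source, so they agree
on an open set because the source map is locally injective. -/
theorem isLocallyConstant_tau :
    IsLocallyConstant fun p : Composable 𝔔.toGroupoid => σ.tau p.fst p.snd := by
  rw [IsLocallyConstant.iff_exists_open]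
  intro p₀
  set g := σ.tau p₀.fst p₀.snd
  have h1 : Continuous fun p : Composable 𝔔.toGroupoid => (⟨p.x, p.z,
      E.tot.comp (E.incl p.x g) (σ.lift (𝔔.comp p.fst p.snd))⟩ : E.tot.Arr) :=
    E.tot.continuous_comp.comp (f := fun p : Composable 𝔔.toGroupoid => (⟨p.x, p.x, p.z,
      E.incl p.x g, σ.lift (𝔔.comp p.fst p.snd)⟩ : Composable E.tot.toGroupoid))
      (continuous_induced_rng.2 (((E.continuous_incl g).comp
        (𝔔.continuous_src.comp (Composable.continuous_fst _))).prodMk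
        (σ.continuous_lift.comp 𝔔.continuous_comp)))
  have h2 : Continuous fun p : Composable 𝔔.toGroupoid => (⟨p.x, p.z,
      E.tot.comp (σ.lift p.fst) (σ.lift p.snd)⟩ : E.tot.Arr) :=
    E.tot.continuous_comp.comp (f := fun p : Composable 𝔔.toGroupoid => (⟨p.x, p.y, p.z,
      σ.lift p.fst, σ.lift p.snd⟩ : Composable E.tot.toGroupoid))
      (continuous_induced_rng.2 ((σ.continuous_lift.comp (Composable.continuous_fst _)).prodMk
        (σ.continuous_lift.comp (Composable.continuous_snd _))))
  refine ⟨_, E.tot.isLocalHomeomorph_src.isLocallyInjective.isOpen_eqLocus h1 h2 rfl, ?_, ?_⟩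
  · exact congrArg (Arrow.mk _ _) (σ.incl_tau_comp _ _)
  · intro p hp
    refine σ.tau_eq ?_
    simpa using hp

variable [Finite G]

theorem nonempty_intertwiners (R : UnitaryDual G) : Nonempty (σ.Intertwiners R) := by
  choose U hU hU' using R.exists_unitary_twist
  exact ⟨{
    T := fun q i => U (E.ad (σ.lift q)) i
    intertwines := fun q i g v => hU _ i g v
    T_id := fun x i => hU' _ i (MulEquiv.ext fun g => by
      rw [σ.lift_id]
      exact E.adFun_id x g)
    isLocallyConstant := fun i => σ.isLocallyConstant_ad.comp fun α =>
      (⟨_, U α i⟩ : Σ k, R.V i ≃ₗᵢ[ℂ] R.V k) }⟩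

namespace Intertwiners

variable {σ} {R : UnitaryDual G} (T : σ.Intertwiners R)

/-- The operators `T_q` assembled to a self-map of the disjoint union of the spaces `V_ρ`.  In this
form composites need no identification of `V_{q₂(q₁([ρ]))}` with `V_{(q₁q₂)([ρ])}`. -/
noncomputable def map {x y : M} (q : 𝔔.Hom x y) (a : Σ k, R.V k) : Σ k, R.V k := ⟨_, T.T q a.1 a.2⟩

theorem map_congr {x y x' y' : M} {q : 𝔔.Hom x y} {q' : 𝔔.Hom x' y'} {i : R.ι}
    (h : (⟨_, T.T q i⟩ : Σ k, R.V i ≃ₗᵢ[ℂ] R.V k) = ⟨_, T.T q' i⟩) (v : R.V i) :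
    T.map q ⟨i, v⟩ = T.map q' ⟨i, v⟩ :=
  congrArg (fun s : Σ k, R.V i ≃ₗᵢ[ℂ] R.V k => (⟨s.1, s.2 v⟩ : Σ k, R.V k)) h

theorem map_id (x : M) (a : Σ k, R.V k) : T.map (𝔔.id x) a = a :=
  congrArg (fun s : Σ k, R.V a.1 ≃ₗᵢ[ℂ] R.V k => (⟨s.1, s.2 a.2⟩ : Σ k, R.V k)) (T.T_id x a.1)

theorem map_injective {x y : M} (q : 𝔔.Hom x y) {i : R.ι} {v v' : R.V i}
    (h : T.map q ⟨i, v⟩ = T.map q ⟨i, v'⟩) : v = v' :=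
  (T.T q i).injective (eq_of_heq (Sigma.mk.inj h).2)

theorem map_map_injective {x y z : M} (q₁ : 𝔔.Hom x y) (q₂ : 𝔔.Hom y z) {i : R.ι} {v v' : R.V i}
    (h : T.map q₂ (T.map q₁ ⟨i, v⟩) = T.map q₂ (T.map q₁ ⟨i, v'⟩)) : v = v' :=
  (T.T q₁ i).injective (T.map_injective q₂ h)

theorem map_rho {x y : M} (q : 𝔔.Hom x y) (i : R.ι) (g : G) (v : R.V i) :
    T.map q ⟨i, R.ρ i (E.ad (σ.lift q) g) v⟩ = ⟨_, R.ρ _ g (T.T q i v)⟩ := by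
  rw [map, T.intertwines]

theorem map_smul {x y : M} (q : 𝔔.Hom x y) (c : ℂ) (a : Σ k, R.V k) :
    T.map q ⟨a.1, c • a.2⟩ = ⟨_, c • (T.map q a).2⟩ := by
  rw [map, _root_.map_smul]; rfl

theorem exists_defect {x y z : M} (q₁ : 𝔔.Hom x y) (q₂ : 𝔔.Hom y z) (i : R.ι) :
    ∃ c : Circle, ∀ v : R.V i, T.map q₂ (T.map q₁ ⟨i, R.ρ i (σ.tau q₁ q₂) v⟩) =
      ⟨_, (c : ℂ) • (T.map (𝔔.comp q₁ q₂) ⟨i, v⟩).2⟩ := by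
  refine R.exists_phase (α := E.ad (σ.lift (𝔔.comp q₁ q₂)))
    ((σ.dualAction R).act_comp q₁ q₂ i).symm
    ((T.T q₂ _).toLinearEquiv.toLinearMap ∘ₗ (T.T q₁ i).toLinearEquiv.toLinearMap ∘ₗ
      R.ρ i (σ.tau q₁ q₂)) (fun v => ?_) (fun g v => ?_) (T.T (𝔔.comp q₁ q₂) i)
      (T.intertwines _ i)
  · change ‖T.T q₂ _ (T.T q₁ i (R.ρ i (σ.tau q₁ q₂) v))‖ = _
    rw [LinearIsometryEquiv.norm_map, LinearIsometryEquiv.norm_map, R.unitary]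
  · change T.T q₂ _ (T.T q₁ i (R.ρ i (σ.tau q₁ q₂) _)) =
      R.ρ _ g (T.T q₂ _ (T.T q₁ i (R.ρ i (σ.tau q₁ q₂) v)))
    rw [← T.intertwines, ← T.intertwines, σ.ad_ad, ← Module.End.mul_apply, ← Module.End.mul_apply,
      ← map_mul, ← map_mul, inv_mul_cancel_right]

/-- The phase `c^{[ρ]}(q₁, q₂)` by which `T_{q₂} T_{q₁}` differs from
`T_{q₁ q₂} ρ(τ(q₁, q₂))⁻¹`. -/
noncomputable def defect {x y z : M} (q₁ : 𝔔.Hom x y) (q₂ : 𝔔.Hom y z) (i : R.ι) : Circle :=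
  (T.exists_defect q₁ q₂ i).choose

theorem map_map {x y z : M} (q₁ : 𝔔.Hom x y) (q₂ : 𝔔.Hom y z) (i : R.ι) (v : R.V i) :
    T.map q₂ (T.map q₁ ⟨i, R.ρ i (σ.tau q₁ q₂) v⟩) =
      T.map (𝔔.comp q₁ q₂) ⟨i, (T.defect q₁ q₂ i : ℂ) • v⟩ :=
  ((T.exists_defect q₁ q₂ i).choose_spec v).trans
    (T.map_smul _ (T.defect q₁ q₂ i : ℂ) ⟨i, v⟩).symm

theorem eq_of_map_smul {x y : M} {q : 𝔔.Hom x y} {i : R.ι} {c c' : Circle}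
    (h : ∀ v, T.map q ⟨i, (c : ℂ) • v⟩ = T.map q ⟨i, (c' : ℂ) • v⟩) : c = c' := by
  obtain ⟨v, hv⟩ := exists_ne (0 : R.V i)
  exact Circle.ext (smul_left_injective ℂ hv (T.map_injective q (h v)))

theorem defect_eq {x y z : M} {q₁ : 𝔔.Hom x y} {q₂ : 𝔔.Hom y z} {i : R.ι} {c : Circle}
    (h : ∀ v, T.map q₂ (T.map q₁ ⟨i, R.ρ i (σ.tau q₁ q₂) v⟩) =
      T.map (𝔔.comp q₁ q₂) ⟨i, (c : ℂ) • v⟩) : T.defect q₁ q₂ i = c :=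
  T.eq_of_map_smul fun v => (T.map_map q₁ q₂ i v).symm.trans (h v)

theorem defect_id_left {x y : M} (q : 𝔔.Hom x y) (i : R.ι) : T.defect (𝔔.id x) q i = 1 :=
  T.defect_eq fun v => by
    rw [σ.tau_id_left, T.map_id, 𝔔.id_comp, map_one, Circle.coe_one, one_smul]; rfl

theorem defect_id_right {x y : M} (q : 𝔔.Hom x y) (i : R.ι) : T.defect q (𝔔.id y) i = 1 :=
  T.defect_eq fun v => by
    rw [σ.tau_id_right, T.map_id, 𝔔.comp_id, map_one, Circle.coe_one, one_smul]; rfl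

/-- Both sides are the phase by which `T_{q₃} T_{q₂} T_{q₁}` differs from a translate of
`T_{q₁ q₂ q₃}`. -/
theorem defect_cocycle {w x y z : M} (q₁ : 𝔔.Hom w x) (q₂ : 𝔔.Hom x y) (q₃ : 𝔔.Hom y z)
    (i : R.ι) : T.defect q₁ q₂ i * T.defect (𝔔.comp q₁ q₂) q₃ i =
      T.defect q₁ (𝔔.comp q₂ q₃) i * T.defect q₂ q₃ ((σ.dualAction R).act q₁ i) := by
  refine T.eq_of_map_smul (q := 𝔔.comp (𝔔.comp q₁ q₂) q₃) (i := i) fun v => ?_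
  have h1 : T.map q₃ (T.map q₂ (T.map q₁
      ⟨i, R.ρ i (σ.tau q₁ q₂ * σ.tau (𝔔.comp q₁ q₂) q₃) v⟩)) =
      T.map (𝔔.comp (𝔔.comp q₁ q₂) q₃)
        ⟨i, ((T.defect q₁ q₂ i * T.defect (𝔔.comp q₁ q₂) q₃ i : Circle) : ℂ) • v⟩ := by
    rw [map_mul, Module.End.mul_apply, T.map_map, ← _root_.map_smul, T.map_map, Circle.coe_mul,
      mul_smul, smul_comm]
  have h2 : T.map q₃ (T.map q₂ (T.map q₁
      ⟨i, R.ρ i (E.ad (σ.lift q₁) (σ.tau q₂ q₃) * σ.tau q₁ (𝔔.comp q₂ q₃)) v⟩)) =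
      T.map (𝔔.comp q₁ (𝔔.comp q₂ q₃)) ⟨i, ((T.defect q₁ (𝔔.comp q₂ q₃) i *
        T.defect q₂ q₃ ((σ.dualAction R).act q₁ i) : Circle) : ℂ) • v⟩ := by
    rw [map_mul, Module.End.mul_apply, T.map_rho, T.map_map, ← _root_.map_smul,
      ← _root_.map_smul]
    refine (T.map_map q₁ (𝔔.comp q₂ q₃) i _).trans ?_
    rw [Circle.coe_mul, mul_smul]
  rw [← h1, σ.tau_mul_tau, h2, 𝔔.assoc]

/-- The phase is determined by the four quantities `T_{q₁}`, `T_{q₂}`, `T_{q₁ q₂}` and `τ(q₁, q₂)`,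
which are locally constant. -/
theorem isLocallyConstant_defect (i : R.ι) :
    IsLocallyConstant fun p : Composable 𝔔.toGroupoid => T.defect p.fst p.snd i := by
  rw [IsLocallyConstant.iff_eventually_eq]
  intro p₀
  have h1 := ((T.isLocallyConstant i).comp_continuous
    (Composable.continuous_fst 𝔔.toGroupoid)).eventually_eq p₀
  have h2 := ((T.isLocallyConstant ((σ.dualAction R).act p₀.fst i)).comp_continuous
    (Composable.continuous_snd 𝔔.toGroupoid)).eventually_eq p₀
  have h3 := ((T.isLocallyConstant i).comp_continuous 𝔔.continuous_comp).eventually_eq p₀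
  have h4 := σ.isLocallyConstant_tau.eventually_eq p₀
  filter_upwards [h1, h2, h3, h4] with p h1 h2 h3 h4
  refine T.defect_eq fun v => ?_
  have h4' : σ.tau p.fst p.snd = σ.tau p₀.fst p₀.snd := h4
  rw [T.map_congr h1, T.map_congr h3, h4', ← T.map_map]
  exact T.map_congr h2 _

/-- The cocycle `c` on `Ĝ ⋊ 𝔔`. -/
noncomputable def cocycle : LocConstCocycle (σ.dualAction R).transformation where
  toFun {p _ _} g h := T.defect g.1 h.1 p.1
  isLocallyConstant := by
    rw [IsLocallyConstant.iff_eventually_eq]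
    intro p₀
    have h1 := (σ.dualAction R).arrowHomeo.continuous.comp
      (Composable.continuous_fst (σ.dualAction R).groupoid)
    have h2 := (σ.dualAction R).arrowHomeo.continuous.comp
      (Composable.continuous_snd (σ.dualAction R).groupoid)
    have h3 : Continuous fun p : Composable (σ.dualAction R).groupoid =>
        (⟨p.x.2, p.y.2, p.z.2, p.fst.1, p.snd.1⟩ : Composable 𝔔.toGroupoid) :=
      continuous_induced_rng.2 ((continuous_snd.comp h1).prodMk (continuous_snd.comp h2))
    have h4 := ((IsLocallyConstant.iff_continuous _).2 (continuous_fst.comp h1)).eventually_eq p₀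
    filter_upwards [((T.isLocallyConstant_defect p₀.x.1).comp_continuous h3).eventually_eq p₀, h4]
      with p h5 h6
    exact (congrArg (T.defect p.fst.1 p.snd.1) h6).trans h5
  cocycle {w x y z} g₁ g₂ g₃ := by
    have h := T.defect_cocycle g₁.1 g₂.1 g₃.1 w.1
    rw [g₁.2] at h
    exact h

theorem isDefect_cocycle : T.IsDefect T.cocycle := fun q₁ q₂ i v =>
  (T.map_map q₁ q₂ i v).trans (T.map_smul _ _ ⟨i, v⟩)

end Intertwiners

end GerbeExtension.Section

/-! ### Existence of continuous sections -/

/-- A covering map has a continuous section over each contractible subspace of the base, by the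
homotopy lifting property. -/
theorem exists_continuous_lift_of_contractible {X Y : Type*} [TopologicalSpace X]
    [TopologicalSpace Y] {f : X → Y} (hf : IsCoveringMap f) (hs : Function.Surjective f)
    (U : Set Y) [ContractibleSpace U] : ∃ s : C(U, X), ∀ y, f (s y) = y := by
  obtain ⟨y₀, ⟨H⟩⟩ := id_nullhomotopic U
  obtain ⟨x₀, hx₀⟩ := hs y₀
  let K : C(unitInterval × U, Y) := (⟨Subtype.val, continuous_subtype_val⟩ : C(U, Y)).comp H.symm
  have hK : ∀ y, K (0, y) = f (ContinuousMap.const U x₀ y) := fun y => by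
    simp [K, hx₀]
  refine ⟨(hf.liftHomotopy K _ hK).comp ((ContinuousMap.const U 1).prodMk (ContinuousMap.id U)),
    fun y => ?_⟩
  refine (congrFun (hf.liftHomotopy_lifts K _ hK) (1, y)).trans ?_
  simp [K]

namespace EtaleGroupoid

variable {M : Type u} [TopologicalSpace M] (𝒢 : EtaleGroupoid M)

/-- The units of an étale groupoid are open because the source map is locally injective, and closed
because the arrow space is Hausdorff. -/
theorem isClopen_units : IsClopen {a : 𝒢.Arr | (⟨a.src, a.src, 𝒢.id a.src⟩ : 𝒢.Arr) = a} := by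
  have h : Continuous fun a : 𝒢.Arr => (⟨a.src, a.src, 𝒢.id a.src⟩ : 𝒢.Arr) :=
    𝒢.continuous_id.comp 𝒢.continuous_src
  exact ⟨isClosed_eq h _root_.continuous_id,
    𝒢.isLocalHomeomorph_src.isLocallyInjective.isOpen_eqLocus h _root_.continuous_id rfl⟩

end EtaleGroupoid

namespace GerbeExtension

variable {G : Type w} [Group G] {M : Type u} [TopologicalSpace M] {𝔔 : EtaleGroupoid M}
  (E : GerbeExtension G 𝔔)

/-- The map of arrow spaces underlying the morphism `𝔥 → 𝔔`. -/
def projArr (a : E.tot.Arr) : 𝔔.Arr := ⟨a.src, a.tgt, E.proj a.hom⟩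

/-- Left translation by the kernel `G` on the arrows of `𝔥`. -/
@[reducible] def arrAction : MulAction G E.tot.Arr where
  smul g a := ⟨a.src, a.tgt, E.tot.comp (E.incl a.src g) a.hom⟩
  one_smul a := by
    change Arrow.mk _ _ _ = _
    rw [E.incl_one, E.tot.id_comp]
  mul_smul g h a := by
    refine congrArg (Arrow.mk a.src a.tgt) ?_
    rw [E.incl_mul, E.tot.assoc]
    rfl

theorem proj_incl_comp {x y : M} (g : G) (h : E.tot.Hom x y) :
    E.proj (E.tot.comp (E.incl x g) h) = E.proj h := by
  rw [E.proj_comp, (E.proj_eq_id_iff _).2 ⟨g, rfl⟩, 𝔔.id_comp]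

theorem exists_incl_comp_eq {x y : M} {h h' : E.tot.Hom x y} (e : E.proj h = E.proj h') :
    ∃ g, E.tot.comp (E.incl x g) h = h' := by
  obtain ⟨g, hg⟩ := (E.proj_eq_id_iff (E.tot.comp h' (E.tot.inv h))).1 (by
    rw [E.proj_comp, E.proj_inv, e, 𝔔.comp_inv])
  exact ⟨g, by rw [hg, E.tot.assoc, E.tot.inv_comp, E.tot.comp_id]⟩

theorem incl_comp_injective {x y : M} (h : E.tot.Hom x y) :
    Function.Injective fun g => E.tot.comp (E.incl x g) h := fun g g' e => by
  have e' := congrArg (fun k => E.tot.comp k (E.tot.inv h)) e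
  simp only [E.tot.assoc, E.tot.comp_inv, E.tot.comp_id] at e'
  exact E.incl_injective x e'

/-- The map `𝔥 → 𝔔` is the quotient by the free and properly discontinuous action of `G`. -/
theorem isCoveringMap_projArr : IsCoveringMap E.projArr := by
  let _ := E.arrAction
  have hsmul : ∀ (g : G) (a : E.tot.Arr),
    g • a = ⟨a.src, a.tgt, E.tot.comp (E.incl a.src g) a.hom⟩ := fun _ _ => rfl
  have hloc : IsLocalHomeomorph E.projArr :=
    IsLocalHomeomorph.of_comp (g := (Arrow.src : 𝔔.Arr → M)) E.tot.isLocalHomeomorph_src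
      𝔔.isLocalHomeomorph_src E.continuous_proj
  have hsurj : Function.Surjective E.projArr := by
    rintro ⟨x, y, q⟩
    obtain ⟨h, rfl⟩ := E.proj_surjective q
    exact ⟨⟨x, y, h⟩, rfl⟩
  suffices h : IsQuotientCoveringMap E.projArr G from h.isCoveringMap
  refine {
    toIsQuotientMap := hloc.isOpenMap.isQuotientMap hloc.continuous hsurj
    continuous_const_smul := fun g => ?_
    apply_eq_iff_mem_orbit := fun {a b} => ⟨fun h => ?_, ?_⟩
    disjoint := fun a => ?_ }
  · exact E.tot.continuous_comp.comp (f := fun a : E.tot.Arr => (⟨a.src, a.src, a.tgt,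
      E.incl a.src g, a.hom⟩ : Composable E.tot.toGroupoid)) (continuous_induced_rng.2
      (((E.continuous_incl g).comp E.tot.continuous_src).prodMk _root_.continuous_id))
  · obtain ⟨x, y, a⟩ := a
    obtain ⟨x', y', b⟩ := b
    simp only [projArr, Arrow.mk.injEq] at h
    obtain ⟨rfl, rfl, h⟩ := h
    obtain ⟨g, hg⟩ := E.exists_incl_comp_eq (eq_of_heq h).symm
    exact ⟨g, congrArg (Arrow.mk x y) hg⟩
  · rintro ⟨g, rfl⟩
    exact congrArg (Arrow.mk b.src b.tgt) (E.proj_incl_comp g b.hom)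
  · obtain ⟨e, ha, he⟩ := E.tot.isLocalHomeomorph_src a
    refine ⟨e.source, e.open_source.mem_nhds ha, ?_⟩
    rintro g ⟨_, ⟨b, hb, rfl⟩, hb'⟩
    have h : g • b = b := e.injOn hb' hb (by rw [← he]; rfl)
    rw [hsmul] at h
    obtain ⟨x, y, b⟩ := b
    simp only [Arrow.mk.injEq, heq_eq_eq, true_and] at h
    exact E.incl_comp_injective b (h.trans (by simp only [E.incl_one, E.tot.id_comp]))

theorem nonempty_section (hcontr : IsUnionOfContractibles 𝔔.Arr) : Nonempty E.Section := by
  classical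
  obtain ⟨κ, U, hUo, hUd, hUu, hUc⟩ := hcontr
  have hsurj : Function.Surjective E.projArr := by
    rintro ⟨x, y, q⟩
    obtain ⟨h, rfl⟩ := E.proj_surjective q
    exact ⟨⟨x, y, h⟩, rfl⟩
  -- a component of the arrow space which meets the units consists of units
  have hloc : ∀ k, ∃ s : C(U k, E.tot.Arr), (∀ a, E.projArr (s a) = a) ∧
      ∀ a : U k, (⟨a.1.src, a.1.src, 𝔔.id a.1.src⟩ : 𝔔.Arr) = a →
        s a = ⟨a.1.src, a.1.src, E.tot.id a.1.src⟩ := fun k => by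
    have hk : IsPreconnected (U k) :=
      isPreconnected_iff_preconnectedSpace.2 inferInstance
    by_cases hne : (U k ∩ {a | (⟨a.src, a.src, 𝔔.id a.src⟩ : 𝔔.Arr) = a}).Nonempty
    · have hsub := hk.subset_isClopen 𝔔.isClopen_units hne
      refine ⟨⟨fun a => ⟨a.1.src, a.1.src, E.tot.id a.1.src⟩, E.tot.continuous_id.comp
        (𝔔.continuous_src.comp continuous_subtype_val)⟩, fun a => ?_, fun _ _ => rfl⟩
      refine Eq.trans ?_ (hsub a.2)
      exact congrArg (Arrow.mk _ _) (E.proj_id _)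
    · obtain ⟨s, hs⟩ :=
        exists_continuous_lift_of_contractible E.isCoveringMap_projArr hsurj (U k)
      exact ⟨s, hs, fun a ha => absurd ⟨a.1, a.2, ha⟩ hne⟩
  choose s hs hs' using hloc
  have hcompat : ∀ i j a (hi : a ∈ U i) (hj : a ∈ U j), s i ⟨a, hi⟩ = s j ⟨a, hj⟩ :=
    fun i j a hi hj => by
      obtain rfl : i = j := by
        by_contra hij
        exact Set.disjoint_left.1 (hUd hij) hi hj
      rfl
  have hcover : ∀ a : 𝔔.Arr, ∃ k, U k ∈ 𝓝 a := fun a => by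
    obtain ⟨k, hk⟩ := Set.mem_iUnion.1 (hUu ▸ Set.mem_univ a)
    exact ⟨k, (hUo k).mem_nhds hk⟩
  let t : C(𝔔.Arr, E.tot.Arr) := ContinuousMap.liftCover U s hcompat hcover
  have ht : ∀ k (a : U k), t a = s k a := fun k a => ContinuousMap.liftCover_coe a
  have hex : ∀ (x y : M) (q : 𝔔.Hom x y), ∃ h : E.tot.Hom x y, t ⟨x, y, q⟩ = ⟨x, y, h⟩ ∧
      E.proj h = q := fun x y q => by
    obtain ⟨k, hk⟩ := hcover ⟨x, y, q⟩
    have h := hs k ⟨⟨x, y, q⟩, mem_of_mem_nhds hk⟩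
    rw [← ht] at h
    generalize t _ = b at h ⊢
    obtain ⟨x', y', b⟩ := b
    simp only [projArr, Arrow.mk.injEq] at h
    obtain ⟨rfl, rfl, h⟩ := h
    exact ⟨b, rfl, eq_of_heq h⟩
  choose l hl hl' using hex
  refine ⟨⟨fun {x y} q => l x y q, fun {x y} q => hl' x y q, fun x => ?_,
    t.continuous.congr fun a => hl _ _ _⟩⟩
  obtain ⟨k, hk⟩ := hcover ⟨x, x, 𝔔.id x⟩
  have h := hs' k ⟨⟨x, x, 𝔔.id x⟩, mem_of_mem_nhds hk⟩ rfl
  rw [← ht, hl] at h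
  simpa using h

end GerbeExtension

/-! ### Morita contexts with local units -/

section MoritaContext

variable {𝕜 : Type v} [Field 𝕜]

/-- An algebra has local units if each finite set of its elements has a common two-sided unit. -/
def HasLocalUnits (A : Type*) [NonUnitalRing A] : Prop :=
  ∀ s : Finset A, ∃ e : A, ∀ a ∈ s, e * a = a ∧ a * e = a

variable {A B C : Type*} [NonUnitalRing A] [Module 𝕜 A]
  [NonUnitalRing B] [Module 𝕜 B] [NonUnitalRing C] [Module 𝕜 C]
  {M N L : Type*} [AddCommGroup M] [Module 𝕜 M] [AddCommGroup N] [Module 𝕜 N]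
  [AddCommGroup L] [Module 𝕜 L]

namespace Bimod

theorem rsmul_tmul_mem (P : Bimod 𝕜 A B M) (Q : Bimod 𝕜 B C N) (m : M) (b : B) (n : N) :
    P.rsmul m b ⊗ₜ[𝕜] n - m ⊗ₜ[𝕜] Q.lsmul b n ∈ P.balancing Q :=
  Submodule.subset_span ⟨m, b, n, rfl⟩

theorem tmul_lsmul_mem (P : Bimod 𝕜 A B M) (Q : Bimod 𝕜 B C N) (m : M) (b : B) (n : N) :
    m ⊗ₜ[𝕜] Q.lsmul b n - P.rsmul m b ⊗ₜ[𝕜] n ∈ P.balancing Q := by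
  rw [← neg_sub]
  exact neg_mem (P.rsmul_tmul_mem Q m b n)

/-- A balanced pairing induces an isomorphism as soon as it spans and, on finite sets, a simple
tensor can be recovered linearly from its image. -/
theorem inducesIso_of_forall_finset {P : Bimod 𝕜 A B M} {Q : Bimod 𝕜 B C N} {R : Bimod 𝕜 A C L}
    {φ : M →ₗ[𝕜] N →ₗ[𝕜] L} (hb : ∀ m b n, φ (P.rsmul m b) n = φ m (Q.lsmul b n))
    (hl : ∀ a m n, φ (P.lsmul a m) n = R.lsmul a (φ m n))
    (hr : ∀ m n c, φ m (Q.rsmul n c) = R.rsmul (φ m n) c)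
    (hs : ∀ x, x ∈ Submodule.span 𝕜 {x | ∃ m n, φ m n = x})
    (hκ : ∀ (s : Finset M) (t : Finset N), ∃ κ : L →ₗ[𝕜] M ⊗[𝕜] N, ∀ m ∈ s, ∀ n ∈ t,
      m ⊗ₜ[𝕜] n - κ (φ m n) ∈ P.balancing Q) : P.InducesIso Q R φ := by
  classical
  refine ⟨hb, hl, hr, ?_, ?_⟩
  · rw [← LinearMap.ker_eq_bot, LinearMap.ker_eq_bot']
    intro q hq
    obtain ⟨t, rfl⟩ := Submodule.mkQ_surjective _ q
    obtain ⟨S, rfl⟩ := TensorProduct.exists_finset t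
    obtain ⟨κ, hκ⟩ := hκ (S.image Prod.fst) (S.image Prod.snd)
    have h0 : ∑ i ∈ S, φ i.1 i.2 = 0 := by simpa using hq
    have h1 : ∑ i ∈ S, (i.1 ⊗ₜ[𝕜] i.2 - κ (φ i.1 i.2)) ∈ P.balancing Q :=
      sum_mem fun i hi => hκ _ (Finset.mem_image_of_mem _ hi) _ (Finset.mem_image_of_mem _ hi)
    rw [Finset.sum_sub_distrib, ← map_sum, h0, map_zero, sub_zero] at h1
    exact (Submodule.Quotient.mk_eq_zero _).2 h1
  · rw [← LinearMap.range_eq_top, eq_top_iff]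
    refine fun x _ => (Submodule.span_le.2 ?_) (hs x)
    rintro _ ⟨m, n, rfl⟩
    exact ⟨Submodule.Quotient.mk (m ⊗ₜ[𝕜] n), by simp⟩

theorem inducesIso_lsmul [IsScalarTower 𝕜 A A] [SMulCommClass 𝕜 A A]
    (hA : HasLocalUnits A) (P : Bimod 𝕜 A B M)
    (h : ∀ m, ∃ a, P.lsmul a m = m) : (Bimod.regular 𝕜 A).InducesIso P P P.lsmul := by
  refine inducesIso_of_forall_finset (fun a a' m => P.mul_lsmul a a' m)
    (fun a a' m => P.mul_lsmul a a' m) (fun a m b => (P.lsmul_rsmul a m b).symm)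
    (fun m => Submodule.subset_span ?_) fun s t => ?_
  · obtain ⟨a, ha⟩ := h m
    exact ⟨a, m, ha⟩
  · obtain ⟨e, he⟩ := hA s
    refine ⟨TensorProduct.mk 𝕜 A M e, fun a ha m _ => ?_⟩
    have := rsmul_tmul_mem (Bimod.regular 𝕜 A) P e a m
    change (e * a) ⊗ₜ[𝕜] m - _ ∈ _ at this
    rwa [(he a ha).1] at this

theorem inducesIso_rsmul [IsScalarTower 𝕜 B B] [SMulCommClass 𝕜 B B]
    (hB : HasLocalUnits B) (P : Bimod 𝕜 A B M)
    (h : ∀ m, ∃ b, P.rsmul m b = m) : P.InducesIso (Bimod.regular 𝕜 B) P P.rsmul := by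
  refine inducesIso_of_forall_finset (fun m b b' => (P.rsmul_mul m b b').symm)
    (fun a m b => P.lsmul_rsmul a m b) (fun m b b' => P.rsmul_mul m b b')
    (fun m => Submodule.subset_span ?_) fun s t => ?_
  · obtain ⟨b, hb⟩ := h m
    exact ⟨m, b, hb⟩
  · obtain ⟨e, he⟩ := hB t
    refine ⟨(TensorProduct.mk 𝕜 M B).flip e, fun m _ b hb => ?_⟩
    have := tmul_lsmul_mem P (Bimod.regular 𝕜 B) m b e
    change m ⊗ₜ[𝕜] (b * e) - _ ∈ _ at this
    rwa [(he b hb).2] at this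

/-- In a Morita context, if the pairing `Ξ` spans `A` then `M ⊗_B N ≅ A`: writing a local unit of
`A` as `∑ Ξ(m', n')` expresses `m ⊗ n` through `Ξ(m, n)`. -/
theorem inducesIso_pairing [IsScalarTower 𝕜 A A] [SMulCommClass 𝕜 A A]
    {P : Bimod 𝕜 A B M} {Q : Bimod 𝕜 B A N} {Ξ : M →ₗ[𝕜] N →ₗ[𝕜] A}
    {Θ : N →ₗ[𝕜] M →ₗ[𝕜] B} (hb : ∀ m b n, Ξ (P.rsmul m b) n = Ξ m (Q.lsmul b n))
    (hl : ∀ a m n, Ξ (P.lsmul a m) n = a * Ξ m n) (hr : ∀ m n a, Ξ m (Q.rsmul n a) = Ξ m n * a)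
    (h₁ : ∀ m n m', P.lsmul (Ξ m n) m' = P.rsmul m (Θ n m'))
    (h₂ : ∀ n m n', Q.lsmul (Θ n m) n' = Q.rsmul n (Ξ m n'))
    (hs : ∀ x, x ∈ Submodule.span 𝕜 {x | ∃ m n, Ξ m n = x})
    (hN : ∀ t : Finset N, ∃ a, ∀ n ∈ t, Q.rsmul n a = n) :
    P.InducesIso Q (Bimod.regular 𝕜 A) Ξ := by
  refine inducesIso_of_forall_finset hb hl hr hs fun s t => ?_
  have key : ∀ a : A, ∃ κ : A →ₗ[𝕜] M ⊗[𝕜] N, ∀ m n,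
      m ⊗ₜ[𝕜] Q.rsmul n a - κ (Ξ m n) ∈ P.balancing Q := fun a => by
    induction hs a using Submodule.span_induction with
    | mem a ha =>
      obtain ⟨m', n', rfl⟩ := ha
      refine ⟨(TensorProduct.mk 𝕜 M N).flip n' ∘ₗ P.lsmul.flip m', fun m n => ?_⟩
      change _ - P.lsmul (Ξ m n) m' ⊗ₜ[𝕜] n' ∈ _
      rw [← h₂, h₁]
      exact tmul_lsmul_mem P Q _ _ _
    | zero => exact ⟨0, fun m n => by simp⟩
    | add a a' _ _ h h' =>
      obtain ⟨κ, hκ⟩ := h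
      obtain ⟨κ', hκ'⟩ := h'
      refine ⟨κ + κ', fun m n => ?_⟩
      rw [map_add, TensorProduct.tmul_add, LinearMap.add_apply, add_sub_add_comm]
      exact add_mem (hκ m n) (hκ' m n)
    | smul r a _ h =>
      obtain ⟨κ, hκ⟩ := h
      refine ⟨r • κ, fun m n => ?_⟩
      rw [map_smul, TensorProduct.tmul_smul, LinearMap.smul_apply, ← smul_sub]
      exact Submodule.smul_mem _ _ (hκ m n)
  obtain ⟨a, ha⟩ := hN t
  obtain ⟨κ, hκ⟩ := key a
  refine ⟨κ, fun m _ n hn => ?_⟩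
  have := hκ m n
  rwa [ha n hn] at this

/-- A module over an algebra with local units that is spanned by products is unital on finite
sets. -/
theorem exists_lsmul_eq (hA : HasLocalUnits A) (P : Bimod 𝕜 A B M)
    (h : ∀ m, m ∈ Submodule.span 𝕜 {x | ∃ a m', P.lsmul a m' = x}) (s : Finset M) :
    ∃ a, ∀ m ∈ s, P.lsmul a m = m := by
  classical
  have key : ∀ m : M, ∃ F : Finset A, ∀ e : A, (∀ a ∈ F, e * a = a) → P.lsmul e m = m := fun m => by
    induction h m using Submodule.span_induction with
    | mem m hm =>
      obtain ⟨a, m', rfl⟩ := hm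
      exact ⟨{a}, fun e he => by rw [← P.mul_lsmul, he a (Finset.mem_singleton_self a)]⟩
    | zero => exact ⟨∅, fun e _ => map_zero _⟩
    | add m m' _ _ h h' =>
      obtain ⟨F, hF⟩ := h
      obtain ⟨F', hF'⟩ := h'
      exact ⟨F ∪ F', fun e he => by
        rw [map_add, hF e fun a ha => he a (Finset.mem_union_left _ ha),
          hF' e fun a ha => he a (Finset.mem_union_right _ ha)]⟩
    | smul r m _ h =>
      obtain ⟨F, hF⟩ := h
      exact ⟨F, fun e he => by rw [map_smul, hF e he]⟩
  choose F hF using key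
  obtain ⟨e, he⟩ := hA (s.biUnion F)
  exact ⟨e, fun m hm => hF m e fun a ha => (he a (Finset.mem_biUnion.2 ⟨m, hm, ha⟩)).1⟩

theorem exists_rsmul_eq (hB : HasLocalUnits B) (P : Bimod 𝕜 A B M)
    (h : ∀ m, m ∈ Submodule.span 𝕜 {x | ∃ m' b, P.rsmul m' b = x}) (s : Finset M) :
    ∃ b, ∀ m ∈ s, P.rsmul m b = m := by
  classical
  have key : ∀ m : M, ∃ F : Finset B, ∀ e : B, (∀ b ∈ F, b * e = b) → P.rsmul m e = m := fun m => by
    induction h m using Submodule.span_induction with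
    | mem m hm =>
      obtain ⟨m', b, rfl⟩ := hm
      exact ⟨{b}, fun e he => by rw [← P.rsmul_mul, he b (Finset.mem_singleton_self b)]⟩
    | zero => exact ⟨∅, fun e _ => by simp⟩
    | add m m' _ _ h h' =>
      obtain ⟨F, hF⟩ := h
      obtain ⟨F', hF'⟩ := h'
      exact ⟨F ∪ F', fun e he => by
        rw [map_add, LinearMap.add_apply, hF e fun a ha => he a (Finset.mem_union_left _ ha),
          hF' e fun a ha => he a (Finset.mem_union_right _ ha)]⟩
    | smul r m _ h =>
      obtain ⟨F, hF⟩ := h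
      exact ⟨F, fun e he => by rw [map_smul, LinearMap.smul_apply, hF e he]⟩
  choose F hF using key
  obtain ⟨e, he⟩ := hB (s.biUnion F)
  exact ⟨e, fun m hm => hF m e fun b hb => (he b (Finset.mem_biUnion.2 ⟨m, hm, hb⟩)).2⟩

end Bimod

end MoritaContext

section Morita

variable {𝕜 : Type v} [Field 𝕜] {A B : Type u} [NonUnitalRing A] [Module 𝕜 A]
  [IsScalarTower 𝕜 A A] [SMulCommClass 𝕜 A A] [NonUnitalRing B] [Module 𝕜 B]
  [IsScalarTower 𝕜 B B] [SMulCommClass 𝕜 B B]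

/-- A Morita context between algebras with local units whose pairings span and whose modules are
unital over `B` is a Morita equivalence. -/
theorem MoritaEquivalent.of_context (hA : HasLocalUnits A) (hB : HasLocalUnits B)
    {M N : Type u} [AddCommGroup M] [Module 𝕜 M] [AddCommGroup N] [Module 𝕜 N]
    (P : Bimod 𝕜 A B M) (Q : Bimod 𝕜 B A N) (Ξ : M →ₗ[𝕜] N →ₗ[𝕜] A) (Θ : N →ₗ[𝕜] M →ₗ[𝕜] B)
    (hΞb : ∀ m b n, Ξ (P.rsmul m b) n = Ξ m (Q.lsmul b n))
    (hΞl : ∀ a m n, Ξ (P.lsmul a m) n = a * Ξ m n)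
    (hΞr : ∀ m n a, Ξ m (Q.rsmul n a) = Ξ m n * a)
    (hΘb : ∀ n a m, Θ (Q.rsmul n a) m = Θ n (P.lsmul a m))
    (hΘl : ∀ b n m, Θ (Q.lsmul b n) m = b * Θ n m)
    (hΘr : ∀ n m b, Θ n (P.rsmul m b) = Θ n m * b)
    (h₁ : ∀ m n m', P.lsmul (Ξ m n) m' = P.rsmul m (Θ n m'))
    (h₂ : ∀ n m n', Q.lsmul (Θ n m) n' = Q.rsmul n (Ξ m n'))
    (hΞs : ∀ x, x ∈ Submodule.span 𝕜 {x | ∃ m n, Ξ m n = x})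
    (hΘs : ∀ x, x ∈ Submodule.span 𝕜 {x | ∃ n m, Θ n m = x})
    (hM : ∀ s : Finset M, ∃ b, ∀ m ∈ s, P.rsmul m b = m)
    (hN : ∀ s : Finset N, ∃ b, ∀ n ∈ s, Q.lsmul b n = n) : MoritaEquivalent 𝕜 A B := by
  have hM' : ∀ s : Finset M, ∃ a, ∀ m ∈ s, P.lsmul a m = m := by
    refine Bimod.exists_lsmul_eq hA P fun m => ?_
    obtain ⟨b, hb⟩ := hM {m}
    rw [← hb m (Finset.mem_singleton_self m)]
    have : Submodule.span 𝕜 {x | ∃ n m, Θ n m = x} ≤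
        (Submodule.span 𝕜 {x | ∃ a m', P.lsmul a m' = x}).comap (P.rsmul m) := by
      refine Submodule.span_le.2 ?_
      rintro _ ⟨n, m', rfl⟩
      exact Submodule.subset_span ⟨Ξ m n, m', h₁ m n m'⟩
    exact this (hΘs b)
  have hN' : ∀ s : Finset N, ∃ a, ∀ n ∈ s, Q.rsmul n a = n := by
    refine Bimod.exists_rsmul_eq hA Q fun n => ?_
    obtain ⟨b, hb⟩ := hN {n}
    rw [← hb n (Finset.mem_singleton_self n)]
    have : Submodule.span 𝕜 {x | ∃ n m, Θ n m = x} ≤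
        (Submodule.span 𝕜 {x | ∃ n' a, Q.rsmul n' a = x}).comap (Q.lsmul.flip n) := by
      refine Submodule.span_le.2 ?_
      rintro _ ⟨n', m, rfl⟩
      exact Submodule.subset_span ⟨n', Ξ m n, (h₂ n' m n).symm⟩
    exact this (hΘs b)
  have one : ∀ {X Y : Type u} {f : X → Y → Y}, (∀ s : Finset Y, ∃ x, ∀ y ∈ s, f x y = y) →
      ∀ y, ∃ x, f x y = y := fun h y => (h {y}).imp fun x hx => hx y (Finset.mem_singleton_self y)
  exact ⟨M, N, _, _, _, _, P, Q, Ξ, Θ,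
    Bimod.inducesIso_lsmul hA P (one hM'),
    Bimod.inducesIso_rsmul hB P (one (f := fun b m => P.rsmul m b) hM),
    Bimod.inducesIso_lsmul hB Q (one hN),
    Bimod.inducesIso_rsmul hA Q (one (f := fun a n => Q.rsmul n a) hN'),
    Bimod.inducesIso_pairing hΞb hΞl hΞr h₁ h₂ hΞs hN',
    Bimod.inducesIso_pairing hΘb hΘl hΘr h₂ h₁ hΘs hM, h₁, h₂⟩

/-- Idempotent multipliers `p i` of an algebra `B` with sum `1`, given by left multiplication
`l i b = p i * b` and right multiplication `r i b = b * p i`. -/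
structure PeirceSystem (𝕜 : Type v) [Field 𝕜] (B : Type*) [NonUnitalRing B] [Module 𝕜 B]
    (ι : Type*) [Fintype ι] where
  l : ι → B →ₗ[𝕜] B
  r : ι → B →ₗ[𝕜] B
  l_mul : ∀ i a b, l i (a * b) = l i a * b
  r_mul : ∀ i a b, r i (a * b) = a * r i b
  mul_l : ∀ i a b, a * l i b = r i a * b
  l_l : ∀ i b, l i (l i b) = l i b
  r_r : ∀ i b, r i (r i b) = r i b
  sum_r : ∀ b, ∑ i, r i b = b

/-- If `A` is isomorphic to the algebra of matrices over `B` whose `(j, k)` entry lies in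
`p (π j) B p (π k)`, for a surjection `π` from the finite index set, then `A` and `B` are Morita
equivalent: the bimodules are the columns with entries in `p (π j) B` and the rows with
entries in `B p (π k)`. -/
theorem MoritaEquivalent.of_matrix (hA : HasLocalUnits A) (hB : HasLocalUnits B)
    {ι J : Type} [Fintype ι] [Fintype J] (p : PeirceSystem 𝕜 B ι)
    {π : J → ι} (hπ : Function.Surjective π) (ψ : A →ₗ[𝕜] J → J → B)
    (hψ : Function.Injective ψ) (hmul : ∀ a a' j k, ψ (a * a') j k = ∑ i, ψ a j i * ψ a' i k)
    (hl : ∀ a j k, p.l (π j) (ψ a j k) = ψ a j k) (hr : ∀ a j k, p.r (π k) (ψ a j k) = ψ a j k)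
    (hsurj : ∀ F : J → J → B, (∀ j k, p.l (π j) (F j k) = F j k) →
      (∀ j k, p.r (π k) (F j k) = F j k) → ∃ a, ψ a = F) : MoritaEquivalent 𝕜 A B := by
  classical
  let M : Submodule 𝕜 (J → B) :=
    { carrier := {v | ∀ j, p.l (π j) (v j) = v j}
      zero_mem' := fun j => map_zero _
      add_mem' := fun {v w} hv hw j => by rw [Pi.add_apply, map_add, hv j, hw j]
      smul_mem' := fun c v hv j => by rw [Pi.smul_apply, map_smul, hv j] }
  let N : Submodule 𝕜 (J → B) :=
    { carrier := {v | ∀ j, p.r (π j) (v j) = v j}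
      zero_mem' := fun j => map_zero _
      add_mem' := fun {v w} hv hw j => by rw [Pi.add_apply, map_add, hv j, hw j]
      smul_mem' := fun c v hv j => by rw [Pi.smul_apply, map_smul, hv j] }
  let P : Bimod 𝕜 A B M :=
    { lsmul := LinearMap.mk₂ 𝕜 (fun a v => ⟨fun j => ∑ k, ψ a j k * v.1 k, fun j => by
          simp only [map_sum, p.l_mul, hl]⟩)
        (fun a a' v => Subtype.ext (funext fun j => by
          simp [add_mul, Finset.sum_add_distrib]))
        (fun c a v => Subtype.ext (funext fun j => by
          simp [Finset.smul_sum, smul_mul_assoc]))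
        (fun a v v' => Subtype.ext (funext fun j => by
          simp [mul_add, Finset.sum_add_distrib]))
        (fun c a v => Subtype.ext (funext fun j => by
          simp [Finset.smul_sum, mul_smul_comm]))
      rsmul := LinearMap.mk₂ 𝕜 (fun v b => ⟨fun j => v.1 j * b, fun j => by
          rw [p.l_mul, v.2 j]⟩)
        (fun v v' b => Subtype.ext (funext fun j => add_mul _ _ _))
        (fun c v b => Subtype.ext (funext fun j => smul_mul_assoc _ _ _))
        (fun v b b' => Subtype.ext (funext fun j => mul_add _ _ _))
        (fun c v b => Subtype.ext (funext fun j => mul_smul_comm _ _ _))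
      mul_lsmul := fun a a' v => Subtype.ext (funext fun j => by
        simp only [LinearMap.mk₂_apply, hmul, Finset.sum_mul, Finset.mul_sum, mul_assoc]
        exact Finset.sum_comm)
      rsmul_mul := fun v b b' => Subtype.ext (funext fun j => (mul_assoc _ _ _).symm)
      lsmul_rsmul := fun a v b => Subtype.ext (funext fun j => by
        simp only [LinearMap.mk₂_apply, Finset.sum_mul, mul_assoc]) }
  let Q : Bimod 𝕜 B A N :=
    { lsmul := LinearMap.mk₂ 𝕜 (fun b w => ⟨fun j => b * w.1 j, fun j => by
          rw [p.r_mul, w.2 j]⟩)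
        (fun b b' w => Subtype.ext (funext fun j => add_mul _ _ _))
        (fun c b w => Subtype.ext (funext fun j => smul_mul_assoc _ _ _))
        (fun b w w' => Subtype.ext (funext fun j => mul_add _ _ _))
        (fun c b w => Subtype.ext (funext fun j => mul_smul_comm _ _ _))
      rsmul := LinearMap.mk₂ 𝕜 (fun w a => ⟨fun k => ∑ j, w.1 j * ψ a j k, fun k => by
          simp only [map_sum, p.r_mul, hr]⟩)
        (fun w w' a => Subtype.ext (funext fun j => by
          simp [add_mul, Finset.sum_add_distrib]))
        (fun c w a => Subtype.ext (funext fun j => by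
          simp [Finset.smul_sum, smul_mul_assoc]))
        (fun w a a' => Subtype.ext (funext fun j => by
          simp [mul_add, Finset.sum_add_distrib]))
        (fun c w a => Subtype.ext (funext fun j => by
          simp [Finset.smul_sum, mul_smul_comm]))
      mul_lsmul := fun b b' w => Subtype.ext (funext fun j => mul_assoc _ _ _)
      rsmul_mul := fun w a a' => Subtype.ext (funext fun j => by
        simp only [LinearMap.mk₂_apply, hmul, Finset.sum_mul, Finset.mul_sum, ← mul_assoc]
        exact Finset.sum_comm)
      lsmul_rsmul := fun b w a => Subtype.ext (funext fun j => by
        simp only [LinearMap.mk₂_apply, Finset.mul_sum, mul_assoc]) }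
  have hex : ∀ (v : M) (w : N), ∃ a, ψ a = fun j k => v.1 j * w.1 k := fun v w =>
    hsurj _ (fun j k => by rw [p.l_mul, v.2 j]) (fun j k => by rw [p.r_mul, w.2 k])
  choose Ξ₀ hΞ₀ using hex
  let Ξ : M →ₗ[𝕜] N →ₗ[𝕜] A := LinearMap.mk₂ 𝕜 Ξ₀
    (fun v v' w => hψ (by rw [map_add, hΞ₀, hΞ₀, hΞ₀]; funext j k; exact add_mul _ _ _))
    (fun c v w => hψ (by rw [map_smul, hΞ₀, hΞ₀]; funext j k; exact smul_mul_assoc _ _ _))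
    (fun v w w' => hψ (by rw [map_add, hΞ₀, hΞ₀, hΞ₀]; funext j k; exact mul_add _ _ _))
    (fun c v w => hψ (by rw [map_smul, hΞ₀, hΞ₀]; funext j k; exact mul_smul_comm _ _ _))
  have hΞ : ∀ v w j k, ψ (Ξ v w) j k = v.1 j * w.1 k := fun v w j k =>
    congrFun (congrFun (hΞ₀ v w) j) k
  let Θ : N →ₗ[𝕜] M →ₗ[𝕜] B := LinearMap.mk₂ 𝕜 (fun w v => ∑ j, w.1 j * v.1 j)
    (fun w w' v => by simp [add_mul, Finset.sum_add_distrib])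
    (fun c w v => by simp [Finset.smul_sum, smul_mul_assoc])
    (fun w v v' => by simp [mul_add, Finset.sum_add_distrib])
    (fun c w v => by simp [Finset.smul_sum, mul_smul_comm])
  have hP : ∀ a v j, (P.lsmul a v).1 j = ∑ k, ψ a j k * v.1 k := fun _ _ _ => rfl
  have hQ : ∀ w a k, (Q.rsmul w a).1 k = ∑ j, w.1 j * ψ a j k := fun _ _ _ => rfl
  have hP' : ∀ v b j, (P.rsmul v b).1 j = v.1 j * b := fun _ _ _ => rfl
  have hQ' : ∀ b w j, (Q.lsmul b w).1 j = b * w.1 j := fun _ _ _ => rfl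
  have hΘ : ∀ w v, Θ w v = ∑ j, w.1 j * v.1 j := fun _ _ => rfl
  -- columns and rows with a single entry
  let col : ∀ j b, p.l (π j) b = b → M := fun j b hb => ⟨Pi.single j b, fun k => by
    by_cases h : k = j
    · subst h; rw [Pi.single_eq_same, hb]
    · rw [Pi.single_eq_of_ne h, map_zero]⟩
  let row : ∀ j b, p.r (π j) b = b → N := fun j b hb => ⟨Pi.single j b, fun k => by
    by_cases h : k = j
    · subst h; rw [Pi.single_eq_same, hb]
    · rw [Pi.single_eq_of_ne h, map_zero]⟩
  have hΞs : ∀ x, x ∈ Submodule.span 𝕜 {x | ∃ m n, Ξ m n = x} := fun x => by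
    obtain ⟨e, he⟩ := hB (Finset.univ.image fun t : J × J => ψ x t.1 t.2)
    have hx : x = ∑ j, ∑ k, Ξ (col j (ψ x j k) (hl x j k)) (row k (p.r (π k) e) (p.r_r _ _)) := by
      apply hψ
      rw [map_sum]
      funext j k
      simp only [map_sum, Finset.sum_apply, hΞ, col, row]
      rw [Finset.sum_eq_single j, Finset.sum_eq_single k]
      · rw [Pi.single_eq_same, Pi.single_eq_same, ← p.r_mul,
          (he _ (Finset.mem_image_of_mem _ (Finset.mem_univ (j, k)))).2, hr]
      · intro k' _ hk'
        rw [Pi.single_eq_of_ne hk'.symm, mul_zero]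
      · simp
      · intro j' _ hj'
        exact Finset.sum_eq_zero fun k' _ => by rw [Pi.single_eq_of_ne hj'.symm, zero_mul]
      · simp
    rw [hx]
    exact sum_mem fun j _ => sum_mem fun k _ => Submodule.subset_span ⟨_, _, rfl⟩
  have hΘs : ∀ x, x ∈ Submodule.span 𝕜 {x | ∃ n m, Θ n m = x} := fun x => by
    obtain ⟨e, he⟩ := hB (Finset.univ.image fun i => p.r i x)
    choose s hs using hπ
    have hx : x = ∑ i, Θ (row (s i) (p.r i x) (by rw [hs, p.r_r]))
        (col (s i) (p.l i e) (by rw [hs, p.l_l])) := by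
      refine (p.sum_r x).symm.trans (Finset.sum_congr rfl fun i _ => ?_)
      simp only [hΘ, col, row]
      rw [Finset.sum_eq_single (s i), Pi.single_eq_same, Pi.single_eq_same]
      · rw [p.mul_l, p.r_r, (he _ (Finset.mem_image_of_mem _ (Finset.mem_univ i))).2]
      · intro j _ hj
        rw [Pi.single_eq_of_ne hj, zero_mul]
      · simp
    rw [hx]
    exact sum_mem fun j _ => Submodule.subset_span ⟨_, _, rfl⟩
  refine MoritaEquivalent.of_context hA hB P Q Ξ Θ (fun v b w => hψ ?_) (fun a v w => hψ ?_)
    (fun v w a => hψ ?_) (fun w a v => ?_) (fun b w v => ?_) (fun w v b => ?_)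
    (fun v w v' => Subtype.ext (funext fun j => ?_))
    (fun w v w' => Subtype.ext (funext fun j => ?_)) hΞs hΘs (fun s => ?_) (fun s => ?_)
  · funext j k
    rw [hΞ, hΞ, hP', hQ', mul_assoc]
  · funext j k
    rw [hmul, hΞ, hP, Finset.sum_mul]
    exact Finset.sum_congr rfl fun i _ => by rw [hΞ, mul_assoc]
  · funext j k
    rw [hmul, hΞ, hQ, Finset.mul_sum]
    exact Finset.sum_congr rfl fun i _ => by rw [hΞ, mul_assoc]
  · simp only [hΘ, hP, hQ, Finset.mul_sum, Finset.sum_mul, mul_assoc]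
    exact Finset.sum_comm
  · simp only [hΘ, hQ', Finset.mul_sum, mul_assoc]
  · simp only [hΘ, hP', Finset.sum_mul, mul_assoc]
  · simp only [hP, hP', hΘ, hΞ, Finset.mul_sum, mul_assoc]
  · simp only [hQ, hQ', hΘ, hΞ, Finset.sum_mul, mul_assoc]
  · obtain ⟨e, he⟩ := hB (s.biUnion fun v => Finset.univ.image v.1)
    exact ⟨e, fun v hv => Subtype.ext (funext fun j => (he _ (Finset.mem_biUnion.2
      ⟨v, hv, Finset.mem_image_of_mem _ (Finset.mem_univ j)⟩)).2)⟩
  · obtain ⟨e, he⟩ := hB (s.biUnion fun v => Finset.univ.image v.1)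
    exact ⟨e, fun v hv => Subtype.ext (funext fun j => (he _ (Finset.mem_biUnion.2
      ⟨v, hv, Finset.mem_image_of_mem _ (Finset.mem_univ j)⟩)).1)⟩

end Morita

/-! ### Local units and cut-offs in crossed products -/

namespace AlgebraSheaf

variable {𝕜 : Type v} [Field 𝕜] {M : Type u} [TopologicalSpace M] (S : AlgebraSheaf 𝕜 M)
  {X : Type u} [TopologicalSpace X] {φ : X → M}

open Classical in
/-- Sections can be glued along a clopen set. -/
theorem sec_ite {U : Set X} (hU : IsClopen U) {a b : ∀ x, S.stalk (φ x)}
    (ha : Continuous fun x => (⟨φ x, a x⟩ : Germ S.stalk))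
    (hb : Continuous fun x => (⟨φ x, b x⟩ : Germ S.stalk)) :
    Continuous fun x => (⟨φ x, if x ∈ U then a x else b x⟩ : Germ S.stalk) := by
  rw [continuous_iff_continuousAt]
  intro x₀
  by_cases hx : x₀ ∈ U
  · refine ha.continuousAt.congr ?_
    filter_upwards [hU.isOpen.mem_nhds hx] with x hx
    rw [if_pos hx]
  · refine hb.continuousAt.congr ?_
    filter_upwards [hU.compl.isOpen.mem_nhds hx] with x hx
    rw [if_neg hx]

end AlgebraSheaf

/-- A groupoid cocycle is normalized if it is `1` as soon as one of its arguments is a unit. -/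
def LocConstCocycle.IsNormalized {M : Type u} [TopologicalSpace M] {𝒢 : EtaleGroupoid M}
    (c : LocConstCocycle 𝒢) : Prop :=
  ∀ {x y : M} (g : 𝒢.Hom x y), c.toFun (𝒢.id x) g = 1 ∧ c.toFun g (𝒢.id y) = 1

section

variable {𝕜 : Type v} [Field 𝕜] {M : Type u} [TopologicalSpace M] {𝒢 : EtaleGroupoid M}

theorem convTerm_of_eq [Algebra ℂ 𝕜] {S : EquivariantSheaf 𝕜 𝒢} {c : LocConstCocycle 𝒢}
    {f g : ∀ a : 𝒢.Arr, S.stalk a.src} {x y z : M} {p : 𝒢.Hom x y} {q : 𝒢.Hom x z}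
    {r : 𝒢.Hom y z} (h : 𝒢.comp (𝒢.inv p) q = r) : convTerm S c f g p q =
      algebraMap ℂ 𝕜 (c.toFun p r) • (f ⟨x, y, p⟩ * S.act p (g ⟨y, z, r⟩)) := by
  subst h; rfl

section UnitSection

variable {S : EquivariantSheaf 𝕜 𝒢} (e : ∀ x, S.stalk x)

open Classical in
/-- A section of the sheaf, extended by zero from the units to all arrows. -/
noncomputable def unitSection (a : 𝒢.Arr) : S.stalk a.src :=
  if (⟨a.src, a.src, 𝒢.id a.src⟩ : 𝒢.Arr) = a then e a.src else 0

variable {e}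

theorem unitSection_mem (he : Continuous fun x => (⟨x, e x⟩ : Germ S.stalk))
    (hc : IsCompact {x | e x ≠ 0}) : unitSection e ∈ compactSections S := by
  have h : Continuous fun a : 𝒢.Arr => (⟨a.src, unitSection e a⟩ : Germ S.stalk) :=
    S.sec_ite 𝒢.isClopen_units (he.comp 𝒢.continuous_src) (S.sec_zero 𝒢.continuous_src)
  refine ⟨h, (hc.image 𝒢.continuous_id).of_isClosed_subset
    (S.isClosed_support 𝒢.continuous_src h) fun a ha => ?_⟩
  by_cases hu : (⟨a.src, a.src, 𝒢.id a.src⟩ : 𝒢.Arr) = a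
  · refine ⟨a.src, ?_, hu⟩
    have h2 : unitSection e a ≠ 0 := ha
    rwa [unitSection, if_pos hu] at h2
  · exact absurd (if_neg hu) ha

theorem unitSection_id (x : M) : unitSection e (⟨x, x, 𝒢.id x⟩ : 𝒢.Arr) = e x := if_pos rfl

theorem eq_id_of_unitSection_ne_zero {x y z : M} {p : 𝒢.Hom x y} {q : 𝒢.Hom x z}
    (h : unitSection e (⟨y, z, 𝒢.comp (𝒢.inv p) q⟩ : 𝒢.Arr) ≠ 0) :
    (⟨y, p⟩ : 𝒢.Out x) = ⟨z, q⟩ := by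
  have hu : (⟨y, y, 𝒢.id y⟩ : 𝒢.Arr) = ⟨y, z, 𝒢.comp (𝒢.inv p) q⟩ := by
    by_contra hn
    exact h (if_neg hn)
  simp only [Arrow.mk.injEq, true_and] at hu
  obtain ⟨rfl, hu⟩ := hu
  have := (EtaleGroupoid.inv_comp_eq p q _).1 (eq_of_heq hu).symm
  rw [this, 𝒢.comp_id]

variable [Algebra ℂ 𝕜] {c : LocConstCocycle 𝒢}

theorem conv_unitSection_left (hc : c.IsNormalized) (f : ∀ a : 𝒢.Arr, S.stalk a.src)
    (a : 𝒢.Arr) : conv S c (unitSection e) f a = e a.src * f a := by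
  obtain ⟨x, y, q⟩ := a
  rw [conv, finsum_eq_single _ (⟨x, 𝒢.id x⟩ : 𝒢.Out x)]
  · have h : 𝒢.comp (𝒢.inv (𝒢.id x)) q = q :=
      (EtaleGroupoid.inv_comp_eq _ _ _).2 (𝒢.id_comp q).symm
    refine (convTerm_of_eq (p := 𝒢.id x) h).trans ?_
    rw [unitSection_id, S.act_id, (hc q).1, Circle.coe_one, map_one, one_smul]
  · rintro ⟨y', p⟩ hp
    by_contra hne
    have h := (convTerm_ne_zero hne).1
    have hu : (⟨x, x, 𝒢.id x⟩ : 𝒢.Arr) = ⟨x, y', p⟩ := by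
      by_contra hn
      exact h (if_neg hn)
    simp only [Arrow.mk.injEq, true_and] at hu
    obtain ⟨rfl, hu⟩ := hu
    exact hp (by rw [eq_of_heq hu])

theorem conv_unitSection_right (hc : c.IsNormalized) (f : ∀ a : 𝒢.Arr, S.stalk a.src)
    (a : 𝒢.Arr) : conv S c f (unitSection e) a = f a * S.act a.hom (e a.tgt) := by
  obtain ⟨x, y, q⟩ := a
  rw [conv, finsum_eq_single _ (⟨y, q⟩ : 𝒢.Out x)]
  · refine (convTerm_of_eq (p := q) (𝒢.inv_comp q)).trans ?_
    rw [unitSection_id, (hc q).2, Circle.coe_one, map_one, one_smul]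
  · rintro ⟨y', p⟩ hp
    by_contra hne
    exact hp (eq_id_of_unitSection_ne_zero (convTerm_ne_zero hne).2)

end UnitSection

variable [Algebra ℂ 𝕜] (S : EquivariantSheaf 𝕜 𝒢) (c : LocConstCocycle 𝒢)

/-- The compactly supported sections of the sheaf which are `1` on large compact sets are local
units of the crossed product. -/
theorem CrossedProduct.hasLocalUnits {c : LocConstCocycle 𝒢} (hc : c.IsNormalized)
    (hS : S.HasCompactUnits) : HasLocalUnits (CrossedProduct S c) := by
  intro s
  obtain ⟨e, he, hec, he1⟩ := hS (⋃ f ∈ s, (Arrow.src '' {a : 𝒢.Arr | f.1 a ≠ 0} ∪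
    Arrow.tgt '' {a : 𝒢.Arr | f.1 a ≠ 0})) (s.isCompact_biUnion fun f _ =>
      (f.2.2.image 𝒢.continuous_src).union (f.2.2.image 𝒢.continuous_tgt))
  refine ⟨⟨unitSection e, unitSection_mem he hec⟩, fun f hf => ⟨Subtype.ext (funext fun a => ?_),
    Subtype.ext (funext fun a => ?_)⟩⟩
  · refine (conv_unitSection_left hc f.1 a).trans ?_
    by_cases h0 : f.1 a = 0
    · rw [h0, mul_zero]
    · rw [he1 _ (Set.mem_iUnion₂.2 ⟨f, hf, Or.inl ⟨a, h0, rfl⟩⟩), one_mul]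
  · refine (conv_unitSection_right hc f.1 a).trans ?_
    by_cases h0 : f.1 a = 0
    · rw [h0, zero_mul]
    · rw [he1 _ (Set.mem_iUnion₂.2 ⟨f, hf, Or.inr ⟨a, h0, rfl⟩⟩), map_one, mul_one]

variable {S c} in
theorem CrossedProduct.sum_apply {ι : Type*} (s : Finset ι) (f : ι → CrossedProduct S c)
    (a : 𝒢.Arr) : (∑ i ∈ s, f i).1 a = ∑ i ∈ s, (f i).1 a := by
  let ev : CrossedProduct S c →+ S.stalk a.src :=
    { toFun := fun f => f.1 a, map_zero' := rfl, map_add' := fun _ _ => rfl }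
  exact map_sum ev f s

open Classical in
/-- Multiplication of the elements of the crossed product by the indicator function of a clopen
set of arrows. -/
noncomputable def CrossedProduct.cut {W : Set 𝒢.Arr} (hW : IsClopen W) :
    CrossedProduct S c →ₗ[𝕜] CrossedProduct S c where
  toFun f := ⟨fun a => if a ∈ W then f.1 a else 0, by
    have h := S.sec_ite hW f.2.1 (S.sec_zero 𝒢.continuous_src)
    refine ⟨h, f.2.2.of_isClosed_subset (S.isClosed_support 𝒢.continuous_src h) fun a ha => ?_⟩
    intro h0
    exact ha (by simp [h0])⟩
  map_add' f g := Subtype.ext (funext fun a => by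
    change (if a ∈ W then f.1 a + g.1 a else 0) =
      (if a ∈ W then f.1 a else 0) + if a ∈ W then g.1 a else 0
    split_ifs <;> simp)
  map_smul' r f := Subtype.ext (funext fun a => by
    change (if a ∈ W then r • f.1 a else 0) = r • if a ∈ W then f.1 a else 0
    split_ifs <;> simp)

open Classical in
theorem CrossedProduct.cut_apply {W : Set 𝒢.Arr} (hW : IsClopen W) (f : CrossedProduct S c)
    (a : 𝒢.Arr) : (CrossedProduct.cut S c hW f).1 a = if a ∈ W then f.1 a else 0 := rfl

variable {S c} in
theorem CrossedProduct.cut_of_mem {W : Set 𝒢.Arr} (hW : IsClopen W) (f : CrossedProduct S c)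
    {a : 𝒢.Arr} (h : a ∈ W) : (CrossedProduct.cut S c hW f).1 a = f.1 a := if_pos h

variable {S c} in
theorem CrossedProduct.cut_of_notMem {W : Set 𝒢.Arr} (hW : IsClopen W) (f : CrossedProduct S c)
    {a : 𝒢.Arr} (h : a ∉ W) : (CrossedProduct.cut S c hW f).1 a = 0 := if_neg h

variable {S c} in
theorem convTerm_congr {f f' g g' : ∀ a : 𝒢.Arr, S.stalk a.src} {x y z : M} {p : 𝒢.Hom x y}
    {q : 𝒢.Hom x z} (hf : f ⟨x, y, p⟩ = f' ⟨x, y, p⟩)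
    (hg : g ⟨y, z, 𝒢.comp (𝒢.inv p) q⟩ = g' ⟨y, z, 𝒢.comp (𝒢.inv p) q⟩) :
    convTerm S c f g p q = convTerm S c f' g' p q := by
  rw [convTerm, convTerm, hf, hg]

variable {S c} in
theorem convTerm_eq_zero {f g : ∀ a : 𝒢.Arr, S.stalk a.src} {x y z : M} {p : 𝒢.Hom x y}
    {q : 𝒢.Hom x z} (h : f ⟨x, y, p⟩ = 0 ∨ g ⟨y, z, 𝒢.comp (𝒢.inv p) q⟩ = 0) :
    convTerm S c f g p q = 0 := by
  by_contra hn
  exact h.elim (convTerm_ne_zero hn).1 (convTerm_ne_zero hn).2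

end

namespace DiscreteAction

variable {M : Type u} [TopologicalSpace M] {𝒢 : EtaleGroupoid M} {ι : Type} [TopologicalSpace ι]
  [DiscreteTopology ι] {𝕜 : Type v} [Field 𝕜] (A : EquivariantSheaf 𝕜 𝒢)
  (α : DiscreteAction 𝒢 ι)

theorem hasCompactUnits_pullbackSheaf [Finite ι] (hA : A.HasCompactUnits) :
    (α.pullbackSheaf A).HasCompactUnits := by
  intro K hK
  obtain ⟨e, he, hec, he1⟩ := hA (Prod.snd '' K) (hK.image continuous_snd)
  refine ⟨fun p => e p.2, continuous_induced_rng.2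
    (continuous_fst.prodMk (he.comp continuous_snd)), ?_, fun p hp => he1 _ ⟨p, hp, rfl⟩⟩
  have : {p : ι × M | e p.2 ≠ 0} = Set.univ ×ˢ {x | e x ≠ 0} := by
    ext p; simp
  exact this ▸ isCompact_univ.prod hec

theorem isClopen_src (i : ι) : IsClopen {a : α.transformation.Arr | a.src.1 = i} :=
  (isClopen_discrete {i}).preimage (continuous_fst.comp α.transformation.continuous_src)

theorem isClopen_tgt (i : ι) : IsClopen {a : α.transformation.Arr | a.tgt.1 = i} :=
  (isClopen_discrete {i}).preimage (continuous_fst.comp α.transformation.continuous_tgt)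

variable [Algebra ℂ 𝕜] (c : LocConstCocycle α.transformation)

/-- The indicator functions of the sheets `{i} × M` of the unit space are multipliers of the
crossed product by `ι ⋊ 𝒢`. -/
noncomputable def peirce [Fintype ι] : PeirceSystem 𝕜 (CrossedProduct (α.pullbackSheaf A) c) ι where
  l i := CrossedProduct.cut _ c (α.isClopen_src i)
  r i := CrossedProduct.cut _ c (α.isClopen_tgt i)
  l_mul i f g := Subtype.ext (funext fun a => by
    by_cases h : a.src.1 = i
    · rw [CrossedProduct.cut_of_mem _ _ h]
      exact finsum_congr fun p => convTerm_congr (CrossedProduct.cut_of_mem _ f h).symm rfl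
    · rw [CrossedProduct.cut_of_notMem _ _ h]
      exact (finsum_eq_zero_of_forall_eq_zero fun p =>
        convTerm_eq_zero (Or.inl (CrossedProduct.cut_of_notMem _ f h))).symm)
  r_mul i f g := Subtype.ext (funext fun a => by
    by_cases h : a.tgt.1 = i
    · rw [CrossedProduct.cut_of_mem _ _ h]
      exact finsum_congr fun p => convTerm_congr rfl (CrossedProduct.cut_of_mem _ g h).symm
    · rw [CrossedProduct.cut_of_notMem _ _ h]
      exact (finsum_eq_zero_of_forall_eq_zero fun p =>
        convTerm_eq_zero (Or.inr (CrossedProduct.cut_of_notMem _ g h))).symm)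
  mul_l i f g := Subtype.ext (funext fun a => finsum_congr fun p => by
    by_cases h : p.1.1 = i
    · exact convTerm_congr (CrossedProduct.cut_of_mem _ f h).symm (CrossedProduct.cut_of_mem _ g h)
    · exact (convTerm_eq_zero (Or.inr (CrossedProduct.cut_of_notMem _ g h))).trans
        (convTerm_eq_zero (Or.inl (CrossedProduct.cut_of_notMem _ f h))).symm)
  l_l i f := Subtype.ext (funext fun a => by
    simp only [CrossedProduct.cut_apply]
    split_ifs <;> rfl)
  r_r i f := Subtype.ext (funext fun a => by
    simp only [CrossedProduct.cut_apply]
    split_ifs <;> rfl)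
  sum_r f := Subtype.ext (funext fun a => by
    rw [CrossedProduct.sum_apply, Finset.sum_eq_single a.tgt.1]
    · exact CrossedProduct.cut_of_mem (α.isClopen_tgt a.tgt.1) f rfl
    · exact fun i _ hi => CrossedProduct.cut_of_notMem (α.isClopen_tgt i) f hi.symm
    · exact fun h => absurd (Finset.mem_univ _) h)

end DiscreteAction

/-! ### The Fourier transform along the fibres -/

namespace UnitaryDual

variable {G : Type w} [Group G] (R : UnitaryDual G)

/-- An index set for a basis of `∏ V_ρ`. -/
abbrev BasisIndex : Type := Σ i : R.ι, Fin (Module.finrank ℂ (R.V i))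

theorem fst_surjective : Function.Surjective (Sigma.fst : R.BasisIndex → R.ι) := fun i =>
  ⟨⟨i, ⟨0, Module.finrank_pos⟩⟩, rfl⟩

/-- A basis of `∏ V_ρ` which is compatible with the product decomposition. -/
noncomputable def basis [Fintype R.ι] : Module.Basis R.BasisIndex ℂ (∀ i, R.V i) :=
  Pi.basis fun i => Module.finBasis ℂ (R.V i)

variable [Fintype R.ι]

theorem basis_repr (v : ∀ i, R.V i) (j : R.BasisIndex) :
    R.basis.repr v j = (Module.finBasis ℂ (R.V j.1)).repr (v j.1) j.2 :=
  Pi.basis_repr _ v j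

open Classical in
theorem basis_apply (j : R.BasisIndex) :
    R.basis j = Pi.single j.1 (Module.finBasis ℂ (R.V j.1) j.2) :=
  Pi.basis_apply _ j

end UnitaryDual

namespace GerbeExtension.Section.Intertwiners

variable {G : Type w} [Group G] [Finite G] {M : Type u} [TopologicalSpace M] {𝔔 : EtaleGroupoid M}
  {E : GerbeExtension G 𝔔} {σ : E.Section} {R : UnitaryDual G} (T : σ.Intertwiners R)

/-- The operator on `∏ V_ρ` by which the arrow `g σ(q)` of `𝔥` acts: its block at `ρ` is
`ρ(g) (T_q^ρ)⁻¹ : V_{q(ρ)} → V_ρ`. -/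
noncomputable def op (g : G) {x y : M} (q : 𝔔.Hom x y) : (∀ i, R.V i) →ₗ[ℂ] ∀ i, R.V i :=
  LinearMap.pi fun i => R.ρ i g ∘ₗ (T.T q i).symm.toLinearEquiv.toLinearMap ∘ₗ LinearMap.proj _

theorem op_apply (g : G) {x y : M} (q : 𝔔.Hom x y) (v : ∀ i, R.V i) (i : R.ι) :
    T.op g q v i = R.ρ i g ((T.T q i).symm (v ((σ.dualAction R).act q i))) := rfl

/-- The operators of the arrows of `𝔥` form a projective representation, whose multiplier is
inverse to the cocycle `c`. -/
theorem defect_smul_op_op {x y z : M} (g₁ g₂ : G) (q₁ : 𝔔.Hom x y) (q₂ : 𝔔.Hom y z)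
    (v : ∀ i, R.V i) (i : R.ι) :
    (T.defect q₁ q₂ i : ℂ) • T.op g₁ q₁ (T.op g₂ q₂ v) i =
      T.op (g₁ * E.ad (σ.lift q₁) g₂ * σ.tau q₁ q₂) (𝔔.comp q₁ q₂) v i := by
  set k := (σ.dualAction R).act q₁ i with hk
  -- `u₁₂` and `u` are the images of the components of `v` under `(T_{q₂} T_{q₁})⁻¹`, `T_{q₁ q₂}⁻¹`
  set u₁₂ : R.V i := (T.T q₁ i).symm ((T.T q₂ k).symm (v ((σ.dualAction R).act q₂ k))) with hu₁₂
  set u : R.V i := (T.T (𝔔.comp q₁ q₂) i).symm (v ((σ.dualAction R).act (𝔔.comp q₁ q₂) i)) with hu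
  have h1 : (T.T q₁ i).symm (R.ρ k g₂ ((T.T q₂ k).symm (v ((σ.dualAction R).act q₂ k)))) =
      R.ρ i (E.ad (σ.lift q₁) g₂) u₁₂ := by
    apply (T.T q₁ i).injective
    rw [T.intertwines, (T.T q₁ i).apply_symm_apply, hu₁₂, (T.T q₁ i).apply_symm_apply]
  have h2 : R.ρ i (σ.tau q₁ q₂) u = (T.defect q₁ q₂ i : ℂ) • u₁₂ := by
    refine T.map_map_injective q₁ q₂ ((T.map_map q₁ q₂ i u).trans ?_)
    have e1 : T.T (𝔔.comp q₁ q₂) i u = v ((σ.dualAction R).act (𝔔.comp q₁ q₂) i) :=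
      (T.T (𝔔.comp q₁ q₂) i).apply_symm_apply _
    have e2 : T.T q₂ k (T.T q₁ i u₁₂) = v ((σ.dualAction R).act q₂ k) := by
      rw [hu₁₂, (T.T q₁ i).apply_symm_apply, (T.T q₂ k).apply_symm_apply]
    have h3 : T.map (𝔔.comp q₁ q₂) ⟨i, u⟩ = T.map q₂ (T.map q₁ ⟨i, u₁₂⟩) := by
      change (⟨_, T.T (𝔔.comp q₁ q₂) i u⟩ : Σ m, R.V m) = ⟨_, T.T q₂ k (T.T q₁ i u₁₂)⟩
      rw [e1, e2]
      exact congrArg (fun m => (⟨m, v m⟩ : Σ m, R.V m)) ((σ.dualAction R).act_comp q₁ q₂ i)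
    have h4 := congrArg (fun a : Σ m, R.V m =>
      (⟨a.1, (T.defect q₁ q₂ i : ℂ) • a.2⟩ : Σ m, R.V m)) h3
    refine (T.map_smul _ _ ⟨i, u⟩).trans (h4.trans ?_)
    exact ((congrArg (T.map q₂) (T.map_smul q₁ _ ⟨i, u₁₂⟩)).trans
      (T.map_smul q₂ _ (T.map q₁ ⟨i, u₁₂⟩))).symm
  change (T.defect q₁ q₂ i : ℂ) • R.ρ i g₁ ((T.T q₁ i).symm (R.ρ k g₂ ((T.T q₂ k).symm
    (v ((σ.dualAction R).act q₂ k))))) =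
    R.ρ i (g₁ * E.ad (σ.lift q₁) g₂ * σ.tau q₁ q₂) u
  rw [h1, map_mul, map_mul, Module.End.mul_apply, Module.End.mul_apply, h2, _root_.map_smul,
    _root_.map_smul]

variable [Fintype R.ι]

/-- The matrix coefficients, in the basis `R.basis`, of the operators of the arrows of `𝔥`. -/
noncomputable def coef (g : G) {x y : M} (q : 𝔔.Hom x y) (j k : R.BasisIndex) : ℂ :=
  R.basis.repr (T.op g q (R.basis k)) j

theorem isLocallyConstant_coef (g : G) (j k : R.BasisIndex) :
    IsLocallyConstant fun a : 𝔔.Arr => T.coef g a.hom j k := by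
  have h := (T.isLocallyConstant j.1).comp fun s : Σ m, R.V j.1 ≃ₗᵢ[ℂ] R.V m =>
    (Module.finBasis ℂ (R.V j.1)).repr (R.ρ j.1 g (s.2.symm (R.basis k s.1))) j.2
  convert h using 2 with a
  exact R.basis_repr _ j

/-- The operator of `g σ(q)` maps `V_{q(ρ)}` to `V_ρ`, so that the other blocks vanish. -/
theorem coef_eq_zero (g : G) {x y : M} {q : 𝔔.Hom x y} {j k : R.BasisIndex}
    (h : (σ.dualAction R).act q j.1 ≠ k.1) : T.coef g q j k = 0 := by
  classical
  rw [coef, R.basis_repr, op_apply, R.basis_apply, Pi.single_eq_of_ne h, map_zero, map_zero,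
    map_zero, Finsupp.zero_apply]

/-- The relation `T.defect_smul_op_op` in terms of matrices. -/
theorem defect_mul_sum_coef {x y z : M} (g₁ g₂ : G) (q₁ : 𝔔.Hom x y) (q₂ : 𝔔.Hom y z)
    (j k : R.BasisIndex) :
    (T.defect q₁ q₂ j.1 : ℂ) * ∑ l, T.coef g₁ q₁ j l * T.coef g₂ q₂ l k =
      T.coef (g₁ * E.ad (σ.lift q₁) g₂ * σ.tau q₁ q₂) (𝔔.comp q₁ q₂) j k := by
  have h : ∑ l, T.coef g₁ q₁ j l * T.coef g₂ q₂ l k =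
      R.basis.repr (T.op g₁ q₁ (T.op g₂ q₂ (R.basis k))) j := by
    conv_rhs => rw [← R.basis.sum_repr (T.op g₂ q₂ (R.basis k))]
    simp only [map_sum, _root_.map_smul, Finsupp.coe_finsetSum, Finset.sum_apply,
      Finsupp.coe_smul, Pi.smul_apply, smul_eq_mul]
    exact Finset.sum_congr rfl fun l _ => mul_comm _ _
  rw [h, R.basis_repr, coef, R.basis_repr, ← T.defect_smul_op_op, _root_.map_smul,
    Finsupp.smul_apply, smul_eq_mul]

variable [Fintype G]

/-- The operators of the arrows over `q` are linearly independent. -/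
theorem eq_zero_of_sum_coef_eq_zero {x y : M} (q : 𝔔.Hom x y) (z : G → ℂ)
    (hz : ∀ j k, ∑ g, z g * T.coef g q j k = 0) : z = 0 := by
  classical
  have h1 : ∑ g, z g • T.op g q = 0 := by
    refine R.basis.ext fun k => R.basis.repr.injective (Finsupp.ext fun j => ?_)
    simpa [coef] using hz j k
  refine R.eq_zero_of_forall_sum_eq_zero z fun i v => ?_
  have h2 := congrFun (LinearMap.congr_fun h1
    (Pi.single ((σ.dualAction R).act q i) (T.T q i v))) i
  simpa [op_apply] using h2

open Classical in
/-- The operators of the arrows over `q` span the elementary matrices of the permitted shape. -/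
theorem exists_sum_coef_eq {x y : M} (q : 𝔔.Hom x y) {j k : R.BasisIndex}
    (h : (σ.dualAction R).act q j.1 = k.1) : ∃ z : G → ℂ, ∀ j' k', ∑ g, z g * T.coef g q j' k' =
      if j' = j ∧ k' = k then 1 else 0 := by
  let φ : R.V j.1 →ₗ[ℂ] ℂ := R.basis.coord k ∘ₗ
    LinearMap.single ℂ R.V ((σ.dualAction R).act q j.1) ∘ₗ (T.T q j.1).toLinearEquiv.toLinearMap
  obtain ⟨z, hz, hz'⟩ := R.exists_rankOne j.1 (Module.finBasis ℂ (R.V j.1) j.2) φ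
  have hφ : ∀ v : ∀ i, R.V i, φ ((T.T q j.1).symm (v ((σ.dualAction R).act q j.1))) =
      R.basis.repr v k := fun v => by
    change R.basis.repr (Pi.single _ (T.T q j.1 ((T.T q j.1).symm _))) k = _
    rw [(T.T q j.1).apply_symm_apply, R.basis_repr, R.basis_repr]
    have : ∀ m, m = k.1 → Pi.single m (v m) k.1 = v k.1 := by
      rintro _ rfl
      exact Pi.single_eq_same _ _
    rw [this _ h]
  have hop : ∀ v, ∑ g, z g • T.op g q v = R.basis.repr v k • R.basis j := fun v => by
    funext i
    simp only [Finset.sum_apply, Pi.smul_apply, op_apply]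
    by_cases hi : i = j.1
    · subst hi
      rw [hz, hφ, R.basis_apply, Pi.single_eq_same]
    · rw [hz' i hi, R.basis_apply, Pi.single_eq_of_ne hi, smul_zero]
  refine ⟨z, fun j' k' => ?_⟩
  have h1 := congrArg (fun v => R.basis.repr v j') (hop (R.basis k'))
  simp only [map_sum, _root_.map_smul, Finsupp.coe_finsetSum, Finset.sum_apply,
      Finsupp.coe_smul, Pi.smul_apply, smul_eq_mul, Module.Basis.repr_self] at h1
  refine h1.trans ?_
  rw [Finsupp.single_apply, Finsupp.single_apply]
  simp only [eq_comm (a := j), ite_and]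
  split_ifs <;> simp_all

/-- The matrix `Z` is a left inverse of the linear map `z ↦ ∑ g, z g * C g t`. -/
def IsDual (C : G → R.BasisIndex × R.BasisIndex → ℂ) (Z : G → R.BasisIndex × R.BasisIndex → ℂ) :
    Prop :=
  ∀ z : G → ℂ, ∀ g, ∑ t, Z g t * ∑ g', z g' * C g' t = z g

open Classical in
/-- A left inverse of a matrix with independent rows, and `0` for other matrices. It is chosen as a
function of the matrix, so that it is locally constant where the matrix is. -/
noncomputable def dual (C : G → R.BasisIndex × R.BasisIndex → ℂ) :
    G → R.BasisIndex × R.BasisIndex → ℂ :=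
  if h : ∃ Z, IsDual C Z then h.choose else 0

/-- The coefficients of the inverse Fourier transform: the dual family of `T.coef`. -/
noncomputable def dualCoef (g : G) {x y : M} (q : 𝔔.Hom x y) (j k : R.BasisIndex) : ℂ :=
  dual (fun g t => T.coef g q t.1 t.2) g (j, k)

theorem isDual {x y : M} (q : 𝔔.Hom x y) : IsDual (fun g t => T.coef g q t.1 t.2)
    (fun g t => T.dualCoef g q t.1 t.2) := by
  classical
  have h : ∃ Z, IsDual (fun g t => T.coef g q t.1 t.2) Z := by
    let L : (G → ℂ) →ₗ[ℂ] (R.BasisIndex × R.BasisIndex → ℂ) :=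
      { toFun := fun z t => ∑ g, z g * T.coef g q t.1 t.2
        map_add' := fun z z' => funext fun t => by
          simp [add_mul, Finset.sum_add_distrib]
        map_smul' := fun r z => funext fun t => by
          simp [Finset.mul_sum, mul_assoc] }
    obtain ⟨L', hL'⟩ := L.exists_leftInverse_of_injective (LinearMap.ker_eq_bot'.2 fun z hz =>
      T.eq_zero_of_sum_coef_eq_zero q z fun j k => congrFun hz (j, k))
    refine ⟨fun g t => L' (Pi.single t 1) g, fun z g => ?_⟩
    have h1 : L' (L z) g = z g := congrFun (LinearMap.congr_fun hL' z) g
    rw [← h1]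
    conv_rhs => rw [pi_eq_sum_univ' (L z)]
    simp only [map_sum, _root_.map_smul, Finset.sum_apply, Pi.smul_apply, smul_eq_mul]
    exact Finset.sum_congr rfl fun t _ => mul_comm _ _
  have : (fun g t => T.dualCoef g q t.1 t.2) = h.choose := by
    simp only [dualCoef, dual]
    rw [dif_pos h]
  rw [this]
  exact h.choose_spec

theorem isLocallyConstant_dualCoef (g : G) (j k : R.BasisIndex) :
    IsLocallyConstant fun a : 𝔔.Arr => T.dualCoef g a.hom j k := by
  have h : IsLocallyConstant fun (a : 𝔔.Arr) (g : G) (t : R.BasisIndex × R.BasisIndex) =>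
      T.coef g a.hom t.1 t.2 := by
    rw [IsLocallyConstant.iff_eventually_eq]
    intro a
    have h1 : ∀ (g : G) (t : R.BasisIndex × R.BasisIndex),
        ∀ᶠ b : 𝔔.Arr in 𝓝 a, T.coef g b.hom t.1 t.2 = T.coef g a.hom t.1 t.2 := fun g t =>
      (T.isLocallyConstant_coef g t.1 t.2).eventually_eq a
    filter_upwards [Filter.eventually_all.2 fun g => Filter.eventually_all.2 (h1 g)] with b hb
    exact funext fun g => funext (hb g)
  exact h.comp fun C => dual C g (j, k)

open Classical in
theorem sum_dualCoef_mul_coef {x y : M} (q : 𝔔.Hom x y) (g g' : G) :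
    ∑ j, ∑ k, T.dualCoef g q j k * T.coef g' q j k = if g' = g then 1 else 0 := by
  have h := T.isDual q (Pi.single g' 1) g
  simp only [Pi.single_apply, ite_mul, one_mul, zero_mul, Finset.sum_ite_eq', Finset.mem_univ,
    if_true] at h
  rw [← Fintype.sum_prod_type', h]
  exact if_congr eq_comm rfl rfl

open Classical in
theorem sum_coef_mul_dualCoef {x y : M} (q : 𝔔.Hom x y) {j k : R.BasisIndex}
    (h : (σ.dualAction R).act q j.1 = k.1) (j' k' : R.BasisIndex) :
    ∑ g, T.coef g q j' k' * T.dualCoef g q j k = if j' = j ∧ k' = k then 1 else 0 := by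
  obtain ⟨z, hz⟩ := T.exists_sum_coef_eq q h
  have h1 : ∀ g, T.dualCoef g q j k = z g := fun g => by
    have h2 := T.isDual q z g
    simp only [hz] at h2
    rw [Finset.sum_eq_single (j, k)] at h2
    · simpa using h2
    · rintro ⟨j', k'⟩ - hne
      rw [if_neg (fun h => hne (Prod.ext h.1 h.2)), mul_zero]
    · simp
  rw [← hz]
  exact Finset.sum_congr rfl fun g _ => by rw [h1, mul_comm]

end GerbeExtension.Section.Intertwiners

/-! ### The arrows of the extension in terms of a section -/

namespace GerbeExtension.Section

variable {G : Type w} [Group G] {M : Type u} [TopologicalSpace M] {𝔔 : EtaleGroupoid M}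
  {E : GerbeExtension G 𝔔} (σ : E.Section)

/-- The arrow `g σ(q)` of `𝔥`. -/
def arr (g : G) {x y : M} (q : 𝔔.Hom x y) : E.tot.Hom x y := E.tot.comp (E.incl x g) (σ.lift q)

theorem proj_arr (g : G) {x y : M} (q : 𝔔.Hom x y) : E.proj (σ.arr g q) = q := by
  rw [arr, E.proj_incl_comp, σ.proj_lift]

theorem arr_injective {x y : M} (q : 𝔔.Hom x y) : Function.Injective fun g => σ.arr g q :=
  E.incl_comp_injective (σ.lift q)

theorem arr_comp_arr (g₁ g₂ : G) {x y z : M} (q₁ : 𝔔.Hom x y) (q₂ : 𝔔.Hom y z) :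
    E.tot.comp (σ.arr g₁ q₁) (σ.arr g₂ q₂) =
      σ.arr (g₁ * E.ad (σ.lift q₁) g₂ * σ.tau q₁ q₂) (𝔔.comp q₁ q₂) := by
  rw [arr, arr, arr, E.incl_mul, E.tot.assoc, E.tot.assoc, σ.incl_tau_comp, E.incl_mul,
    E.tot.assoc]
  congr 1
  rw [← E.tot.assoc, ← E.tot.assoc]
  congr 1
  exact (E.incl_adFun_comp _ _).symm

theorem continuous_arr (g : G) :
    Continuous fun a : 𝔔.Arr => (⟨a.src, a.tgt, σ.arr g a.hom⟩ : E.tot.Arr) :=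
  E.tot.continuous_comp.comp (f := fun a : 𝔔.Arr => (⟨a.src, a.src, a.tgt, E.incl a.src g,
    σ.lift a.hom⟩ : Composable E.tot.toGroupoid)) (continuous_induced_rng.2
    (((E.continuous_incl g).comp 𝔔.continuous_src).prodMk σ.continuous_lift))

theorem exists_arr_eq {x y : M} (h : E.tot.Hom x y) : ∃ g, σ.arr g (E.proj h) = h :=
  E.exists_incl_comp_eq (σ.proj_lift _)

/-- The element `g` of `G` with `h = g σ(q)`, where `q` is the image of `h` in `𝔔`. -/
noncomputable def fibre {x y : M} (h : E.tot.Hom x y) : G := (σ.exists_arr_eq h).choose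

theorem arr_fibre {x y : M} (h : E.tot.Hom x y) : σ.arr (σ.fibre h) (E.proj h) = h :=
  (σ.exists_arr_eq h).choose_spec

theorem fibre_eq {x y : M} {h : E.tot.Hom x y} {g : G} (e : σ.arr g (E.proj h) = h) :
    σ.fibre h = g :=
  σ.arr_injective (E.proj h) ((σ.arr_fibre h).trans e.symm)

theorem fibre_arr (g : G) {x y : M} (q : 𝔔.Hom x y) : σ.fibre (σ.arr g q) = g :=
  σ.fibre_eq (by rw [σ.proj_arr])

/-- If `g` is the value at one arrow, then it is the value wherever the arrows `h` and `g σ(q)`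
agree, an open condition because their sources agree and the source map is locally injective. -/
theorem isLocallyConstant_fibre : IsLocallyConstant fun a : E.tot.Arr => σ.fibre a.hom := by
  rw [IsLocallyConstant.iff_exists_open]
  intro a₀
  refine ⟨_, E.tot.isLocalHomeomorph_src.isLocallyInjective.isOpen_eqLocus
    ((σ.continuous_arr (σ.fibre a₀.hom)).comp E.continuous_proj) _root_.continuous_id rfl,
    congrArg (Arrow.mk _ _) (σ.arr_fibre a₀.hom), fun a ha => σ.fibre_eq ?_⟩
  have h : (⟨a.src, a.tgt, σ.arr (σ.fibre a₀.hom) (E.proj a.hom)⟩ : E.tot.Arr) = a := ha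
  obtain ⟨x, y, h'⟩ := a
  simpa using h

end GerbeExtension.Section

/-! ### The isomorphism with a matrix algebra -/

namespace GerbeExtension.Section.Intertwiners

variable {G : Type w} [Group G] [Finite G] {M : Type u} [TopologicalSpace M] {𝔔 : EtaleGroupoid M}
  {E : GerbeExtension G 𝔔} {σ : E.Section} {R : UnitaryDual G} (T : σ.Intertwiners R)
  [Fintype R.ι] [Fintype G] {𝕜 : Type v} [Field 𝕜] [Algebra ℂ 𝕜] {A : EquivariantSheaf 𝕜 𝔔}

/-- The `(j, k)` entry at the arrow `q` of the Fourier transform of a section `a` over the arrows of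
`𝔥`: the entry of `∑_g a(g σ(q)) ⊗ T.op g q`. -/
noncomputable def fourier (a : ∀ b : E.tot.Arr, A.stalk b.src) (j k : R.BasisIndex) {x y : M}
    (q : 𝔔.Hom x y) : A.stalk x :=
  ∑ g, algebraMap ℂ 𝕜 (T.coef g q j k) • a ⟨x, y, σ.arr g q⟩

theorem fourier_eq_zero (a : ∀ b : E.tot.Arr, A.stalk b.src) {j k : R.BasisIndex} {x y : M}
    {q : 𝔔.Hom x y} (h : (σ.dualAction R).act q j.1 ≠ k.1) : T.fourier a j k q = 0 :=
  Finset.sum_eq_zero fun g _ => by rw [T.coef_eq_zero g h, map_zero, zero_smul]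

theorem exists_ne_zero_of_fourier_ne_zero {a : ∀ b : E.tot.Arr, A.stalk b.src} {j k : R.BasisIndex}
    {x y : M} {q : 𝔔.Hom x y} (h : T.fourier a j k q ≠ 0) : ∃ g, a ⟨x, y, σ.arr g q⟩ ≠ 0 := by
  by_contra! h0
  exact h (Finset.sum_eq_zero fun g _ => by rw [h0, smul_zero])

theorem fourier_add (a a' : ∀ b : E.tot.Arr, A.stalk b.src) (j k : R.BasisIndex) {x y : M}
    (q : 𝔔.Hom x y) :
    T.fourier (fun b => a b + a' b) j k q = T.fourier a j k q + T.fourier a' j k q := by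
  simp only [fourier, smul_add, Finset.sum_add_distrib]

theorem fourier_smul (r : 𝕜) (a : ∀ b : E.tot.Arr, A.stalk b.src) (j k : R.BasisIndex) {x y : M}
    (q : 𝔔.Hom x y) : T.fourier (fun b => r • a b) j k q = r • T.fourier a j k q := by
  simp only [fourier, Finset.smul_sum, smul_comm r]

theorem continuous_fourier {a : ∀ b : E.tot.Arr, A.stalk b.src}
    (ha : Continuous fun b : E.tot.Arr => (⟨b.src, a b⟩ : Germ A.stalk)) (j k : R.BasisIndex) :
    Continuous fun b : 𝔔.Arr => (⟨b.src, T.fourier a j k b.hom⟩ : Germ A.stalk) :=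
  A.sec_sum 𝔔.continuous_src Finset.univ fun g _ => A.sec_locConst_smul
    ((T.isLocallyConstant_coef g j k).comp (algebraMap ℂ 𝕜)) (ha.comp (σ.continuous_arr g))

/-- Fourier inversion. -/
theorem sum_dualCoef_smul_fourier (a : ∀ b : E.tot.Arr, A.stalk b.src) (g : G) {x y : M}
    (q : 𝔔.Hom x y) : ∑ j, ∑ k, algebraMap ℂ 𝕜 (T.dualCoef g q j k) • T.fourier a j k q =
      a ⟨x, y, σ.arr g q⟩ := by
  classical
  have h : ∀ g', ∑ j, ∑ k, algebraMap ℂ 𝕜 (T.dualCoef g q j k) •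
      algebraMap ℂ 𝕜 (T.coef g' q j k) • a ⟨x, y, σ.arr g' q⟩ =
      if g' = g then a ⟨x, y, σ.arr g' q⟩ else 0 := fun g' => by
    simp only [smul_smul, ← map_mul, ← Finset.sum_smul, ← map_sum, T.sum_dualCoef_mul_coef]
    split_ifs <;> simp
  simp only [fourier, Finset.smul_sum]
  rw [Finset.sum_congr rfl fun j _ => Finset.sum_comm, Finset.sum_comm,
    Finset.sum_congr rfl fun g' _ => h g', Finset.sum_ite_eq' Finset.univ g,
    if_pos (Finset.mem_univ g)]

/-- Each family of entries that vanishes outside the permitted blocks is a Fourier transform. -/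
theorem sum_coef_smul_sum_dualCoef {x y : M} (q : 𝔔.Hom x y)
    (f : R.BasisIndex → R.BasisIndex → A.stalk x)
    (hf : ∀ j k, (σ.dualAction R).act q j.1 ≠ k.1 → f j k = 0) (j k : R.BasisIndex) :
    ∑ g, algebraMap ℂ 𝕜 (T.coef g q j k) •
      ∑ j', ∑ k', algebraMap ℂ 𝕜 (T.dualCoef g q j' k') • f j' k' = f j k := by
  classical
  have h : ∀ j' k', ∑ g, algebraMap ℂ 𝕜 (T.coef g q j k) •
      algebraMap ℂ 𝕜 (T.dualCoef g q j' k') • f j' k' =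
      if j = j' then if k = k' then f j' k' else 0 else 0 := fun j' k' => by
    by_cases h0 : (σ.dualAction R).act q j'.1 = k'.1
    · simp only [smul_smul, ← map_mul, ← Finset.sum_smul, ← map_sum, T.sum_coef_mul_dualCoef q h0,
        ite_and]
      split_ifs <;> simp
    · simp [hf j' k' h0]
  simp only [Finset.smul_sum]
  rw [Finset.sum_comm, Finset.sum_congr rfl fun j' _ => Finset.sum_comm]
  simp only [h]
  simp

/-- The Fourier transform turns the convolution on `𝔥` into the product of matrices with entries
in the twisted convolution on `Ĝ ⋊ 𝔔`. -/
theorem fourier_conv (a a' : ∀ b : E.tot.Arr, A.stalk b.src) (j k : R.BasisIndex) {x z : M}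
    (q : 𝔔.Hom x z) (s : Finset (𝔔.Out x))
    (hs : ∀ g (p : 𝔔.Out x), a ⟨x, p.1, σ.arr g p.2⟩ ≠ 0 → p ∈ s) :
    T.fourier (conv (E.pullbackSheaf A) (LocConstCocycle.trivial E.tot) a a') j k q =
      ∑ p ∈ s, ∑ l, algebraMap ℂ 𝕜 (T.defect p.2 (𝔔.comp (𝔔.inv p.2) q) j.1) •
        (T.fourier a j l p.2 * A.act p.2 (T.fourier a' l k (𝔔.comp (𝔔.inv p.2) q))) := by
  classical
  have hpq : ∀ p : 𝔔.Out x, 𝔔.comp p.2 (𝔔.comp (𝔔.inv p.2) q) = q := fun p => by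
    rw [← 𝔔.assoc, 𝔔.comp_inv, 𝔔.id_comp]
  -- if `g = γ p g₁ g₂` then `(g₁ σ(p)) (g₂ σ(p⁻¹ q)) = g σ(q)`
  let γ : 𝔔.Out x → G → G ≃ G := fun p g₁ => ((E.ad (σ.lift p.2)).toEquiv.trans
    (Equiv.mulLeft g₁)).trans (Equiv.mulRight (σ.tau p.2 (𝔔.comp (𝔔.inv p.2) q)))
  have hγ : ∀ p g₁ g₂, E.tot.comp (σ.arr g₁ p.2) (σ.arr g₂ (𝔔.comp (𝔔.inv p.2) q)) =
      σ.arr (γ p g₁ g₂) q := fun p g₁ g₂ => by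
    rw [σ.arr_comp_arr, hpq]
    rfl
  let t : 𝔔.Out x × G → G → A.stalk x := fun r g₂ => a ⟨x, r.1.1, σ.arr r.2 r.1.2⟩ *
    A.act r.1.2 (a' ⟨r.1.1, z, σ.arr g₂ (𝔔.comp (𝔔.inv r.1.2) q)⟩)
  have hconv : ∀ g, conv (E.pullbackSheaf A) (LocConstCocycle.trivial E.tot) a a'
      ⟨x, z, σ.arr g q⟩ = ∑ p ∈ s, ∑ g₁, t (p, g₁) ((γ p g₁).symm g) := fun g => by
    let e : 𝔔.Out x × G ↪ E.tot.Out x := ⟨fun r => ⟨r.1.1, σ.arr r.2 r.1.2⟩, by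
      rintro ⟨⟨y, p⟩, g₁⟩ ⟨⟨y', p'⟩, g₁'⟩ h
      simp only [Sigma.mk.injEq] at h
      obtain ⟨rfl, h⟩ := h
      have h := eq_of_heq h
      have hp : p = p' := by rw [← σ.proj_arr g₁ p, h, σ.proj_arr]
      subst hp
      rw [σ.arr_injective p h]⟩
    refine (conv_eq_sum (S := E.pullbackSheaf A) (f := a) (g := a') ⟨x, z, σ.arr g q⟩
      ((s ×ˢ Finset.univ).map e) fun p hp => ?_).trans
      (((Finset.sum_map _ _ _).trans (Finset.sum_product _ _ _)).trans ?_)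
    rotate_left
    · refine Finset.sum_congr rfl fun p _ => Finset.sum_congr rfl fun g₁ _ => ?_
      have h1 : E.tot.comp (E.tot.inv (σ.arr g₁ p.2)) (σ.arr g q) =
          σ.arr ((γ p g₁).symm g) (𝔔.comp (𝔔.inv p.2) q) :=
        (EtaleGroupoid.inv_comp_eq _ _ _).2 (by rw [hγ, Equiv.apply_symm_apply])
      refine (convTerm_of_eq (S := E.pullbackSheaf A) (p := σ.arr g₁ p.2) h1).trans ?_
      change algebraMap ℂ 𝕜 ((1 : Circle) : ℂ) • (a ⟨x, p.1, σ.arr g₁ p.2⟩ *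
        A.act (E.proj (σ.arr g₁ p.2)) _) = _
      rw [Circle.coe_one, map_one, one_smul, σ.proj_arr]
    · obtain ⟨y, h⟩ := p
      rw [← σ.arr_fibre h] at hp ⊢
      exact Finset.mem_map.2 ⟨(⟨y, E.proj h⟩, σ.fibre h),
        Finset.mem_product.2 ⟨hs _ ⟨y, E.proj h⟩ hp, Finset.mem_univ _⟩, rfl⟩
  simp only [fourier, hconv, Finset.smul_sum]
  rw [Finset.sum_comm]
  refine Finset.sum_congr rfl fun p _ => ?_
  rw [Finset.sum_comm]
  have h1 : ∀ g₁, ∑ g, algebraMap ℂ 𝕜 (T.coef g q j k) • t (p, g₁) ((γ p g₁).symm g) =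
      ∑ g₂, ∑ l, (algebraMap ℂ 𝕜 (T.defect p.2 (𝔔.comp (𝔔.inv p.2) q) j.1) *
        (algebraMap ℂ 𝕜 (T.coef g₁ p.2 j l) *
          algebraMap ℂ 𝕜 (T.coef g₂ (𝔔.comp (𝔔.inv p.2) q) l k))) • t (p, g₁) g₂ := fun g₁ => by
    refine (Fintype.sum_equiv (γ p g₁) _ _ fun g₂ => ?_).symm
    have h2 := T.defect_mul_sum_coef g₁ g₂ p.2 (𝔔.comp (𝔔.inv p.2) q) j k
    rw [hpq] at h2
    change T.defect p.2 (𝔔.comp (𝔔.inv p.2) q) j.1 * _ = T.coef (γ p g₁ g₂) q j k at h2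
    rw [Equiv.symm_apply_apply, ← h2, ← Finset.sum_smul]
    simp only [map_mul, map_sum, Finset.mul_sum]
  rw [Finset.sum_congr rfl fun g₁ _ => h1 g₁]
  simp only [map_sum, Finset.sum_mul, Finset.mul_sum, Finset.smul_sum, _root_.map_smul,
    smul_mul_assoc, mul_smul_comm, smul_smul]
  rw [Finset.sum_congr rfl fun g₁ _ => Finset.sum_comm, Finset.sum_comm]
  refine Finset.sum_congr rfl fun l _ => ?_
  rw [Finset.sum_comm]
  exact Finset.sum_congr rfl fun g₂ _ => Finset.sum_congr rfl fun g₁ _ => by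
    rw [mul_comm (algebraMap ℂ 𝕜 (T.coef g₁ p.2 j l))]

open Classical in
/-- The Fourier transform, as a map from the crossed product by `𝔥` to matrices with entries in the
twisted crossed product by `Ĝ ⋊ 𝔔`: the `(j, k)` entry is supported on the arrows with source in
the sheet of `Ĝ × M` to which `j` belongs. -/
noncomputable def matrix : CrossedProduct (E.pullbackSheaf A) (LocConstCocycle.trivial E.tot) →ₗ[𝕜]
    R.BasisIndex → R.BasisIndex → CrossedProduct ((σ.dualAction R).pullbackSheaf A) T.cocycle where
  toFun a j k := ⟨fun b => if b ∈ {b : (σ.dualAction R).transformation.Arr | b.src.1 = j.1} then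
      T.fourier (A := A) a.1 j k b.hom.1 else 0, by
    have h1 : Continuous fun b : (σ.dualAction R).transformation.Arr => (⟨b.src.2, b.tgt.2,
        b.hom.1⟩ : 𝔔.Arr) := continuous_snd.comp (σ.dualAction R).arrowHomeo.continuous
    have h2 := ((σ.dualAction R).pullbackSheaf A).sec_ite ((σ.dualAction R).isClopen_src j.1)
      (φ := Arrow.src) (a := fun b => T.fourier (A := A) a.1 j k b.hom.1)
      (continuous_induced_rng.2 ((continuous_fst.comp
        (σ.dualAction R).transformation.continuous_src).prodMk
          ((T.continuous_fourier a.2.1 j k).comp h1)))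
      (((σ.dualAction R).pullbackSheaf A).sec_zero (σ.dualAction R).transformation.continuous_src)
    refine ⟨h2, ((σ.dualAction R).arrowHomeo.isCompact_preimage.2 (isCompact_univ.prod
      (a.2.2.image E.continuous_proj))).of_isClosed_subset
      (((σ.dualAction R).pullbackSheaf A).isClosed_support
        (σ.dualAction R).transformation.continuous_src h2) fun b hb => ⟨trivial, ?_⟩⟩
    have hb' : T.fourier (A := A) a.1 j k b.hom.1 ≠ 0 := fun h =>
      hb ((if_congr Iff.rfl h rfl).trans (ite_self _))
    obtain ⟨g, hg⟩ := T.exists_ne_zero_of_fourier_ne_zero hb'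
    exact ⟨⟨b.src.2, b.tgt.2, σ.arr g b.hom.1⟩, hg,
      congrArg (Arrow.mk _ _) (σ.proj_arr g b.hom.1)⟩⟩
  map_add' a a' := by
    funext j k
    refine Subtype.ext (funext fun b => ?_)
    have h : T.fourier (A := A) (a + a').1 j k b.hom.1 =
        T.fourier (A := A) a.1 j k b.hom.1 + T.fourier (A := A) a'.1 j k b.hom.1 :=
      T.fourier_add (A := A) a.1 a'.1 j k b.hom.1
    change (if b ∈ _ then T.fourier (A := A) (a + a').1 j k b.hom.1 else 0) =
      (if b ∈ _ then T.fourier (A := A) a.1 j k b.hom.1 else 0) +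
        (if b ∈ _ then T.fourier (A := A) a'.1 j k b.hom.1 else 0)
    rw [h]
    split_ifs <;> simp
  map_smul' r a := by
    funext j k
    refine Subtype.ext (funext fun b => ?_)
    have h : T.fourier (A := A) (r • a).1 j k b.hom.1 =
        r • T.fourier (A := A) a.1 j k b.hom.1 :=
      T.fourier_smul (A := A) r a.1 j k b.hom.1
    change (if b ∈ _ then T.fourier (A := A) (r • a).1 j k b.hom.1 else 0) =
      r • (if b ∈ _ then T.fourier (A := A) a.1 j k b.hom.1 else 0)
    rw [h]
    split_ifs <;> simp

section

variable (a a' : CrossedProduct (E.pullbackSheaf A) (LocConstCocycle.trivial E.tot))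

theorem matrix_of_eq {j k : R.BasisIndex} {b : (σ.dualAction R).transformation.Arr}
    (h : b.src.1 = j.1) : (T.matrix a j k).1 b = T.fourier (A := A) a.1 j k b.hom.1 := if_pos h

theorem matrix_of_ne {j k : R.BasisIndex} {b : (σ.dualAction R).transformation.Arr}
    (h : b.src.1 ≠ j.1) : (T.matrix a j k).1 b = 0 := if_neg h

theorem peirce_l_matrix (j k : R.BasisIndex) :
    ((σ.dualAction R).peirce A T.cocycle).l j.1 (T.matrix a j k) = T.matrix a j k :=
  Subtype.ext (funext fun b => by
    by_cases h : b.src.1 = j.1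
    · exact CrossedProduct.cut_of_mem ((σ.dualAction R).isClopen_src j.1) _ h
    · exact (CrossedProduct.cut_of_notMem ((σ.dualAction R).isClopen_src j.1) _ h).trans
        (T.matrix_of_ne a h).symm)

/-- The `(j, k)` entry vanishes at `q` unless `q` carries the class of `j` to that of `k`. -/
theorem peirce_r_matrix (j k : R.BasisIndex) :
    ((σ.dualAction R).peirce A T.cocycle).r k.1 (T.matrix a j k) = T.matrix a j k :=
  Subtype.ext (funext fun b => by
    by_cases h : b.tgt.1 = k.1
    · exact CrossedProduct.cut_of_mem ((σ.dualAction R).isClopen_tgt k.1) _ h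
    · refine (CrossedProduct.cut_of_notMem ((σ.dualAction R).isClopen_tgt k.1) _ h).trans ?_
      by_cases h' : b.src.1 = j.1
      · exact ((T.matrix_of_eq a h').trans (T.fourier_eq_zero _ (by rwa [← h', b.hom.2]))).symm
      · exact (T.matrix_of_ne a h').symm)

theorem matrix_injective : Function.Injective (T.matrix (A := A)) := by
  rw [← LinearMap.ker_eq_bot, LinearMap.ker_eq_bot']
  intro a ha
  refine Subtype.ext (funext fun b => ?_)
  obtain ⟨x, y, h⟩ := b
  have h1 := T.sum_dualCoef_smul_fourier (A := A) a.1 (σ.fibre h) (E.proj h)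
  rw [σ.arr_fibre] at h1
  refine h1.symm.trans (Finset.sum_eq_zero fun j _ => Finset.sum_eq_zero fun k _ => ?_)
  have h2 : T.matrix a j k = 0 := congrFun (congrFun ha j) k
  let b : (σ.dualAction R).transformation.Arr :=
    ⟨(j.1, x), (_, y), (σ.dualAction R).arrow j.1 (E.proj h)⟩
  have h3 : (T.matrix a j k).1 b = 0 := by
    rw [h2]
    rfl
  have h4 : T.fourier (A := A) a.1 j k (E.proj h) = 0 :=
    (T.matrix_of_eq a (b := b) rfl).symm.trans h3
  rw [h4, smul_zero]

theorem matrix_mul (j k : R.BasisIndex) :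
    T.matrix (a * a') j k = ∑ l, T.matrix a j l * T.matrix a' l k := by
  classical
  refine Subtype.ext (funext fun b => ?_)
  rw [CrossedProduct.sum_apply]
  obtain ⟨⟨i, x⟩, ⟨i', z⟩, ⟨q, hq⟩⟩ := b
  by_cases h : i = j.1
  · subst h
    have hfin := 𝔔.finite_out (a.2.2.image E.continuous_proj) x
    refine (T.matrix_of_eq (a * a') rfl).trans ((T.fourier_conv (A := A) a.1 a'.1 j k q
      hfin.toFinset fun g p hp => (Set.Finite.mem_toFinset _).2 ⟨_, hp, ?_⟩).trans ?_)
    · exact congrArg (Arrow.mk x p.1) (σ.proj_arr g p.2)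
    · rw [Finset.sum_comm]
      refine Finset.sum_congr rfl fun l _ => Eq.symm ?_
      let e : 𝔔.Out x ↪ (σ.dualAction R).transformation.Out (j.1, x) :=
        ⟨fun p => ⟨(_, p.1), (σ.dualAction R).arrow j.1 p.2⟩, fun p p' h =>
          congrArg (fun r : (σ.dualAction R).transformation.Out (j.1, x) =>
            (⟨r.1.2, r.2.1⟩ : 𝔔.Out x)) h⟩
      refine (conv_eq_sum _ (hfin.toFinset.map e) ?_).trans ((Finset.sum_map _ _ _).trans
        (Finset.sum_congr rfl fun p _ => ?_))
      · rintro ⟨⟨m, y⟩, ⟨(p : 𝔔.Hom x y), (hm : (σ.dualAction R).act p j.1 = m)⟩⟩ hp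
        subst hm
        have hp' : T.fourier (A := A) a.1 j l p ≠ 0 := fun h0 =>
          hp ((T.matrix_of_eq a rfl).trans h0)
        obtain ⟨g, hg⟩ := T.exists_ne_zero_of_fourier_ne_zero hp'
        exact Finset.mem_map.2 ⟨⟨y, p⟩, (Set.Finite.mem_toFinset _).2
          ⟨⟨x, y, σ.arr g p⟩, hg, congrArg (Arrow.mk x y) (σ.proj_arr g p)⟩, rfl⟩
      · have h1 : (T.matrix a j l).1 ⟨(j.1, x), (e p).1, (e p).2⟩ =
            T.fourier (A := A) a.1 j l p.2 := T.matrix_of_eq a rfl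
        by_cases h2 : (σ.dualAction R).act p.2 j.1 = l.1
        · have h3 : (T.matrix a' l k).1 ⟨(e p).1, (i', z), (σ.dualAction R).transformation.comp
              ((σ.dualAction R).transformation.inv (e p).2) ⟨q, hq⟩⟩ =
              T.fourier (A := A) a'.1 l k (𝔔.comp (𝔔.inv p.2) q) := T.matrix_of_eq a' h2
          exact congrArg₂ (fun u v => algebraMap ℂ 𝕜 (T.defect p.2 (𝔔.comp (𝔔.inv p.2) q) j.1) •
            (u * A.act p.2 v)) h1 h3
        · have h3 := T.fourier_eq_zero (A := A) a.1 h2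
          refine (convTerm_eq_zero (Or.inl (h1.trans h3))).trans ?_
          rw [h3, zero_mul, smul_zero]
          rfl
  · refine (T.matrix_of_ne (a * a') h).trans (Finset.sum_eq_zero fun l _ => ?_).symm
    exact finsum_eq_zero_of_forall_eq_zero fun p =>
      convTerm_eq_zero (Or.inl (T.matrix_of_ne a h))

theorem exists_matrix_eq
    (F : R.BasisIndex → R.BasisIndex → CrossedProduct ((σ.dualAction R).pullbackSheaf A) T.cocycle)
    (hl : ∀ j k, ((σ.dualAction R).peirce A T.cocycle).l j.1 (F j k) = F j k)
    (hr : ∀ j k, ((σ.dualAction R).peirce A T.cocycle).r k.1 (F j k) = F j k) :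
    ∃ a, T.matrix a = F := by
  -- the entries of `F` as functions of the arrows of `𝔔`
  let f : ∀ {x y : M}, 𝔔.Hom x y → R.BasisIndex → R.BasisIndex → A.stalk x := fun {x y} q j k =>
    (F j k).1 ⟨(j.1, x), (_, y), (σ.dualAction R).arrow j.1 q⟩
  have hf0 : ∀ {x y : M} (q : 𝔔.Hom x y) j k, (σ.dualAction R).act q j.1 ≠ k.1 → f q j k = 0 :=
    fun {x y} q j k h => by
      change (F j k).1 ⟨(j.1, x), (_, y), (σ.dualAction R).arrow j.1 q⟩ = 0
      rw [← hr]
      exact CrossedProduct.cut_of_notMem ((σ.dualAction R).isClopen_tgt k.1) _ h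
  have hf : ∀ j k, Continuous fun b : 𝔔.Arr => (⟨b.src, f b.hom j k⟩ : Germ A.stalk) := fun j k =>
    (continuous_snd.comp (DiscreteAction.germHomeo R.ι A.stalk).continuous).comp ((F j k).2.1.comp
      ((σ.dualAction R).arrowHomeo.symm.continuous.comp
        (continuous_const.prodMk _root_.continuous_id)))
  let a₀ : ∀ b : E.tot.Arr, A.stalk b.src := fun b => ∑ j, ∑ k,
    algebraMap ℂ 𝕜 (T.dualCoef (σ.fibre b.hom) (E.proj b.hom) j k) • f (E.proj b.hom) j k
  have hcoef : ∀ j k, IsLocallyConstant fun b : E.tot.Arr =>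
      T.dualCoef (σ.fibre b.hom) (E.proj b.hom) j k := fun j k => by
    rw [IsLocallyConstant.iff_eventually_eq]
    intro b₀
    filter_upwards [σ.isLocallyConstant_fibre.eventually_eq b₀,
      ((T.isLocallyConstant_dualCoef (σ.fibre b₀.hom) j k).comp_continuous
        E.continuous_proj).eventually_eq b₀] with b h1 h2
    rw [h1]
    exact h2
  have hcont : Continuous fun b : E.tot.Arr => (⟨b.src, a₀ b⟩ : Germ A.stalk) :=
    A.sec_sum E.tot.continuous_src _ fun j _ => A.sec_sum E.tot.continuous_src _ fun k _ =>
      A.sec_locConst_smul ((hcoef j k).comp (algebraMap ℂ 𝕜)) ((hf j k).comp E.continuous_proj)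
  have hcpt : IsCompact {b | a₀ b ≠ 0} := by
    refine (isCompact_iUnion fun t : G × R.BasisIndex × R.BasisIndex =>
      (((F t.2.1 t.2.2).2.2.image (σ.dualAction R).arrowHomeo.continuous).image
        continuous_snd).image (σ.continuous_arr t.1)).of_isClosed_subset
      (A.isClosed_support E.tot.continuous_src hcont) fun b hb => ?_
    obtain ⟨j, -, hj⟩ := Finset.exists_ne_zero_of_sum_ne_zero hb
    obtain ⟨k, -, hk⟩ := Finset.exists_ne_zero_of_sum_ne_zero hj
    refine Set.mem_iUnion.2 ⟨(σ.fibre b.hom, j, k), ⟨b.src, b.tgt, E.proj b.hom⟩,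
      ⟨_, ⟨⟨(j.1, b.src), (_, b.tgt), (σ.dualAction R).arrow j.1 (E.proj b.hom)⟩, ?_, rfl⟩, rfl⟩,
      congrArg (Arrow.mk _ _) (σ.arr_fibre b.hom)⟩
    intro h
    have h' : f (E.proj b.hom) j k = 0 := h
    exact hk (by rw [h', smul_zero])
  have ha₀ : ∀ g {x y : M} (q : 𝔔.Hom x y), a₀ ⟨x, y, σ.arr g q⟩ =
      ∑ j, ∑ k, algebraMap ℂ 𝕜 (T.dualCoef g q j k) • f q j k := fun g {x y} q => by
    simp only [a₀, σ.fibre_arr, σ.proj_arr]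
  refine ⟨⟨a₀, hcont, hcpt⟩, funext fun j => funext fun k => Subtype.ext (funext fun b => ?_)⟩
  obtain ⟨⟨i, x⟩, ⟨i', y⟩, ⟨(q : 𝔔.Hom x y), (hi : (σ.dualAction R).act q i = i')⟩⟩ := b
  subst hi
  by_cases h : i = j.1
  · subst h
    refine (T.matrix_of_eq _ rfl).trans ?_
    change T.fourier a₀ j k q = f q j k
    simp only [fourier, ha₀]
    exact T.sum_coef_smul_sum_dualCoef q (f q) (hf0 q) j k
  · rw [← hl]
    exact (T.matrix_of_ne _ h).trans
      (CrossedProduct.cut_of_notMem ((σ.dualAction R).isClopen_src j.1) _ h).symm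

end

end GerbeExtension.Section.Intertwiners

open GerbeExtension.Section in
/-- The matrix algebra in question is taken over the basis vectors of `∏ V_ρ`; each class `ρ`
occurs, since no `V_ρ` is zero. -/
theorem moritaEquivalent_of_intertwiners {𝕜 : Type v} [Field 𝕜] [Algebra ℂ 𝕜] {M : Type u}
    [TopologicalSpace M] {G : Type w} [Group G] [Finite G] {𝔔 : EtaleGroupoid M}
    {E : GerbeExtension G 𝔔} {σ : E.Section} {R : UnitaryDual G} (T : σ.Intertwiners R)
    (A : EquivariantSheaf 𝕜 𝔔) (hA : A.HasCompactUnits) : MoritaEquivalent 𝕜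
      (CrossedProduct (E.pullbackSheaf A) (LocConstCocycle.trivial E.tot))
      (CrossedProduct ((σ.dualAction R).pullbackSheaf A) T.cocycle) := by
  have := R.finite_index
  have := Fintype.ofFinite R.ι
  have := Fintype.ofFinite G
  exact MoritaEquivalent.of_matrix
    (CrossedProduct.hasLocalUnits (E.pullbackSheaf A) (fun _ => ⟨rfl, rfl⟩) hA)
    (CrossedProduct.hasLocalUnits ((σ.dualAction R).pullbackSheaf A)
      (fun g => ⟨T.defect_id_left g.1 _, T.defect_id_right g.1 _⟩)
      ((σ.dualAction R).hasCompactUnits_pullbackSheaf A hA))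
    ((σ.dualAction R).peirce A T.cocycle) R.fst_surjective T.matrix T.matrix_injective T.matrix_mul
    T.peirce_l_matrix T.peirce_r_matrix T.exists_matrix_eq

end GerbeDuality

theorem mainTheorem2 {𝕜 : Type v} [Field 𝕜] [Algebra ℂ 𝕜] {M : Type u} [TopologicalSpace M]
    {G : Type w} [Group G] [Finite G] {𝔔 : EtaleGroupoid M} (hproper : 𝔔.IsProper)
    (hcontr : IsUnionOfContractibles 𝔔.Arr) (E : GerbeExtension G 𝔔) (R : UnitaryDual G)
    (A : EquivariantSheaf 𝕜 𝔔) (hA : A.HasCompactUnits) :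
    Nonempty E.Section ∧
    ∀ σ : E.Section, Nonempty (σ.Intertwiners R) ∧
    ∀ T : σ.Intertwiners R, ∃ c : LocConstCocycle (σ.dualAction R).transformation,
      T.IsDefect c ∧
      MoritaEquivalent 𝕜
        (CrossedProduct (E.pullbackSheaf A) (LocConstCocycle.trivial E.tot))
        (CrossedProduct ((σ.dualAction R).pullbackSheaf A) c) := by
  exact ⟨E.nonempty_section hcontr, fun σ => ⟨σ.nonempty_intertwiners R, fun T =>
    ⟨T.cocycle, T.isDefect_cocycle, moritaEquivalent_of_intertwiners T A hA⟩⟩⟩
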